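/- **Theorem 3.5 (Generic Structural Stability and Approximation Theorem).** Let $U\subseteq\mathbb R^2$ be open and $F_0,G_0\in C^2(U)$, and consider the system $u_t+F_0(u,v)_x=0$, $v_t+G_0(u,v)_x=0$ with Riemann data $(u_l,v_l)$ for $x<0$ and $(u_r,v_r)$ for $x>0$. *Notation.* For a flux $(F,G)$ let $J$ be its Jacobian matrix, with eigenvalues $\lambda_1<\lambda_2$ (the smaller and the larger root of the characteristic polynomial), and for a given state $g=(u_g,v_g)$ let $H_g(u,v)=(F(u,v)-F(g))(v-v_g)-(G(u,v)-G(g))(u-u_g)$. Let $D$ be a set of states ($D=U$ for $(F_0,G_0)$; $D=K$ compact for fluxes given on $K$). - The Hugoniot locus $\mathcal H_g$ in $D$ is $\{p\in D: H_g(p)=0\}$. The rarefaction curve $\mathcal R_{k,g}$ in $D$ is the set of $p\in D$ joined to $g$ by a solution of $(J(w(\xi))-\xi)w'(\xi)=0$, $\lambda_k(w(\xi))=\xi$, with $\xi$ running between $\lambda_k(g)$ and $\lambda_k(p)$, followed only until it first hits $\partial D$ (so $w(\xi)\in\operatorname{int}D$ except possibly at the end point $p$). - A $1$-shock from $l$ to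 $r$ is a jump with $F(r)-F(l)=s(u_r-u_l)$, $G(r)-G(l)=s(v_r-v_l)$ and $\lambda_1(l)>s>\lambda_1(r)$, $s<\lambda_2(r)$; a $2$-shock is one with $\lambda_2(l)>s>\lambda_2(r)$, $s>\lambda_1(l)$. - The forward $1$-wave curve of $l$ in $D$ consists of the states in $D$ to which $l$ is joined by a $1$-shock and of the $p\in\mathcal R_{1,l}$ with $\lambda_1(p)\ge\lambda_1(l)$. The backward $2$-wave curve of $r$ in $D$ consists of the states in $D$ joined to $r$ by a $2$-shock and of the $p\in\mathcal R_{2,r}$ with $\lambda_2(p)\le\lambda_2(r)$. - The Riemann problem has a *unique double-wave entropy solution* in $D$ with intermediate state $m$ if these two wave curves meet exactly at the one point $m$ and $m\ne l,r$. Its *type* records whether $m$ lies on the shock or the rarefaction part of each of the two wave curves. - The *transversality property on $K$* for $l,r$: for every choice $\mathcal W_l\in\{\mathcal H_l,\mathcal R_{1,l}\}$ and $\mathcal W_r\in\{\mathcal H_r,\mathcal R_{2,r}\}$ in $K$, the set $(\mathcal W_l\cap\mathcal W_r)\setminus\{l,r\}$ is finite, and at each of its points both curves are regular, with tangent lines that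 span $\mathbb R^2$. *Assumptions.* (i) $J$ has two distinct real eigenvalues at every point of $U$; (ii) $\nabla\lambda_k\cdot r_k\neq0$ in $U$ for $k=1,2$ and every eigenvector $r_k$ of $J$ for $\lambda_k$; (iii) either $(F_0)_v\ne0$ on all of $U$ or $(G_0)_u\neq0$ on all of $U$; (iv) for every $g\in U$, $0$ is a regular value of $H_g$ restricted to $U\setminus\{g\}$. *Conclusion.* For almost every $(u_l,v_l,u_r,v_r)\in U^2$ (Lebesgue measure) the following holds. Suppose that the Riemann problem for $(F_0,G_0)$ has a unique double-wave entropy solution in $U$, with intermediate state $(u^*,v^*)$, and let $K\subset U$ be compact such that $\operatorname{int}K$ contains $(u_l,v_l)$, $(u_r,v_r)$, $(u^*,v^*)$ and all the states in the rarefaction waves of this solution. Then for every $\varepsilon_2>0$ there is $\varepsilon_1>0$ such that for all $F_\delta,G_\delta\in C^2(K)$ (restrictions to $K$ of functions that are $C^2$ in a neighbourhood of $K$, with the supremum over $K$ of the derivatives of order $\le2$ as norm) and all $\delta u_l,\delta v_l,\delta u_r,\delta v_r\in\mathbb R$ with $\|(F_\delta,G_\delta,\delta u_l,\delta v_l,\delta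 u_r,\delta v_r)\|_{C^2(K)^2\times\mathbb R^4}<\varepsilon_1$, the system with fluxes $F_0+F_\delta$, $G_0+G_\delta$ on $K$ and states $(\tilde u_l,\tilde v_l)=(u_l+\delta u_l,v_l+\delta v_l)$, $(\tilde u_r,\tilde v_r)=(u_r+\delta u_r,v_r+\delta v_r)$ has the transversality property on $K$ and admits a unique double-wave entropy solution in $K$; this solution is of the same type, and its intermediate state $(\tilde u^*,\tilde v^*)\in\operatorname{int}K$ satisfies $\|(\tilde u^*,\tilde v^*)-(u^*,v^*)\|_2<\varepsilon_2$. -/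

import Mathlib

open Set Filter Topology MeasureTheory

noncomputable section

namespace Riemann

/-- The partial derivative in the first variable `u`. -/
def du (f : ℝ × ℝ → ℝ) (p : ℝ × ℝ) : ℝ := fderiv ℝ f p (1, 0)

/-- The partial derivative in the second variable `v`. -/
def dv (f : ℝ × ℝ → ℝ) (p : ℝ × ℝ) : ℝ := fderiv ℝ f p (0, 1)

/-- The Jacobian of the flux `(F, G)` at `p`, as an endomorphism of `ℝ²`. -/
def jac (F G : ℝ × ℝ → ℝ) (p : ℝ × ℝ) : Module.End ℝ (ℝ × ℝ) :=
  ((fderiv ℝ F p).prod (fderiv ℝ G p)).toLinearMap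

/-- The discriminant of the characteristic polynomial of the Jacobian. -/
def disc (F G : ℝ × ℝ → ℝ) (p : ℝ × ℝ) : ℝ :=
  (du F p + dv G p) ^ 2 - 4 * (du F p * dv G p - dv F p * du G p)

/-- The `k`-th characteristic speed `λ_k`, for `k = 1, 2` (so that `λ_1 < λ_2` whenever the
Jacobian has two distinct real eigenvalues). -/
def lam (F G : ℝ × ℝ → ℝ) (k : ℕ) (p : ℝ × ℝ) : ℝ :=
  (du F p + dv G p + (2 * (k : ℝ) - 3) * √(disc F G p)) / 2

/-- Strict hyperbolicity in `U`. -/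
def StrictlyHyperbolic (U : Set (ℝ × ℝ)) (F G : ℝ × ℝ → ℝ) : Prop :=
  ∀ p ∈ U, ∃ a b : ℝ, a ≠ b ∧ (jac F G p).HasEigenvalue a ∧ (jac F G p).HasEigenvalue b

/-- Genuine nonlinearity in `U` : `∇λ_k · r_k ≠ 0` for both families. As this does not depend on
the scaling of the eigenvector, all eigenvectors are allowed. -/
def GenuinelyNonlinear (U : Set (ℝ × ℝ)) (F G : ℝ × ℝ → ℝ) : Prop :=
  ∀ p ∈ U, ∀ k : ℕ, k = 1 ∨ k = 2 → ∀ r : ℝ × ℝ,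
    (jac F G p).HasEigenvector (lam F G k p) r → fderiv ℝ (lam F G k) p r ≠ 0

/-- The graph condition in `U`. -/
def GraphCondition (U : Set (ℝ × ℝ)) (F G : ℝ × ℝ → ℝ) : Prop :=
  (∀ p ∈ U, dv F p ≠ 0) ∨ (∀ p ∈ U, du G p ≠ 0)

/-- The Hugoniot objective function `p ↦ H_g(p)` of the given state `g`. -/
def hugoniot (F G : ℝ × ℝ → ℝ) (g p : ℝ × ℝ) : ℝ :=
  (F p - F g) * (p.2 - g.2) - (G p - G g) * (p.1 - g.1)

/-- The regular manifold assumption: for every `g ∈ U`, zero is a regular value of `H_g`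
restricted to `U \ {g}`. -/
def RegularManifold (U : Set (ℝ × ℝ)) (F G : ℝ × ℝ → ℝ) : Prop :=
  ∀ g ∈ U, ∀ p ∈ U \ {g}, hugoniot F G g p = 0 →
    Function.Surjective (fderiv ℝ (hugoniot F G g) p)

/-- The Rankine-Hugoniot condition for a jump between `l` and `r` with speed `s`. -/
def RankineHugoniot (F G : ℝ × ℝ → ℝ) (l r : ℝ × ℝ) (s : ℝ) : Prop :=
  F r - F l = s * (r.1 - l.1) ∧ G r - G l = s * (r.2 - l.2)

/-- The left state `l` is joined to the right state `r` by a `1`-shock (Lax conditions). -/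
def IsOneShock (F G : ℝ × ℝ → ℝ) (l r : ℝ × ℝ) : Prop :=
  ∃ s : ℝ, RankineHugoniot F G l r s ∧
    lam F G 1 l > s ∧ s > lam F G 1 r ∧ s < lam F G 2 r

/-- The left state `l` is joined to the right state `r` by a `2`-shock (Lax conditions). -/
def IsTwoShock (F G : ℝ × ℝ → ℝ) (l r : ℝ × ℝ) : Prop :=
  ∃ s : ℝ, RankineHugoniot F G l r s ∧
    lam F G 2 l > s ∧ s > lam F G 2 r ∧ lam F G 1 l < s

/-- The full `k`-rarefaction curve of the given state `g`, in the state domain `D`: the points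
`p` of `D` joined to `g` by a solution `w` of `(J(w(ξ)) - ξ) w'(ξ) = 0`, `λ_k(w(ξ)) = ξ`, where
`ξ` runs between `λ_k(g)` and `λ_k(p)`. The curve is followed until it first
hits the boundary of `D`: before its end point `p` it stays in the interior of `D`. -/
def rarefactionCurve (D : Set (ℝ × ℝ)) (F G : ℝ × ℝ → ℝ) (k : ℕ) (g : ℝ × ℝ) :
    Set (ℝ × ℝ) :=
  {p | p ∈ D ∧ ∃ w w' : ℝ → ℝ × ℝ,
    w (lam F G k g) = g ∧ w (lam F G k p) = p ∧
    ∀ ξ ∈ uIcc (lam F G k g) (lam F G k p),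
      (ξ ≠ lam F G k p → w ξ ∈ interior D) ∧
      lam F G k (w ξ) = ξ ∧
      HasDerivWithinAt w (w' ξ) (uIcc (lam F G k g) (lam F G k p)) ξ ∧
      jac F G (w ξ) (w' ξ) = ξ • w' ξ}

/-- The two kinds of waves. A pair of kinds (for the `1`-wave and for the `2`-wave) is the type of
a double-wave solution. -/
inductive Wave where
  | shock : Wave
  | rarefaction : Wave

/-- The full wave curve of the given state `g` in `D`: the Hugoniot locus or the full
`k`-rarefaction curve. -/
def fullCurve (D : Set (ℝ × ℝ)) (F G : ℝ × ℝ → ℝ) (k : ℕ) (g : ℝ × ℝ) : Wave → Set (ℝ × ℝ)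
  | Wave.shock => {p | p ∈ D ∧ hugoniot F G g p = 0}
  | Wave.rarefaction => rarefactionCurve D F G k g

/-- The tangent space at `p` of the full wave curve of `g`: the kernel of the
differential of the defining function for the Hugoniot locus, the `k`-th eigenspace for the integral
curve. It is a line exactly at the points where the curve is regular. -/
def tangent (F G : ℝ × ℝ → ℝ) (k : ℕ) (g p : ℝ × ℝ) : Wave → Submodule ℝ (ℝ × ℝ)
  | Wave.shock => LinearMap.ker (fderiv ℝ (hugoniot F G g) p).toLinearMap
  | Wave.rarefaction => (jac F G p).eigenspace (lam F G k p)

/-- The transversality property on `K` for the left state `l` and the right state `r`: for each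
of the four choices of full wave curves, there are only finitely many intersection
points in `K` other than `l` and `r`, and at each of them both curves are regular
and their tangent lines span the plane. -/
def TransverseOn (K : Set (ℝ × ℝ)) (F G : ℝ × ℝ → ℝ) (l r : ℝ × ℝ) : Prop :=
  ∀ a b : Wave,
    ((fullCurve K F G 1 l a ∩ fullCurve K F G 2 r b) \ {l, r}).Finite ∧
    ∀ p ∈ (fullCurve K F G 1 l a ∩ fullCurve K F G 2 r b) \ {l, r},
      Module.finrank ℝ (tangent F G 1 l p a) = 1 ∧
      Module.finrank ℝ (tangent F G 2 r p b) = 1 ∧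
      tangent F G 1 l p a ⊔ tangent F G 2 r p b = ⊤

/-- The two parts of the forward `1`-wave curve of `l` in `D`: the states to which `l` can be joined
by a `1`-shock, and the part of the `1`-rarefaction curve where `λ_1` increases. -/
def forwardOne (D : Set (ℝ × ℝ)) (F G : ℝ × ℝ → ℝ) (l : ℝ × ℝ) : Wave → Set (ℝ × ℝ)
  | Wave.shock => {p | p ∈ D ∧ IsOneShock F G l p}
  | Wave.rarefaction => {p | p ∈ rarefactionCurve D F G 1 l ∧ lam F G 1 l ≤ lam F G 1 p}

/-- The two parts of the backward `2`-wave curve of `r` in `D`: the states which can be joined to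
`r` by a `2`-shock, and the part of the `2`-rarefaction curve where `λ_2` decreases. -/
def backwardTwo (D : Set (ℝ × ℝ)) (F G : ℝ × ℝ → ℝ) (r : ℝ × ℝ) : Wave → Set (ℝ × ℝ)
  | Wave.shock => {p | p ∈ D ∧ IsTwoShock F G p r}
  | Wave.rarefaction => {p | p ∈ rarefactionCurve D F G 2 r ∧ lam F G 2 p ≤ lam F G 2 r}

/-- The Riemann problem with state domain `D` and left and right states `l`, `r` has a double-wave
entropy solution of type `(a, b)` with intermediate state `m`. -/
def IsDoubleWave (D : Set (ℝ × ℝ)) (F G : ℝ × ℝ → ℝ) (l r : ℝ × ℝ) (a b : Wave)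
    (m : ℝ × ℝ) : Prop :=
  m ∈ forwardOne D F G l a ∧ m ∈ backwardTwo D F G r b ∧ m ≠ l ∧ m ≠ r

/-- In addition, this is the unique entropy solution with states in `D`: the forward `1`-wave curve
of `l` and the backward `2`-wave curve of `r` meet only at `m` (single-wave
solutions, for which the point is `l` or `r`, are excluded too). -/
def IsUniqueDoubleWave (D : Set (ℝ × ℝ)) (F G : ℝ × ℝ → ℝ) (l r : ℝ × ℝ) (a b : Wave)
    (m : ℝ × ℝ) : Prop :=
  IsDoubleWave D F G l r a b m ∧
  (⋃ c, forwardOne D F G l c) ∩ (⋃ c, backwardTwo D F G r c) = {m}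

/-- The `C²(K)` norm (of a function that is `C²` near `K`). -/
def c2Norm (K : Set (ℝ × ℝ)) (f : ℝ × ℝ → ℝ) : ℝ :=
  ∑ i ∈ Finset.range 3, ⨆ p : K, ‖iteratedFDeriv ℝ i f (p : ℝ × ℝ)‖

end Riemann

end

open Riemann

/-! If the full wave curves of the two states meet only transversally and no relevant shock is
sonic, every assertion of the conclusion is stable under small perturbations. The proof shows that
almost every pair of states has these properties (`Generic`) and then derives stability from
compactness.

Genericity. The graph condition singles out a nowhere vanishing C¹ eigenvector field for each
family, so rarefaction curves are orbits; countably many cut-off global fields capture all of them.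
Exceptional pairs of states are handled by Fubini, one state being fixed. The main tool is
parametric transversality (`measure_critical_parameters_eq_zero`), which rests on Sard's theorem
between spaces of equal dimension. Because H_l(p) = H_p(l), the regular manifold assumption also
allows the equation of a Hugoniot locus to be solved by moving its base state, so the systems of
equations involved are submersive. Sonic shocks are excluded through `Reg.eq_zero_of_sonic`: the
regular manifold assumption and genuine nonlinearity make each sonic point a non-degenerate zero of
a map of the plane, so the sonic points of one locus are countable, and sonic base states over a
null set of points form a null set. `ae_generic` collects the results.

Stability. If the conclusion fails, there are failing perturbations of size tending to zero. Along a
free ultrafilter every family of points of K converges, and limits of points on perturbed curves lie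
on the unperturbed curves. Genericity excludes equality in the limiting Lax inequalities, so shocks
remain shocks. A transverse intersection persists by a quantitative inverse function theorem
(`exists_tendsto_zero`).

Uniqueness and finiteness both come from secants. Two families of points on the same perturbed curve
with a common limit have secants asymptotically annihilated by the conormal of the limit curve. If
both families lie on two curves that are transverse in the limit, two independent covectors
annihilate the secants, so the families coincide (`Secant.eventually_eq`). -/

noncomputable section

namespace Riemann

open scoped NNReal

/-! ### Flows of bounded Lipschitz vector fields -/

section Flow

variable {E : Type*} [NormedAddCommGroup E]

/-- A bounded and globally Lipschitz vector field. -/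
structure GlobalField (Y : E → E) : Prop where
  lip : ∃ L : ℝ≥0, LipschitzWith L Y
  bdd : ∃ M : ℝ≥0, ∀ x, ‖Y x‖ ≤ M

theorem GlobalField.continuous {Y : E → E} (hY : GlobalField Y) : Continuous Y := by
  obtain ⟨L, hL⟩ := hY.lip
  exact hL.continuous

variable [NormedSpace ℝ E]

theorem GlobalField.exists_curve [CompleteSpace E] {Y : E → E} (hY : GlobalField Y) (g : E) :
    ∃ γ : ℝ → E, γ 0 = g ∧ ∀ t, HasDerivAt γ (Y (γ t)) t := by
  obtain ⟨L, hL⟩ := hY.lip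
  obtain ⟨M, hM⟩ := hY.bdd
  have key : ∀ n : ℕ, ∃ α : ℝ → E, α 0 = g ∧
      ∀ t ∈ Ioo (-(n + 1 : ℝ)) (n + 1), HasDerivAt α (Y (α t)) t := by
    intro n
    have h0 : (0 : ℝ) ∈ Icc (-(n + 1 : ℝ)) (n + 1) := ⟨by linarith [n.cast_nonneg (α := ℝ)],
      by positivity⟩
    -- The bound on `Y` holds everywhere, so the ball may have radius M (n + 1), the farthest that a
    -- curve of speed at most M gets in time n + 1.
    have hp : IsPicardLindelof (fun _ ↦ Y) (⟨0, h0⟩ : Icc (-(n + 1 : ℝ)) (n + 1)) g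
        (M * (n + 1)) 0 M L := by
      refine IsPicardLindelof.of_time_independent (fun x _ ↦ hM x) hL.lipschitzOnWith ?_
      simp
    obtain ⟨α, h1, h2⟩ := hp.exists_eq_forall_mem_Icc_hasDerivWithinAt₀
    exact ⟨α, h1, fun t ht ↦ (h2 t (Ioo_subset_Icc_self ht)).hasDerivAt
      (Icc_mem_nhds ht.1 ht.2)⟩
  choose α h0 hα using key
  have agree : ∀ m n : ℕ, m ≤ n → ∀ t ∈ Ioo (-(m + 1 : ℝ)) (m + 1), α n t = α m t := by
    intro m n hmn t ht
    have hc : (m : ℝ) ≤ n := by exact_mod_cast hmn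
    have hm := m.cast_nonneg (α := ℝ)
    refine ODE_solution_unique_of_mem_Ioo (v := fun _ ↦ Y) (s := fun _ ↦ univ) (K := L) (t₀ := 0)
      (a := -(m + 1 : ℝ)) (b := m + 1)
      (fun _ _ ↦ hL.lipschitzOnWith) ⟨by linarith, by linarith⟩ (fun s hs ↦ ⟨hα n s ?_, trivial⟩)
      (fun s hs ↦ ⟨hα m s hs, trivial⟩) ?_ ht
    · exact ⟨by linarith [hs.1], by linarith [hs.2]⟩
    · rw [h0, h0]
  -- Near `t` the index ⌈|s|⌉ is at most ⌈|t|⌉ + 1, so the glued curve agrees there with a single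
  -- solution.
  refine ⟨fun t ↦ α ⌈|t|⌉₊ t, by simp [h0], fun t ↦ ?_⟩
  have hev : (fun t ↦ α ⌈|t|⌉₊ t) =ᶠ[𝓝 t] α (⌈|t|⌉₊ + 1) := by
    have : ∀ᶠ s in 𝓝 t, |s| < |t| + 1 :=
      (continuous_abs.tendsto t).eventually (gt_mem_nhds (by linarith))
    filter_upwards [this] with s hs
    refine (agree _ _ ?_ s ?_).symm
    · refine Nat.ceil_le.2 ?_
      push_cast
      linarith [Nat.le_ceil |t|]
    · have h1 := Nat.le_ceil |s|
      have h2 := abs_le.1 h1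
      exact ⟨by linarith [h2.1], by linarith [h2.2]⟩
  have ht : t ∈ Ioo (-(((⌈|t|⌉₊ + 1 : ℕ) : ℝ) + 1)) (((⌈|t|⌉₊ + 1 : ℕ) : ℝ) + 1) := by
    have h2 := abs_le.1 (Nat.le_ceil |t|)
    push_cast
    exact ⟨by linarith [h2.1], by linarith [h2.2]⟩
  have := (hα _ t ht).congr_of_eventuallyEq hev
  rwa [← hev.self_of_nhds] at this

open Classical in
/-- The integral curve of `Y` that starts at `g`. -/
def flow (Y : E → E) (g : E) : ℝ → E :=
  if h : ∃ γ : ℝ → E, γ 0 = g ∧ ∀ t, HasDerivAt γ (Y (γ t)) t then h.choose else fun _ ↦ g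

variable [CompleteSpace E] {Y Z : E → E}

@[simp]
theorem GlobalField.flow_zero (hY : GlobalField Y) (g : E) : flow Y g 0 = g := by
  rw [flow, dif_pos (hY.exists_curve g)]
  exact (hY.exists_curve g).choose_spec.1

theorem GlobalField.hasDerivAt_flow (hY : GlobalField Y) (g : E) (t : ℝ) :
    HasDerivAt (flow Y g) (Y (flow Y g t)) t := by
  rw [flow, dif_pos (hY.exists_curve g)]
  exact (hY.exists_curve g).choose_spec.2 t

theorem GlobalField.continuous_flow (hY : GlobalField Y) (g : E) : Continuous (flow Y g) :=
  continuous_iff_continuousAt.2 fun t ↦ (hY.hasDerivAt_flow g t).continuousAt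

theorem GlobalField.contDiff_flow (hY : GlobalField Y) (g : E) : ContDiff ℝ 1 (flow Y g) := by
  rw [contDiff_one_iff_deriv]
  refine ⟨fun t ↦ (hY.hasDerivAt_flow g t).differentiableAt, ?_⟩
  have : deriv (flow Y g) = fun t ↦ Y (flow Y g t) :=
    funext fun t ↦ (hY.hasDerivAt_flow g t).deriv
  rw [this]
  exact hY.continuous.comp (hY.continuous_flow g)

theorem GlobalField.flow_unique (hY : GlobalField Y) {γ : ℝ → E}
    (h : ∀ t, HasDerivAt γ (Y (γ t)) t) (t : ℝ) : γ t = flow Y (γ 0) t := by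
  obtain ⟨L, hL⟩ := hY.lip
  exact congrFun (ODE_solution_unique_univ (v := fun _ ↦ Y) (s := fun _ ↦ univ) (t₀ := 0)
    (fun _ ↦ hL.lipschitzOnWith) (fun t ↦ ⟨h t, trivial⟩)
    (fun t ↦ ⟨hY.hasDerivAt_flow (γ 0) t, trivial⟩) (by simp [hY])) t

theorem GlobalField.flow_flow (hY : GlobalField Y) (g : E) (s t : ℝ) :
    flow Y (flow Y g s) t = flow Y g (s + t) := by
  have := hY.flow_unique (γ := fun t ↦ flow Y g (s + t)) (fun t ↦ by
    simpa using (hY.hasDerivAt_flow g (s + t)).comp_const_add s t) t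
  simpa using this.symm

theorem GlobalField.flow_flow_neg (hY : GlobalField Y) (g : E) (t : ℝ) :
    flow Y (flow Y g t) (-t) = g := by
  rw [hY.flow_flow, add_neg_cancel, hY.flow_zero]

/-- Grönwall's inequality for a curve that nearly follows a rescaled vector field. -/
theorem GlobalField.dist_flow_le {L : ℝ≥0} (hY : GlobalField Y) (hL : LipschitzWith L Y)
    {β β' : ℝ → E} {a A : ℝ → ℝ} {C : ℝ≥0} {ε : ℝ} (g : E)
    (hA : ∀ t ∈ Icc (0 : ℝ) 1, HasDerivWithinAt A (a t) (Icc 0 1) t) (hA0 : A 0 = 0)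
    (haC : ∀ t ∈ Icc (0 : ℝ) 1, |a t| ≤ C)
    (hβ : ∀ t ∈ Icc (0 : ℝ) 1, HasDerivWithinAt β (β' t) (Icc 0 1) t)
    (hε : ∀ t ∈ Icc (0 : ℝ) 1, ‖β' t - a t • Y (β t)‖ ≤ ε) :
    ∀ t ∈ Icc (0 : ℝ) 1, dist (β t) (flow Y g (A t)) ≤
      gronwallBound (dist (β 0) g) ((C * L : ℝ≥0) : ℝ) ε t := by
  have hγ : ∀ t ∈ Icc (0 : ℝ) 1, HasDerivWithinAt (fun t ↦ flow Y g (A t))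
      (a t • Y (flow Y g (A t))) (Icc 0 1) t := fun t ht ↦
    (hY.hasDerivAt_flow g (A t)).scomp_hasDerivWithinAt t (hA t ht)
  have mono : ∀ {f : ℝ → E} {f' : E} {t : ℝ}, t ∈ Ico (0 : ℝ) 1 →
      HasDerivWithinAt f f' (Icc 0 1) t → HasDerivWithinAt f f' (Ici t) t := by
    intro f f' t ht h
    refine h.mono_of_mem_nhdsWithin ?_
    exact mem_of_superset (Icc_mem_nhdsGE_of_mem ⟨ht.1, ht.2⟩) subset_rfl
  intro t ht
  have := dist_le_of_approx_trajectories_ODE_of_mem (v := fun t x ↦ a t • Y x)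
    (s := fun _ ↦ univ) (K := C * L) (f := β) (f' := β') (g := fun t ↦ flow Y g (A t))
    (g' := fun t ↦ a t • Y (flow Y g (A t))) (a := 0) (b := 1) (εf := ε) (εg := 0)
    (δ := dist (β 0) g)
    (fun t ht ↦ ?_) (fun t ht ↦ (hβ t ht).continuousWithinAt)
    (fun t ht ↦ mono ht (hβ t (Ico_subset_Icc_self ht)))
    (fun t ht ↦ by rw [dist_eq_norm]; exact hε t (Ico_subset_Icc_self ht))
    (fun _ _ ↦ trivial) (fun t ht ↦ (hγ t ht).continuousWithinAt)
    (fun t ht ↦ mono ht (hγ t (Ico_subset_Icc_self ht)))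
    (fun t ht ↦ by rw [dist_self]) (fun _ _ ↦ trivial) (by simp [hA0, hY]) t ht
  · simpa using this
  · refine (LipschitzWith.of_dist_le_mul fun x y ↦ ?_).lipschitzOnWith
    rw [dist_smul₀, Real.norm_eq_abs]
    calc |a t| * dist (Y x) (Y y) ≤ C * (L * dist x y) :=
          mul_le_mul (haC t (Ico_subset_Icc_self ht)) (hL.dist_le_mul x y) dist_nonneg
            C.coe_nonneg
      _ = ((C * L : ℝ≥0) : ℝ) * dist x y := by push_cast; ring

/-- Grönwall with no initial gap and no error. It identifies a rarefaction curve, which is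
parametrized by its speed, with an orbit run at the time A = ∫ a. -/
theorem GlobalField.eq_flow_of_hasDerivWithinAt (hY : GlobalField Y) {β : ℝ → E} {a A : ℝ → ℝ}
    (hA : ∀ t ∈ Icc (0 : ℝ) 1, HasDerivWithinAt A (a t) (Icc 0 1) t) (hA0 : A 0 = 0)
    (ha : ContinuousOn a (Icc 0 1))
    (hβ : ∀ t ∈ Icc (0 : ℝ) 1, HasDerivWithinAt β (a t • Y (β t)) (Icc 0 1) t) :
    ∀ t ∈ Icc (0 : ℝ) 1, β t = flow Y (β 0) (A t) := by
  obtain ⟨L, hL⟩ := hY.lip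
  obtain ⟨C, hC⟩ := isCompact_Icc.exists_bound_of_continuousOn ha
  intro t ht
  have := hY.dist_flow_le hL (C := C.toNNReal) (ε := 0) (β 0) hA hA0
    (fun t ht ↦ (hC t ht).trans (Real.le_coe_toNNReal C)) hβ (by simp) t ht
  rw [dist_self, gronwallBound_ε0_δ0] at this
  exact dist_le_zero.1 this

/-- Rescaling time by `T` puts both orbits over [0, 1], whatever the sign of `T`. The fields are
compared only along the orbit of `Z`, because in the applications they may be close only on a
compact set that contains it. -/
theorem GlobalField.dist_flow_flow_le {L : ℝ≥0} (hY : GlobalField Y) (hZ : GlobalField Z)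
    (hL : LipschitzWith L Y) (g h : E) {T ε : ℝ} {C : ℝ≥0} (hT : |T| ≤ C)
    (hε : ∀ t ∈ uIcc 0 T, ‖Z (flow Z h t) - Y (flow Z h t)‖ ≤ ε) :
    dist (flow Z h T) (flow Y g T) ≤
      gronwallBound (dist h g) ((C * L : ℝ≥0) : ℝ) (C * ε) 1 := by
  have hmem : ∀ t ∈ Icc (0 : ℝ) 1, t * T ∈ uIcc 0 T := by
    intro t ht
    rcases le_total 0 T with h | h
    · rw [uIcc_of_le h]; exact ⟨by nlinarith [ht.1], by nlinarith [ht.2]⟩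
    · rw [uIcc_of_ge h]; exact ⟨by nlinarith [ht.2], by nlinarith [ht.1]⟩
  have hA : ∀ t : ℝ, HasDerivAt (fun t : ℝ ↦ t * T) T t := fun t ↦ by
    simpa using (hasDerivAt_id t).mul_const T
  have := hY.dist_flow_le hL (β := fun t ↦ flow Z h (t * T))
    (β' := fun t ↦ T • Z (flow Z h (t * T))) (a := fun _ ↦ T) (A := fun t ↦ t * T) (C := C)
    (ε := C * ε) g (fun t _ ↦ (hA t).hasDerivWithinAt) (by simp) (fun _ _ ↦ hT)
    (fun t _ ↦ ((hZ.hasDerivAt_flow h (t * T)).scomp t (hA t)).hasDerivWithinAt)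
    (fun t ht ↦ ?_) 1 (by simp)
  · simpa [hZ] using this
  · rw [← smul_sub, norm_smul, Real.norm_eq_abs]
    exact mul_le_mul hT (hε _ (hmem t ht)) (norm_nonneg _) C.coe_nonneg

theorem GlobalField.dist_flow_time_le (hY : GlobalField Y) {M : ℝ≥0} (hM : ∀ x, ‖Y x‖ ≤ M) (g : E)
    (s t : ℝ) : dist (flow Y g s) (flow Y g t) ≤ M * |s - t| := by
  rw [dist_eq_norm]
  exact Convex.norm_image_sub_le_of_norm_hasDerivWithin_le (s := univ)
    (fun x _ ↦ (hY.hasDerivAt_flow g x).hasDerivWithinAt) (fun x _ ↦ hM _) convex_univ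
    (mem_univ t) (mem_univ s)

/-- Flows depend continuously on the field, the initial point and the time. -/
theorem GlobalField.tendsto_flow {ι : Type*} {l : Filter ι} {Z : ι → E → E} {h : ι → E}
    {T : ι → ℝ} {g : E} {T₀ : ℝ} (hY : GlobalField Y) (hZ : ∀ i, GlobalField (Z i))
    (hh : Tendsto h l (𝓝 g)) (hT : Tendsto T l (𝓝 T₀))
    (hε : ∀ ε > 0, ∀ᶠ i in l, ∀ t ∈ uIcc 0 (T i),
      ‖Z i (flow (Z i) (h i) t) - Y (flow (Z i) (h i) t)‖ ≤ ε) :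
    Tendsto (fun i ↦ flow (Z i) (h i) (T i)) l (𝓝 (flow Y g T₀)) := by
  obtain ⟨L, hL⟩ := hY.lip
  -- The constant is enlarged to keep the Grönwall rate nonzero, where the bound has one explicit
  -- continuous formula.
  have hL' : LipschitzWith (L + 1) Y := hL.weaken (by simp)
  obtain ⟨M, hM⟩ := hY.bdd
  obtain ⟨C, hC⟩ : ∃ C : ℝ≥0, C = Real.toNNReal (|T₀| + 1) := ⟨_, rfl⟩
  have hCr : (C : ℝ) = |T₀| + 1 := by rw [hC, Real.coe_toNNReal _ (by positivity)]
  have hTC : ∀ᶠ i in l, |T i| ≤ C := by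
    have := (continuous_abs.tendsto T₀).comp hT
    filter_upwards [this.eventually (gt_mem_nhds (show |T₀| < C by rw [hCr]; linarith))] with i hi
    exact hi.le
  have hK : ((C * (L + 1) : ℝ≥0) : ℝ) ≠ 0 := by
    push_cast
    rw [hCr]
    positivity
  rw [tendsto_iff_dist_tendsto_zero]
  have hlim : Tendsto (fun q : ℝ × ℝ ↦ gronwallBound q.1 ((C * (L + 1) : ℝ≥0) : ℝ) (C * q.2) 1)
      (𝓝 (0, 0)) (𝓝 0) := by
    have : Continuous fun q : ℝ × ℝ ↦
        gronwallBound q.1 ((C * (L + 1) : ℝ≥0) : ℝ) (C * q.2) 1 := by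
      simp only [gronwallBound_of_K_ne_0 hK]
      fun_prop
    have h2 := this.tendsto (0, 0)
    simpa [gronwallBound_ε0_δ0] using h2
  have hd : Tendsto (fun i ↦ M * |T i - T₀|) l (𝓝 0) := by
    have h1 : Tendsto (fun i ↦ T i - T₀) l (𝓝 0) := by simpa using hT.sub_const T₀
    have h2 : Tendsto (fun i ↦ |T i - T₀|) l (𝓝 0) := by
      simpa [Function.comp_def] using (continuous_abs.tendsto 0).comp h1
    simpa using h2.const_mul (M : ℝ)
  rw [Metric.tendsto_nhds]
  intro η hη
  have e1 : ∀ᶠ q : ℝ × ℝ in 𝓝 (0, 0),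
      gronwallBound q.1 ((C * (L + 1) : ℝ≥0) : ℝ) (C * q.2) 1 < η / 2 :=
    hlim.eventually (gt_mem_nhds (by linarith))
  obtain ⟨ρ, hρ, hball⟩ := Metric.eventually_nhds_iff.1 e1
  have hh' := (tendsto_iff_dist_tendsto_zero.1 hh).eventually (gt_mem_nhds hρ)
  filter_upwards [hTC, hh', hε (ρ / 2) (by linarith), hd.eventually (gt_mem_nhds (half_pos hη))]
    with i h1 h2 h3 h4
  have h5 := hY.dist_flow_flow_le (hZ i) hL' g (h i) h1 h3
  have h6 : dist (flow Y g (T i)) (flow Y g T₀) ≤ M * |T i - T₀| :=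
    hY.dist_flow_time_le hM g _ _
  have h7 := @hball (dist (h i) g, ρ / 2) (by
    rw [Prod.dist_eq, Real.dist_eq, Real.dist_eq, sub_zero, sub_zero, abs_of_nonneg dist_nonneg,
      abs_of_pos (by linarith)]
    exact max_lt h2 (by linarith))
  rw [Real.dist_eq, sub_zero, abs_of_nonneg dist_nonneg]
  calc dist (flow (Z i) (h i) (T i)) (flow Y g T₀) ≤
      dist (flow (Z i) (h i) (T i)) (flow Y g (T i)) + dist (flow Y g (T i)) (flow Y g T₀) :=
        dist_triangle _ _ _
    _ < η := by
      simp only [NNReal.coe_mul, NNReal.coe_add] at *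
      linarith

theorem GlobalField.continuous_uncurry_flow (hY : GlobalField Y) :
    Continuous fun q : E × ℝ ↦ flow Y q.1 q.2 := by
  refine continuous_iff_continuousAt.2 fun q ↦ ?_
  exact hY.tendsto_flow (Z := fun _ ↦ Y) (fun _ ↦ hY) continuous_fst.continuousAt
    continuous_snd.continuousAt (by simp +contextual [le_of_lt])

end Flow

/-! ### Null sets from the implicit function theorem and Sard's theorem -/

section Parametric

variable {E P N Y : Type*} [NormedAddCommGroup E] [NormedSpace ℝ E] [FiniteDimensional ℝ E]
  [NormedAddCommGroup P] [NormedSpace ℝ P] [FiniteDimensional ℝ P]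
  [NormedAddCommGroup N] [NormedSpace ℝ N] [FiniteDimensional ℝ N]
  [NormedAddCommGroup Y] [NormedSpace ℝ Y] [FiniteDimensional ℝ Y]

omit [FiniteDimensional ℝ N] [FiniteDimensional ℝ Y] in
/-- The implicit function theorem: the zero set of `Φ` is locally parametrized by the values of a
linear map `A` that is complementary to the derivative of `Φ`. -/
theorem exists_local_parametrization {Φ : E → Y} {z₀ : E} (hΦ : ContDiffAt ℝ 1 Φ z₀)
    (A : E →L[ℝ] N) (hA : Function.Bijective ((fderiv ℝ Φ z₀).prod A)) :
    ∃ O ∈ 𝓝 z₀, ∃ ψ : N → E, ∃ ψ' : E → N →L[ℝ] E, ∀ z ∈ O, Φ z = 0 →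
      ψ (A z) = z ∧ HasFDerivAt ψ (ψ' z) (A z) ∧
      ∀ e, fderiv ℝ Φ z e = 0 → ψ' z (A e) = e := by
  have : CompleteSpace E := FiniteDimensional.complete ℝ E
  set Θ : E → Y × N := fun z ↦ (Φ z, A z) with hΘ
  have hΘd : ContDiffAt ℝ 1 Θ z₀ := hΦ.prodMk A.contDiff.contDiffAt
  have hderiv : ∀ z, DifferentiableAt ℝ Φ z → HasFDerivAt Θ ((fderiv ℝ Φ z).prod A) z :=
    fun z hz ↦ hz.hasFDerivAt.prodMk A.hasFDerivAt
  let e₀ : E ≃L[ℝ] Y × N :=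
    (LinearEquiv.ofBijective (((fderiv ℝ Φ z₀).prod A : E →L[ℝ] Y × N) : E →ₗ[ℝ] Y × N)
      hA).toContinuousLinearEquiv
  have he₀ : (e₀ : E →L[ℝ] Y × N) = (fderiv ℝ Φ z₀).prod A := by
    ext x <;> rfl
  have hd₀ : HasFDerivAt Θ (e₀ : E →L[ℝ] Y × N) z₀ := by
    rw [he₀]; exact hderiv _ (hΦ.differentiableAt one_ne_zero)
  let H := hΘd.toOpenPartialHomeomorph Θ hd₀ one_ne_zero
  have hH : ∀ z, H z = Θ z := fun z ↦ rfl
  have h1 : ∀ᶠ z in 𝓝 z₀, z ∈ H.source :=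
    H.open_source.mem_nhds (hΘd.mem_toOpenPartialHomeomorph_source hd₀ one_ne_zero)
  have h2 : ∀ᶠ z in 𝓝 z₀, DifferentiableAt ℝ Φ z :=
    (hΦ.eventually (by simp)).mono fun z hz ↦ hz.differentiableAt one_ne_zero
  -- Invertibility is an open condition, so the parametrization is differentiable at all nearby
  -- zeros and not only at `z₀`.
  have h3 : ∀ᶠ z in 𝓝 z₀, (fderiv ℝ Φ z).prod A ∈
      range ((↑) : (E ≃L[ℝ] Y × N) → E →L[ℝ] Y × N) := by
    have hc : ContinuousAt (fun z ↦ (fderiv ℝ Φ z).prod A) z₀ := by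
      have hc1 : ContinuousAt (fderiv ℝ Φ) z₀ :=
        (hΦ.fderiv_right (m := 0) (by simp)).continuousAt
      have : Continuous fun B : E →L[ℝ] Y ↦ B.prod A := by
        have h4 : (fun B : E →L[ℝ] Y ↦ B.prod A) = fun B ↦
            (ContinuousLinearMap.inl ℝ Y N).comp B + (ContinuousLinearMap.inr ℝ Y N).comp A := by
          funext B; ext x <;> simp
        rw [h4]
        fun_prop
      exact this.continuousAt.comp hc1
    have hn := e₀.nhds
    rw [he₀] at hn
    exact hc hn
  refine ⟨_, h1.and (h2.and h3), fun n ↦ H.symm (0, n), fun z ↦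
    (((fderiv ℝ Φ z).prod A).inverse).comp (ContinuousLinearMap.inr ℝ Y N), ?_⟩
  rintro z ⟨hz1, hz2, e, he⟩ hz0
  have hz : (0, A z) = H z := by rw [hH, hΘ, ← hz0]
  have hs : H.symm (0, A z) = z := by rw [hz, H.left_inv hz1]
  have hinv : ((fderiv ℝ Φ z).prod A).inverse = (e.symm : Y × N →L[ℝ] E) := by
    rw [← he, ContinuousLinearMap.inverse_equiv]
  refine ⟨hs, ?_, ?_⟩
  · have h5 : HasFDerivAt H.symm (e.symm : Y × N →L[ℝ] E) (0, A z) := by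
      refine H.hasFDerivAt_symm (by rw [hz]; exact H.map_source hz1) ?_
      rw [hs]
      have := hderiv z hz2
      rwa [← he] at this
    beta_reduce
    rw [hinv]
    exact h5.comp (A z) (hasFDerivAt_prodMk_right 0 (A z))
  · intro x hx
    beta_reduce
    rw [hinv]
    have : e x = (0, A x) := by
      have := congrArg (fun B : E →L[ℝ] Y × N ↦ B x) he
      simpa [hx] using this
    simp [← this]

/-- A set is mapped to a null set if it is so locally. -/
theorem measure_image_null_of_locally_null {X Z : Type*} [TopologicalSpace X]
    [SecondCountableTopology X] [MeasurableSpace Z] {μ : Measure Z} {f : X → Z} {s : Set X}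
    (h : ∀ x ∈ s, ∃ O ∈ 𝓝 x, μ (f '' (s ∩ O)) = 0) : μ (f '' s) = 0 := by
  choose! O hO hμ using h
  obtain ⟨t, hts, htc, hcov⟩ := TopologicalSpace.countable_cover_nhdsWithin (s := s)
    (fun x hx ↦ mem_nhdsWithin_of_mem_nhds (hO x hx))
  have : f '' s ⊆ ⋃ x ∈ t, f '' (s ∩ O x) := by
    rintro _ ⟨x, hx, rfl⟩
    obtain ⟨y, hy, hxy⟩ := mem_iUnion₂.1 (hcov hx)
    exact mem_iUnion₂.2 ⟨y, hy, x, ⟨hx, hxy⟩, rfl⟩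
  exact measure_mono_null this ((measure_biUnion_null_iff htc).2 fun x hx ↦ hμ x (hts hx))

variable [MeasurableSpace E] [BorelSpace E] {μ : Measure E} [μ.IsAddHaarMeasure]

/-- **Parametric transversality**: for almost every parameter, the partial derivative of `Φ` is
injective at all the zeros at which the full derivative is onto. -/
theorem measure_critical_parameters_eq_zero {Φ : E × P → Y}
    (hdim : Module.finrank ℝ P = Module.finrank ℝ Y) {S : Set (E × P)}
    (h1 : ∀ z ∈ S, ContDiffAt ℝ 1 Φ z) (h0 : ∀ z ∈ S, Φ z = 0)
    (hsurj : ∀ z ∈ S, Function.Surjective (fderiv ℝ Φ z))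
    (hcrit : ∀ z ∈ S, ∃ v : P, v ≠ 0 ∧ fderiv ℝ Φ z (0, v) = 0) :
    μ (Prod.fst '' S) = 0 := by
  refine measure_image_null_of_locally_null fun z₀ hz₀ ↦ ?_
  set B := fderiv ℝ Φ z₀ with hB
  set K := LinearMap.ker (B : E × P →ₗ[ℝ] Y) with hK
  obtain ⟨f, hf⟩ : K.ClosedComplemented := Submodule.ClosedComplemented.of_finiteDimensional K
  -- Since P and Y have equal dimension, the kernel of the full derivative has the dimension of E. A
  -- projection onto it, read in E, is the linear map that completes the derivative to an
  -- isomorphism.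
  have hr : Module.finrank ℝ K = Module.finrank ℝ E := by
    have h2 := LinearMap.finrank_range_add_finrank_ker (B : E × P →ₗ[ℝ] Y)
    rw [LinearMap.range_eq_top.2 (hsurj z₀ hz₀), finrank_top, Module.finrank_prod] at h2
    have h3 : Module.finrank ℝ Y + Module.finrank ℝ K =
        Module.finrank ℝ E + Module.finrank ℝ P := h2
    omega
  let e : K ≃L[ℝ] E := ContinuousLinearEquiv.ofFinrankEq hr
  let A : E × P →L[ℝ] E := (e : K →L[ℝ] E).comp f
  have hinj : Function.Injective (B.prod A) := by
    rw [injective_iff_map_eq_zero]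
    intro x hx
    have hx1 : B x = 0 := congrArg Prod.fst hx
    have hx2 : e (f x) = 0 := congrArg Prod.snd hx
    have hx3 : f x = 0 := by simpa using hx2
    have := hf ⟨x, hx1⟩
    rw [hx3] at this
    exact (congrArg Subtype.val this).symm
  have hbij : Function.Bijective (B.prod A) := by
    refine ⟨hinj, ?_⟩
    have := (LinearMap.injective_iff_surjective_of_finrank_eq_finrank
      (f := ((B.prod A : E × P →L[ℝ] Y × E) : E × P →ₗ[ℝ] Y × E)) (by
        rw [Module.finrank_prod, Module.finrank_prod, hdim, add_comm])).1 hinj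
    exact this
  obtain ⟨O, hO, ψ, ψ', hψ⟩ := exists_local_parametrization (h1 z₀ hz₀) A hbij
  refine ⟨O, hO, ?_⟩
  have hsub : Prod.fst '' (S ∩ O) ⊆ (fun n ↦ (ψ n).1) '' (A '' (S ∩ O)) := by
    rintro _ ⟨z, hz, rfl⟩
    exact ⟨A z, ⟨z, hz, rfl⟩, by simp [(hψ z hz.2 (h0 z hz.1)).1]⟩
  refine measure_mono_null hsub ?_
  -- The zero set is charted by E and projected back to E. Sard's theorem in equal dimensions needs
  -- no smoothness beyond differentiability.
  refine addHaar_image_eq_zero_of_det_fderivWithin_eq_zero μ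
    (f' := fun n ↦ (ContinuousLinearMap.fst ℝ E P).comp (ψ' (ψ n))) ?_ ?_
  · rintro _ ⟨z, hz, rfl⟩
    obtain ⟨h2, h3, h4⟩ := hψ z hz.2 (h0 z hz.1)
    rw [h2]
    exact (hasFDerivAt_fst.comp (A z) h3).hasFDerivWithinAt
  · rintro _ ⟨z, hz, rfl⟩
    obtain ⟨h2, h3, h4⟩ := hψ z hz.2 (h0 z hz.1)
    obtain ⟨v, hv, hv0⟩ := hcrit z hz.1
    rw [h2]
    -- The vector (0, v) is tangent to the zero set and is killed by the projection to the
    -- parameters, so the charted projection is singular.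
    have h5 : ψ' z (A (0, v)) = (0, v) := h4 _ hv0
    by_contra hdet
    have h6 : Function.Injective ((ContinuousLinearMap.fst ℝ E P).comp (ψ' z)) := by
      have hu : IsUnit (LinearMap.det
        (((ContinuousLinearMap.fst ℝ E P).comp (ψ' z) : E →L[ℝ] E) : E →ₗ[ℝ] E)) :=
        isUnit_iff_ne_zero.2 hdet
      exact (LinearEquiv.ofIsUnitDet (v := Module.finBasis ℝ E) (v' := Module.finBasis ℝ E)
        (f := (((ContinuousLinearMap.fst ℝ E P).comp (ψ' z) : E →L[ℝ] E) : E →ₗ[ℝ] E))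
        (by rwa [LinearMap.det_toMatrix])).injective
    have h7 : A (0, v) = 0 := h6 (by simp [h5])
    rw [h7, map_zero] at h5
    exact hv (congrArg Prod.snd h5).symm

/-- A dummy real variable is added on which the equation does not depend. Its direction is critical
at every zero, so all zeros are critical parameters. -/
theorem measure_regular_level_set_eq_zero {f : E → ℝ} {S : Set E}
    (h1 : ∀ z ∈ S, ContDiffAt ℝ 1 f z) (h0 : ∀ z ∈ S, f z = 0)
    (hreg : ∀ z ∈ S, fderiv ℝ f z ≠ 0) : μ S = 0 := by
  have hd : ∀ z ∈ S, ∀ t : ℝ, fderiv ℝ (fun q : E × ℝ ↦ f q.1) (z, t) =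
      (fderiv ℝ f z).comp (ContinuousLinearMap.fst ℝ E ℝ) := fun z hz t ↦
    (HasFDerivAt.comp (z, t) ((h1 z hz).differentiableAt one_ne_zero).hasFDerivAt
      hasFDerivAt_fst).fderiv
  have := measure_critical_parameters_eq_zero (μ := μ) (Φ := fun q : E × ℝ ↦ f q.1)
    (P := ℝ) rfl (S := S ×ˢ {0}) ?_ ?_ ?_ ?_
  · rwa [fst_image_prod _ (singleton_nonempty 0)] at this
  · rintro ⟨z, t⟩ ⟨hz, -⟩
    exact (h1 z hz).comp (z, t) contDiffAt_fst
  · rintro ⟨z, t⟩ ⟨hz, -⟩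
    exact h0 z hz
  · rintro ⟨z, t⟩ ⟨hz, -⟩
    rw [hd z hz t]
    rw [ContinuousLinearMap.coe_comp, ContinuousLinearMap.coe_fst']
    refine Function.Surjective.comp ?_ Prod.fst_surjective
    refine LinearMap.surjective_of_ne_zero (f := (fderiv ℝ f z : E →ₗ[ℝ] ℝ)) ?_
    exact fun h ↦ hreg z hz (by ext x; exact congrArg (fun g : E →ₗ[ℝ] ℝ ↦ g x) h)
  · rintro ⟨z, t⟩ ⟨hz, -⟩
    exact ⟨1, one_ne_zero, by rw [hd z hz t]; simp⟩

/-- If the equation `Φ (x, y) = 0` can be solved for `x`, then the solutions with `y` in a null set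
form a null set. -/
theorem measure_solutions_over_null_eq_zero {Φ : E × E → Y} {S : Set (E × E)} {Z : Set E}
    (hZ : μ Z = 0) (h1 : ∀ z ∈ S, ContDiffAt ℝ 1 Φ z) (h0 : ∀ z ∈ S, Φ z = 0)
    (hdim : Module.finrank ℝ E = Module.finrank ℝ Y)
    (hinj : ∀ z ∈ S, ∀ v, fderiv ℝ Φ z (v, 0) = 0 → v = 0) (hS : ∀ z ∈ S, z.2 ∈ Z) :
    μ (Prod.fst '' S) = 0 := by
  refine measure_image_null_of_locally_null fun z₀ hz₀ ↦ ?_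
  set B := fderiv ℝ Φ z₀ with hB
  let A : E × E →L[ℝ] E := ContinuousLinearMap.snd ℝ E E
  have hinj : Function.Injective (B.prod A) := by
    rw [injective_iff_map_eq_zero]
    rintro ⟨x, y⟩ hx
    have hx2 : y = 0 := congrArg Prod.snd hx
    subst hx2
    rw [hinj z₀ hz₀ x (congrArg Prod.fst hx)]
    rfl
  have hbij : Function.Bijective (B.prod A) := by
    refine ⟨hinj, ?_⟩
    have := (LinearMap.injective_iff_surjective_of_finrank_eq_finrank
      (f := ((B.prod A : E × E →L[ℝ] Y × E) : E × E →ₗ[ℝ] Y × E)) (by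
        rw [Module.finrank_prod, Module.finrank_prod, hdim])).1 hinj
    exact this
  obtain ⟨O, hO, ψ, ψ', hψ⟩ := exists_local_parametrization (h1 z₀ hz₀) A hbij
  refine ⟨O, hO, ?_⟩
  have hsub : Prod.fst '' (S ∩ O) ⊆ (fun n ↦ (ψ n).1) '' (A '' (S ∩ O)) := by
    rintro _ ⟨z, hz, rfl⟩
    exact ⟨A z, ⟨z, hz, rfl⟩, by simp [(hψ z hz.2 (h0 z hz.1)).1]⟩
  refine measure_mono_null hsub ?_
  -- Locally the solution x is a differentiable function of y, and differentiable maps between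
  -- spaces of equal dimension preserve null sets.
  refine addHaar_image_eq_zero_of_differentiableOn_of_addHaar_eq_zero μ ?_ ?_
  · rintro _ ⟨z, hz, rfl⟩
    obtain ⟨h2, h3, h4⟩ := hψ z hz.2 (h0 z hz.1)
    exact (hasFDerivAt_fst.comp (A z) h3).differentiableAt.differentiableWithinAt
  · refine measure_mono_null ?_ hZ
    rintro _ ⟨z, hz, rfl⟩
    exact hS z hz.1

/-- Parametric transversality for the equation x = γ(t). The fibre is ℝ × ℝ to match the dimension
of E; its second coordinate is a dummy and supplies the critical direction. -/
theorem measure_range_curve_eq_zero {γ : ℝ → E} (hγ : ContDiff ℝ 1 γ)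
    (hdim : Module.finrank ℝ E = 2) : μ (range γ) = 0 := by
  have hd : ∀ q : E × (ℝ × ℝ), HasFDerivAt (fun q : E × (ℝ × ℝ) ↦ q.1 - γ q.2.1)
      (ContinuousLinearMap.fst ℝ E (ℝ × ℝ) - (fderiv ℝ γ q.2.1).comp
        ((ContinuousLinearMap.fst ℝ ℝ ℝ).comp (ContinuousLinearMap.snd ℝ E (ℝ × ℝ)))) q :=
    fun q ↦ hasFDerivAt_fst.sub ((hγ.differentiable one_ne_zero _).hasFDerivAt.comp q
      (hasFDerivAt_fst.comp q hasFDerivAt_snd))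
  have := measure_critical_parameters_eq_zero (μ := μ) (P := ℝ × ℝ)
    (Φ := fun q : E × (ℝ × ℝ) ↦ q.1 - γ q.2.1) (by simp [hdim])
    (S := {q | q.1 = γ q.2.1}) ?_ ?_ ?_ ?_
  · refine measure_mono_null ?_ this
    rintro _ ⟨t, rfl⟩
    exact ⟨(γ t, (t, 0)), rfl, rfl⟩
  · intro z _
    exact (contDiff_fst.sub (hγ.comp (contDiff_fst.comp contDiff_snd))).contDiffAt
  · intro z hz
    exact sub_eq_zero.2 hz
  · intro z _ y
    rw [(hd z).fderiv]
    exact ⟨(y, 0), by simp⟩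
  · intro z _
    refine ⟨(0, 1), by simp, ?_⟩
    rw [(hd z).fderiv]
    simp

/-- The projection of the zero set of a continuous function on an open set is measurable. -/
theorem measurableSet_exists_zero {A B Z : Type*} [NormedAddCommGroup A] [NormedSpace ℝ A]
    [FiniteDimensional ℝ A] [NormedAddCommGroup B] [NormedSpace ℝ B] [FiniteDimensional ℝ B]
    [MeasurableSpace A] [BorelSpace A] [TopologicalSpace Z] [T1Space Z] {O : Set (A × B)}
    (hO : IsOpen O) {f : A × B → Z} (hf : ContinuousOn f O) (c : Z) :
    MeasurableSet {a | ∃ b, (a, b) ∈ O ∧ f (a, b) = c} := by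
  have : ProperSpace A := FiniteDimensional.proper ℝ A
  have : ProperSpace B := FiniteDimensional.proper ℝ B
  have : LocallyCompactSpace O := hO.locallyCompactSpace
  have h1 : IsClosed {x : O | f x = c} :=
    isClosed_singleton.preimage (continuousOn_iff_continuous_domRestrict.1 hf)
  -- Open subsets of a finite-dimensional space are σ-compact, and σ-compactness passes to
  -- relatively closed subsets and to projections.
  have h2 : IsSigmaCompact {x : O | f x = c} :=
    isSigmaCompact_univ.of_isClosed_subset h1 (subset_univ _)
  have h3 := h2.image (f := fun x : O ↦ (x : A × B).1) (by fun_prop)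
  have h4 : {a | ∃ b, (a, b) ∈ O ∧ f (a, b) = c} =
      (fun x : O ↦ (x : A × B).1) '' {x : O | f x = c} := by
    ext a
    constructor
    · rintro ⟨b, hb, h⟩
      exact ⟨⟨(a, b), hb⟩, h, rfl⟩
    · rintro ⟨⟨⟨a, b⟩, hb⟩, h, rfl⟩
      exact ⟨b, hb, h⟩
  rw [h4]
  obtain ⟨K, hK, hKu⟩ := h3
  rw [← hKu]
  exact MeasurableSet.iUnion fun n ↦ (hK n).measurableSet

end Parametric

/-! ### Characteristic speeds and eigenvectors as functions of the differentials -/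

/-- The pairs of values of the differentials of the two fluxes. -/
abbrev Jet : Type := (ℝ × ℝ →L[ℝ] ℝ) × (ℝ × ℝ →L[ℝ] ℝ)

/-- The differentials of the two fluxes at a point. -/
def jet (F G : ℝ × ℝ → ℝ) (p : ℝ × ℝ) : Jet := (fderiv ℝ F p, fderiv ℝ G p)

/-- The discriminant as a function of the differentials. -/
def jetDisc (A : Jet) : ℝ :=
  (A.1 (1, 0) + A.2 (0, 1)) ^ 2 - 4 * (A.1 (1, 0) * A.2 (0, 1) - A.1 (0, 1) * A.2 (1, 0))

/-- The characteristic speed as a function of the differentials. -/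
def jetLam (k : ℕ) (A : Jet) : ℝ :=
  (A.1 (1, 0) + A.2 (0, 1) + (2 * (k : ℝ) - 3) * √(jetDisc A)) / 2

/-- The off-diagonal entry of the Jacobian that the graph condition is about. -/
def jetEntry (b : Bool) (A : Jet) : ℝ := if b then A.1 (0, 1) else A.2 (1, 0)

/-- An eigenvector of the Jacobian, as a function of the differentials. -/
def jetField (b : Bool) (k : ℕ) (A : Jet) : ℝ × ℝ :=
  if b then (A.1 (0, 1), jetLam k A - A.1 (1, 0)) else (jetLam k A - A.2 (0, 1), A.2 (1, 0))

/-- The field of eigenvectors of the `k`-th family. -/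
def field (b : Bool) (F G : ℝ × ℝ → ℝ) (k : ℕ) (p : ℝ × ℝ) : ℝ × ℝ := jetField b k (jet F G p)

theorem lam_eq_jetLam (F G : ℝ × ℝ → ℝ) (k : ℕ) : lam F G k = fun p ↦ jetLam k (jet F G p) := rfl

theorem contDiff_jetDisc {n : WithTop ℕ∞} : ContDiff ℝ n jetDisc := by
  unfold jetDisc
  fun_prop

theorem contDiffAt_jetLam {n : WithTop ℕ∞} {k : ℕ} {A : Jet} (hA : 0 < jetDisc A) :
    ContDiffAt ℝ n (jetLam k) A := by
  have h1 : ContDiffAt ℝ n (fun A ↦ √(jetDisc A)) A := contDiff_jetDisc.contDiffAt.sqrt hA.ne'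
  have h2 : ContDiffAt ℝ n (fun A : Jet ↦ A.1 (1, 0)) A := by fun_prop
  have h3 : ContDiffAt ℝ n (fun A : Jet ↦ A.2 (0, 1)) A := by fun_prop
  exact ((h2.add h3).add (contDiffAt_const.mul h1)).div_const 2

theorem contDiffAt_jetField {n : WithTop ℕ∞} {b : Bool} {k : ℕ} {A : Jet} (hA : 0 < jetDisc A) :
    ContDiffAt ℝ n (jetField b k) A := by
  have h1 := contDiffAt_jetLam (n := n) (k := k) hA
  have h2 : ContDiffAt ℝ n (fun A : Jet ↦ A.1 (1, 0)) A := by fun_prop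
  have h3 : ContDiffAt ℝ n (fun A : Jet ↦ A.2 (0, 1)) A := by fun_prop
  have h4 : ContDiffAt ℝ n (fun A : Jet ↦ A.1 (0, 1)) A := by fun_prop
  have h5 : ContDiffAt ℝ n (fun A : Jet ↦ A.2 (1, 0)) A := by fun_prop
  cases b
  · exact (h1.sub h3).prodMk h5
  · exact h4.prodMk (h1.sub h2)

theorem continuous_jetEntry (b : Bool) : Continuous (jetEntry b) := by
  unfold jetEntry
  cases b
  · simp only [Bool.false_eq_true, if_false]; fun_prop
  · simp only [if_true]; fun_prop

/-- The local hypotheses on the fluxes at a point. -/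
structure Reg (b : Bool) (F G : ℝ × ℝ → ℝ) (p : ℝ × ℝ) : Prop where
  F2 : ContDiffAt ℝ 2 F p
  G2 : ContDiffAt ℝ 2 G p
  disc_pos : 0 < jetDisc (jet F G p)
  entry_ne : jetEntry b (jet F G p) ≠ 0
  gnl : ∀ k : ℕ, k = 1 ∨ k = 2 → fderiv ℝ (lam F G k) p (field b F G k p) ≠ 0

section Local

variable {b : Bool} {F G : ℝ × ℝ → ℝ} {p : ℝ × ℝ} {k : ℕ}

theorem contDiffAt_jet (hF : ContDiffAt ℝ 2 F p) (hG : ContDiffAt ℝ 2 G p) :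
    ContDiffAt ℝ 1 (jet F G) p :=
  (hF.fderiv_right (by norm_num)).prodMk (hG.fderiv_right (by norm_num))

namespace Reg

theorem jet1 (h : Reg b F G p) : ContDiffAt ℝ 1 (jet F G) p := contDiffAt_jet h.F2 h.G2

theorem lam1 (h : Reg b F G p) (k : ℕ) : ContDiffAt ℝ 1 (lam F G k) p :=
  (contDiffAt_jetLam h.disc_pos).comp p h.jet1

theorem field1 (h : Reg b F G p) (k : ℕ) : ContDiffAt ℝ 1 (field b F G k) p :=
  (contDiffAt_jetField h.disc_pos).comp p h.jet1

theorem continuousAt_fderiv_lam (h : Reg b F G p) (k : ℕ) :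
    ContinuousAt (fderiv ℝ (lam F G k)) p :=
  ((h.lam1 k).fderiv_right (m := 0) (by simp)).continuousAt

theorem continuousAt_gnl (h : Reg b F G p) (k : ℕ) :
    ContinuousAt (fun q ↦ fderiv ℝ (lam F G k) q (field b F G k q)) p :=
  (h.continuousAt_fderiv_lam k).clm_apply (h.field1 k).continuousAt

end Reg

theorem fderiv_apply_eq (f : ℝ × ℝ → ℝ) (p h : ℝ × ℝ) :
    fderiv ℝ f p h = h.1 * du f p + h.2 * dv f p := by
  have : h = h.1 • ((1, 0) : ℝ × ℝ) + h.2 • ((0, 1) : ℝ × ℝ) := by ext <;> simp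
  conv_lhs => rw [this]
  rw [map_add, map_smul, map_smul]
  rfl

theorem jac_apply (F G : ℝ × ℝ → ℝ) (p h : ℝ × ℝ) :
    jac F G p h = (fderiv ℝ F p h, fderiv ℝ G p h) := rfl

theorem lam_root (hd : 0 < disc F G p) (hk : k = 1 ∨ k = 2) :
    (lam F G k p - du F p) * (lam F G k p - dv G p) = dv F p * du G p := by
  have h1 := Real.sq_sqrt hd.le
  have h2 : disc F G p = (du F p + dv G p) ^ 2 - 4 * (du F p * dv G p - dv F p * du G p) := rfl
  unfold lam
  rcases hk with rfl | rfl <;> push_cast <;> linear_combination (1 / 4) * h1 + (1 / 4) * h2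

theorem lam_lt_lam (hd : 0 < disc F G p) : lam F G 1 p < lam F G 2 p := by
  have := Real.sqrt_pos.2 hd
  unfold lam
  push_cast
  linarith

theorem field_apply (b : Bool) (F G : ℝ × ℝ → ℝ) (k : ℕ) (p : ℝ × ℝ) : field b F G k p =
    if b then (dv F p, lam F G k p - du F p) else (lam F G k p - dv G p, du G p) := rfl

theorem jetEntry_jet (b : Bool) (F G : ℝ × ℝ → ℝ) (p : ℝ × ℝ) :
    jetEntry b (jet F G p) = if b then dv F p else du G p := rfl

/-- The determinant of two vectors of the plane. -/
def cross (x y : ℝ × ℝ) : ℝ := x.1 * y.2 - x.2 * y.1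

theorem exists_smul_of_cross_eq_zero {x y : ℝ × ℝ} (hx : x ≠ 0) (h : cross x y = 0) :
    ∃ c : ℝ, y = c • x := by
  unfold cross at h
  by_cases h1 : x.1 = 0
  · have h2 : x.2 ≠ 0 := fun h2 ↦ hx (Prod.ext h1 h2)
    refine ⟨y.2 / x.2, Prod.ext ?_ ?_⟩
    · have : x.2 * y.1 = 0 := by rw [h1] at h; linarith
      have : y.1 = 0 := by simpa [h2] using this
      simp [this, h1]
    · simp [h2]
  · refine ⟨y.1 / x.1, Prod.ext ?_ ?_⟩
    · simp [h1]
    · simp only [Prod.smul_snd, smul_eq_mul]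
      field_simp
      linarith

namespace Reg

/-- The off-diagonal entry controlled by the graph condition is itself a component of the field. -/
theorem field_ne_zero (h : Reg b F G p) (k : ℕ) : field b F G k p ≠ 0 := by
  intro h0
  have := h.entry_ne
  rw [jetEntry_jet] at this
  rw [field_apply] at h0
  cases b
  · exact this (congrArg Prod.snd h0)
  · exact this (congrArg Prod.fst h0)

theorem jac_field (h : Reg b F G p) (hk : k = 1 ∨ k = 2) :
    jac F G p (field b F G k p) = lam F G k p • field b F G k p := by
  have hr := lam_root h.disc_pos hk
  rw [jac_apply, fderiv_apply_eq, fderiv_apply_eq, field_apply]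
  cases b
  · ext <;> simp <;> first | ring1 | linear_combination -hr
  · ext <;> simp <;> first | ring1 | linear_combination -hr

theorem cross_field (_h : Reg b F G p) {v : ℝ × ℝ}
    (hv : jac F G p v = lam F G k p • v) : cross (field b F G k p) v = 0 := by
  rw [jac_apply, fderiv_apply_eq, fderiv_apply_eq] at hv
  have h1 := congrArg Prod.fst hv
  have h2 := congrArg Prod.snd hv
  simp only [Prod.smul_fst, Prod.smul_snd, smul_eq_mul] at h1 h2
  rw [field_apply, cross]
  cases b
  · simp; linarith
  · simp; linarith

theorem exists_smul_field (h : Reg b F G p) {v : ℝ × ℝ} (hv : jac F G p v = lam F G k p • v) :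
    ∃ c : ℝ, v = c • field b F G k p :=
  exists_smul_of_cross_eq_zero (h.field_ne_zero k) (h.cross_field hv)

theorem eigenspace_iff (h : Reg b F G p) (hk : k = 1 ∨ k = 2) {v : ℝ × ℝ} :
    v ∈ (jac F G p).eigenspace (lam F G k p) ↔ cross (field b F G k p) v = 0 := by
  rw [Module.End.mem_eigenspace_iff]
  refine ⟨h.cross_field, fun h0 ↦ ?_⟩
  obtain ⟨c, rfl⟩ := exists_smul_of_cross_eq_zero (h.field_ne_zero k) h0
  rw [map_smul, h.jac_field hk, smul_comm]

/-- Up to sign, the determinant is the off-diagonal entry times the gap between the two speeds. -/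
theorem cross_field_field (h : Reg b F G p) : cross (field b F G 1 p) (field b F G 2 p) ≠ 0 := by
  have h1 := lam_lt_lam h.disc_pos
  have h2 := h.entry_ne
  rw [jetEntry_jet] at h2
  rw [field_apply, field_apply, cross]
  cases b
  · simp only [Bool.false_eq_true, if_false] at h2 ⊢
    intro h3
    have : (lam F G 1 p - lam F G 2 p) * du G p = 0 := by linarith
    rcases mul_eq_zero.1 this with h4 | h4
    · linarith
    · exact h2 h4
  · simp only [if_true] at h2 ⊢
    intro h3
    have : (lam F G 2 p - lam F G 1 p) * dv F p = 0 := by linarith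
    rcases mul_eq_zero.1 this with h4 | h4
    · linarith
    · exact h2 h4

end Reg

end Local

/-- The global hypotheses imply the local ones. -/
theorem exists_forall_reg {U : Set (ℝ × ℝ)} (hU : IsOpen U) {F G : ℝ × ℝ → ℝ}
    (hF : ContDiffOn ℝ 2 F U) (hG : ContDiffOn ℝ 2 G U)
    (hyp : StrictlyHyperbolic U F G) (gnl : GenuinelyNonlinear U F G)
    (graph : GraphCondition U F G) : ∃ b, ∀ p ∈ U, Reg b F G p := by
  have hdisc : ∀ p ∈ U, 0 < disc F G p := by
    intro p hp
    obtain ⟨x, y, hxy, hx, hy⟩ := hyp p hp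
    have root : ∀ x, (jac F G p).HasEigenvalue x →
        (du F p - x) * (dv G p - x) - dv F p * du G p = 0 := by
      intro x hx
      obtain ⟨v, hv, hv0⟩ := hx.exists_hasEigenvector
      rw [Module.End.mem_eigenspace_iff, jac_apply, fderiv_apply_eq, fderiv_apply_eq] at hv
      have h1 := congrArg Prod.fst hv
      have h2 := congrArg Prod.snd hv
      simp only [Prod.smul_fst, Prod.smul_snd, smul_eq_mul] at h1 h2
      by_contra hne
      refine hv0 (Prod.ext ?_ ?_)
      · have : ((du F p - x) * (dv G p - x) - dv F p * du G p) * v.1 = 0 := by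
          linear_combination (dv G p - x) * h1 - dv F p * h2
        simpa [hne] using this
      · have : ((du F p - x) * (dv G p - x) - dv F p * du G p) * v.2 = 0 := by
          linear_combination (du F p - x) * h2 - du G p * h1
        simpa [hne] using this
    have hx' := root x hx
    have hy' := root y hy
    have hs : x + y = du F p + dv G p := by
      have : (x - y) * (x + y - (du F p + dv G p)) = 0 := by linear_combination hx' - hy'
      rcases mul_eq_zero.1 this with h | h
      · exact absurd (sub_eq_zero.1 h) hxy
      · linarith
    have : disc F G p = (x - y) ^ 2 := by
      unfold disc
      linear_combination (-2) * hx' - 2 * hy' + (x + y - (du F p + dv G p)) * hs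
    rw [this]
    have := sub_ne_zero.2 hxy
    positivity
  have key : ∀ b : Bool, (∀ p ∈ U, jetEntry b (jet F G p) ≠ 0) → ∀ p ∈ U, Reg b F G p := by
    intro b hb p hp
    refine ⟨hF.contDiffAt (hU.mem_nhds hp), hG.contDiffAt (hU.mem_nhds hp), hdisc p hp, hb p hp,
      fun k hk ↦ gnl p hp k hk _ ?_⟩
    have hr := lam_root (hdisc p hp) hk
    rw [Module.End.hasEigenvector_iff, Module.End.mem_eigenspace_iff]
    have he := hb p hp
    rw [jetEntry_jet] at he
    constructor
    · rw [jac_apply, fderiv_apply_eq, fderiv_apply_eq, field_apply]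
      cases b
      · ext <;> simp <;> first | ring1 | linear_combination -hr
      · ext <;> simp <;> first | ring1 | linear_combination -hr
    · intro h0
      rw [field_apply] at h0
      cases b
      · exact he (congrArg Prod.snd h0)
      · exact he (congrArg Prod.fst h0)
  rcases graph with h | h
  · exact ⟨true, key true h⟩
  · exact ⟨false, key false h⟩

/-! ### Hugoniot loci, shock speeds and sonic points -/

section Hugoniot

variable {b : Bool} {F G : ℝ × ℝ → ℝ} {g p : ℝ × ℝ} {k : ℕ}

theorem hugoniot_comm (F G : ℝ × ℝ → ℝ) (g p : ℝ × ℝ) : hugoniot F G g p = hugoniot F G p g := by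
  unfold hugoniot
  ring

theorem hasFDerivAt_hugoniot (hF : DifferentiableAt ℝ F p) (hG : DifferentiableAt ℝ G p)
    (g : ℝ × ℝ) : HasFDerivAt (hugoniot F G g)
      ((p.2 - g.2) • fderiv ℝ F p + (F p - F g) • ContinuousLinearMap.snd ℝ ℝ ℝ -
        ((p.1 - g.1) • fderiv ℝ G p + (G p - G g) • ContinuousLinearMap.fst ℝ ℝ ℝ)) p := by
  have h1 := (hF.hasFDerivAt.sub_const (F g)).mul
    ((hasFDerivAt_snd (𝕜 := ℝ) (E := ℝ) (F := ℝ) (p := p)).sub_const g.2)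
  have h2 := (hG.hasFDerivAt.sub_const (G g)).mul
    ((hasFDerivAt_fst (𝕜 := ℝ) (E := ℝ) (F := ℝ) (p := p)).sub_const g.1)
  refine (h1.sub h2).congr_fderiv ?_
  rw [add_comm ((F p - F g) • _), add_comm ((G p - G g) • _)]

theorem fderiv_hugoniot_apply (hF : DifferentiableAt ℝ F p) (hG : DifferentiableAt ℝ G p)
    (g h : ℝ × ℝ) : fderiv ℝ (hugoniot F G g) p h =
      (p.2 - g.2) * fderiv ℝ F p h + (F p - F g) * h.2 -
        ((p.1 - g.1) * fderiv ℝ G p h + (G p - G g) * h.1) := by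
  rw [(hasFDerivAt_hugoniot hF hG g).fderiv]
  simp

theorem contDiffAt_hugoniot {q : (ℝ × ℝ) × (ℝ × ℝ)} (h1 : ContDiffAt ℝ 2 F q.1)
    (h2 : ContDiffAt ℝ 2 G q.1) (h3 : ContDiffAt ℝ 2 F q.2) (h4 : ContDiffAt ℝ 2 G q.2) :
    ContDiffAt ℝ 2 (fun q : (ℝ × ℝ) × (ℝ × ℝ) ↦ hugoniot F G q.1 q.2) q := by
  have f1 := h1.comp q contDiffAt_fst
  have f2 := h2.comp q contDiffAt_fst
  have f3 := h3.comp q contDiffAt_snd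
  have f4 := h4.comp q contDiffAt_snd
  have c1 : ContDiffAt ℝ 2 (fun q : (ℝ × ℝ) × (ℝ × ℝ) ↦ q.2.2 - q.1.2) q := by fun_prop
  have c2 : ContDiffAt ℝ 2 (fun q : (ℝ × ℝ) × (ℝ × ℝ) ↦ q.2.1 - q.1.1) q := by fun_prop
  exact ((f3.sub f1).mul c1).sub ((f4.sub f2).mul c2)

theorem contDiffAt_hugoniot_right (hF : ContDiffAt ℝ 2 F p) (hG : ContDiffAt ℝ 2 G p)
    (g : ℝ × ℝ) : ContDiffAt ℝ 2 (hugoniot F G g) p := by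
  have c1 : ContDiffAt ℝ 2 (fun q : ℝ × ℝ ↦ q.2 - g.2) p := by fun_prop
  have c2 : ContDiffAt ℝ 2 (fun q : ℝ × ℝ ↦ q.1 - g.1) p := by fun_prop
  exact ((hF.sub contDiffAt_const).mul c1).sub ((hG.sub contDiffAt_const).mul c2)

/-- The shock speed of the jump between two states. -/
def speed (F G : ℝ × ℝ → ℝ) (l p : ℝ × ℝ) : ℝ :=
  ((F p - F l) * (p.1 - l.1) + (G p - G l) * (p.2 - l.2)) /
    ((p.1 - l.1) ^ 2 + (p.2 - l.2) ^ 2)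

theorem speed_comm (F G : ℝ × ℝ → ℝ) (l p : ℝ × ℝ) : speed F G l p = speed F G p l := by
  unfold speed
  congr 1 <;> ring

theorem normSq_pos (h : p ≠ g) : 0 < (p.1 - g.1) ^ 2 + (p.2 - g.2) ^ 2 := by
  by_contra hn
  refine h (Prod.ext ?_ ?_)
  · nlinarith [sq_nonneg (p.1 - g.1), sq_nonneg (p.2 - g.2)]
  · nlinarith [sq_nonneg (p.1 - g.1), sq_nonneg (p.2 - g.2)]

theorem RankineHugoniot.symm {s : ℝ} (h : RankineHugoniot F G g p s) :
    RankineHugoniot F G p g s :=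
  ⟨by linarith [h.1], by linarith [h.2]⟩

theorem RankineHugoniot.hugoniot_eq_zero {s : ℝ} (h : RankineHugoniot F G g p s) :
    hugoniot F G g p = 0 := by
  rw [hugoniot, h.1, h.2]
  ring

theorem RankineHugoniot.eq_speed {s : ℝ} (h : RankineHugoniot F G g p s) (hne : p ≠ g) :
    s = speed F G g p := by
  rw [speed, h.1, h.2, eq_div_iff (normSq_pos hne).ne']
  ring

/-- The Hugoniot equation says that the jumps of flux and state are parallel. `speed` projects the
first on the second, which gives their ratio without deciding which component of the state jumps. -/
theorem rankineHugoniot_speed (h : hugoniot F G g p = 0) (hne : p ≠ g) :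
    RankineHugoniot F G g p (speed F G g p) := by
  have h1 := (normSq_pos hne).ne'
  unfold hugoniot at h
  constructor
  · rw [speed, div_mul_eq_mul_div, eq_div_iff h1]
    linear_combination (p.2 - g.2) * h
  · rw [speed, div_mul_eq_mul_div, eq_div_iff h1]
    linear_combination -(p.1 - g.1) * h

theorem contDiffAt_speed {q : (ℝ × ℝ) × (ℝ × ℝ)} (h1 : ContDiffAt ℝ 2 F q.1)
    (h2 : ContDiffAt ℝ 2 G q.1) (h3 : ContDiffAt ℝ 2 F q.2) (h4 : ContDiffAt ℝ 2 G q.2)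
    (hne : q.2 ≠ q.1) :
    ContDiffAt ℝ 2 (fun q : (ℝ × ℝ) × (ℝ × ℝ) ↦ speed F G q.1 q.2) q := by
  have f1 := h1.comp q contDiffAt_fst
  have f2 := h2.comp q contDiffAt_fst
  have f3 := h3.comp q contDiffAt_snd
  have f4 := h4.comp q contDiffAt_snd
  have c1 : ContDiffAt ℝ 2 (fun q : (ℝ × ℝ) × (ℝ × ℝ) ↦ q.2.2 - q.1.2) q := by fun_prop
  have c2 : ContDiffAt ℝ 2 (fun q : (ℝ × ℝ) × (ℝ × ℝ) ↦ q.2.1 - q.1.1) q := by fun_prop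
  exact (((f3.sub f1).mul c2).add ((f4.sub f2).mul c1)).div ((c2.pow 2).add (c1.pow 2))
    (normSq_pos hne).ne'

theorem contDiffAt_speed_right (hF : ContDiffAt ℝ 2 F p) (hG : ContDiffAt ℝ 2 G p)
    (hne : p ≠ g) : ContDiffAt ℝ 2 (speed F G g) p := by
  have c1 : ContDiffAt ℝ 2 (fun q : ℝ × ℝ ↦ q.2 - g.2) p := by fun_prop
  have c2 : ContDiffAt ℝ 2 (fun q : ℝ × ℝ ↦ q.1 - g.1) p := by fun_prop
  exact (((hF.sub contDiffAt_const).mul c2).add ((hG.sub contDiffAt_const).mul c1)).div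
    ((c2.pow 2).add (c1.pow 2)) (normSq_pos hne).ne'

/-- The product rule for the speed times the squared length of the jump, so that no quotient has to
be differentiated. -/
theorem fderiv_speed_apply (hF : ContDiffAt ℝ 2 F p) (hG : ContDiffAt ℝ 2 G p)
    (hne : p ≠ g) (h : ℝ × ℝ) :
    fderiv ℝ (speed F G g) p h * ((p.1 - g.1) ^ 2 + (p.2 - g.2) ^ 2) +
      speed F G g p * (2 * (p.1 - g.1) * h.1 + 2 * (p.2 - g.2) * h.2) =
    fderiv ℝ F p h * (p.1 - g.1) + (F p - F g) * h.1 +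
      (fderiv ℝ G p h * (p.2 - g.2) + (G p - G g) * h.2) := by
  have hF' := (hF.differentiableAt two_ne_zero).hasFDerivAt.sub_const (F g)
  have hG' := (hG.differentiableAt two_ne_zero).hasFDerivAt.sub_const (G g)
  have d1 := (hasFDerivAt_fst (𝕜 := ℝ) (E := ℝ) (F := ℝ) (p := p)).sub_const g.1
  have d2 := (hasFDerivAt_snd (𝕜 := ℝ) (E := ℝ) (F := ℝ) (p := p)).sub_const g.2
  have hs := ((contDiffAt_speed_right hF hG hne).differentiableAt two_ne_zero).hasFDerivAt
  have hl := hs.mul ((d1.mul d1).add (d2.mul d2))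
  have hr := (hF'.mul d1).add (hG'.mul d2)
  have hev : (fun x : ℝ × ℝ ↦ speed F G g x *
      ((x.1 - g.1) * (x.1 - g.1) + (x.2 - g.2) * (x.2 - g.2))) =ᶠ[𝓝 p]
      fun x ↦ (F x - F g) * (x.1 - g.1) + (G x - G g) * (x.2 - g.2) := by
    filter_upwards [isOpen_ne.mem_nhds hne] with x hx
    have := (normSq_pos hx).ne'
    rw [speed, ← sq, ← sq, div_mul_cancel₀ _ this]
  have := congrArg (fun A : ℝ × ℝ →L[ℝ] ℝ ↦ A h)
    (hl.unique (hr.congr_of_eventuallyEq hev))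
  simp at this
  linear_combination this

/-- A sonic point of the Hugoniot locus is a regular point of the system that consists of
the Hugoniot equation and the sonic condition. -/
theorem Reg.eq_zero_of_sonic (hr : Reg b F G p) (hk : k = 1 ∨ k = 2) (hne : p ≠ g)
    (h0 : hugoniot F G g p = 0) (hs : speed F G g p = lam F G k p)
    (hreg : fderiv ℝ (hugoniot F G g) p ≠ 0) {h : ℝ × ℝ}
    (h1 : fderiv ℝ (hugoniot F G g) p h = 0)
    (h2 : fderiv ℝ (speed F G g) p h = fderiv ℝ (lam F G k) p h) : h = 0 := by
  have hF := hr.F2.differentiableAt two_ne_zero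
  have hG := hr.G2.differentiableAt two_ne_zero
  obtain ⟨e1, e2⟩ := rankineHugoniot_speed h0 hne
  have hN := (normSq_pos hne).ne'
  have root := lam_root hr.disc_pos hk
  have hsp := fderiv_speed_apply hr.F2 hr.G2 hne h
  rw [fderiv_hugoniot_apply hF hG] at h1
  rw [e1, e2, hs] at h1 hsp
  set ds := fderiv ℝ (speed F G g) p h with hds
  set L := lam F G k p with hL
  set x := p.1 - g.1 with hx
  set y := p.2 - g.2 with hy
  -- With `w2` this is the linearized Rankine-Hugoniot relation (J - λ_k) h = ds (p - g). The
  -- Hugoniot equation gives its component across p - g, the derivative of the speed the component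
  -- along it.
  have w1 : fderiv ℝ F p h - L * h.1 = ds * x := by
    have : (fderiv ℝ F p h - L * h.1) * (x ^ 2 + y ^ 2) = ds * x * (x ^ 2 + y ^ 2) := by
      linear_combination y * h1 - x * hsp
    exact mul_right_cancel₀ hN this
  have w2 : fderiv ℝ G p h - L * h.2 = ds * y := by
    have : (fderiv ℝ G p h - L * h.2) * (x ^ 2 + y ^ 2) = ds * y * (x ^ 2 + y ^ 2) := by
      linear_combination - x * h1 - y * hsp
    exact mul_right_cancel₀ hN this
  -- If ds ≠ 0, then p - g lies in the range of the singular matrix J - λ_k, so the adjugate of that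
  -- matrix kills p - g (`k1`, `k2`). At a sonic point these relations say that the differential of
  -- H_g vanishes at p.
  have hds0 : ds = 0 := by
    by_contra hd
    rw [fderiv_apply_eq] at w1 w2
    have k1 : dv F p * y = (dv G p - L) * x := by
      refine mul_left_cancel₀ hd ?_
      linear_combination (dv G p - L) * w1 - dv F p * w2 - h.1 * root
    have k2 : du G p * x = (du F p - L) * y := by
      refine mul_left_cancel₀ hd ?_
      linear_combination (du F p - L) * w2 - du G p * w1 - h.2 * root
    refine hreg ?_
    ext <;> rw [ContinuousLinearMap.comp_apply, fderiv_hugoniot_apply hF hG, e1, e2, hs,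
      fderiv_apply_eq, fderiv_apply_eq, ← hx, ← hy] <;> simp
    · linear_combination -k2
    · linear_combination k1
  -- Now `h` is a multiple of the eigenvector, and λ_k is stationary along it; genuine nonlinearity
  -- makes the multiple zero.
  rw [hds0, zero_mul, sub_eq_zero] at w1 w2
  obtain ⟨c, rfl⟩ := hr.exists_smul_field (k := k) (v := h) (by
    rw [jac_apply, w1, w2]; rfl)
  rw [hds0, map_smul, smul_eq_mul, eq_comm, mul_eq_zero] at h2
  rcases h2 with h2 | h2
  · simp [h2]
  · exact absurd h2 (hr.gnl k hk)

end Hugoniot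

/-! ### Tangent lines through conormal vectors -/

section Conormal

variable {b : Bool} {F G : ℝ × ℝ → ℝ} {g p : ℝ × ℝ} {k : ℕ}

/-- The standard bilinear form of the plane. -/
def dot (x y : ℝ × ℝ) : ℝ := x.1 * y.1 + x.2 * y.2

/-- A conormal vector at `p` of the full wave curve of `g`. -/
def conormal (b : Bool) (F G : ℝ × ℝ → ℝ) (k : ℕ) (g p : ℝ × ℝ) : Wave → ℝ × ℝ
  | Wave.shock => (du (hugoniot F G g) p, dv (hugoniot F G g) p)
  | Wave.rarefaction => (-(field b F G k p).2, (field b F G k p).1)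

theorem Reg.mem_tangent_iff (h : Reg b F G p) (hk : k = 1 ∨ k = 2) (c : Wave) {v : ℝ × ℝ} :
    v ∈ tangent F G k g p c ↔ dot (conormal b F G k g p c) v = 0 := by
  cases c
  · change fderiv ℝ (hugoniot F G g) p v = 0 ↔ _
    rw [fderiv_apply_eq, dot, conormal]
    simp only [mul_comm]
  · rw [tangent, h.eigenspace_iff hk, dot, conormal, cross]
    constructor <;> intro h <;> linarith

/-- The kernel of a linear form on the plane. -/
def dotKer (x : ℝ × ℝ) : Submodule ℝ (ℝ × ℝ) :=
  LinearMap.ker (x.1 • LinearMap.fst ℝ ℝ ℝ + x.2 • LinearMap.snd ℝ ℝ ℝ)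

theorem mem_dotKer {x v : ℝ × ℝ} : v ∈ dotKer x ↔ dot x v = 0 := by
  simp [dotKer, dot]

theorem finrank_dotKer {x : ℝ × ℝ} (hx : x ≠ 0) : Module.finrank ℝ (dotKer x) = 1 := by
  have h1 := LinearMap.finrank_range_add_finrank_ker
    (x.1 • LinearMap.fst ℝ ℝ ℝ + x.2 • LinearMap.snd ℝ ℝ ℝ)
  have h2 : Function.Surjective (x.1 • LinearMap.fst ℝ ℝ ℝ + x.2 • LinearMap.snd ℝ ℝ ℝ) := by
    refine LinearMap.surjective_of_ne_zero fun h ↦ hx (Prod.ext ?_ ?_)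
    · simpa using congrArg (fun f : ℝ × ℝ →ₗ[ℝ] ℝ ↦ f (1, 0)) h
    · simpa using congrArg (fun f : ℝ × ℝ →ₗ[ℝ] ℝ ↦ f (0, 1)) h
  rw [LinearMap.range_eq_top.2 h2, finrank_top, Module.finrank_prod, Module.finrank_self] at h1
  have h3 : 1 + Module.finrank ℝ (dotKer x) = 1 + 1 := h1
  omega

theorem dotKer_sup_dotKer {x y : ℝ × ℝ} (h : cross x y ≠ 0) : dotKer x ⊔ dotKer y = ⊤ := by
  have hx : x ≠ 0 := by rintro rfl; simp [cross] at h
  have hy : y ≠ 0 := by rintro rfl; simp [cross] at h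
  have h1 : dotKer x ⊓ dotKer y = ⊥ := by
    rw [eq_bot_iff]
    rintro v ⟨hv1, hv2⟩
    rw [SetLike.mem_coe, mem_dotKer, dot] at hv1 hv2
    rw [Submodule.mem_bot]
    unfold cross at h
    refine Prod.ext ?_ ?_
    · have : (x.1 * y.2 - x.2 * y.1) * v.1 = 0 := by
        linear_combination y.2 * hv1 - x.2 * hv2
      simpa [h] using this
    · have : (x.1 * y.2 - x.2 * y.1) * v.2 = 0 := by
        linear_combination x.1 * hv2 - y.1 * hv1
      simpa [h] using this
  have h2 := Submodule.finrank_sup_add_finrank_inf_eq (dotKer x) (dotKer y)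
  rw [h1, finrank_bot, finrank_dotKer hx, finrank_dotKer hy] at h2
  exact Submodule.eq_top_of_finrank_eq (by rw [Module.finrank_prod, Module.finrank_self]; omega)

theorem Reg.tangent_eq_dotKer (h : Reg b F G p) (hk : k = 1 ∨ k = 2) (c : Wave) :
    tangent F G k g p c = dotKer (conormal b F G k g p c) :=
  Submodule.ext fun _ ↦ (h.mem_tangent_iff hk c).trans mem_dotKer.symm

/-- Transversality in terms of the conormal vectors. -/
theorem Reg.transverse (h : Reg b F G p) {l r : ℝ × ℝ} {c d : Wave}
    (hc : cross (conormal b F G 1 l p c) (conormal b F G 2 r p d) ≠ 0) :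
    Module.finrank ℝ (tangent F G 1 l p c) = 1 ∧ Module.finrank ℝ (tangent F G 2 r p d) = 1 ∧
      tangent F G 1 l p c ⊔ tangent F G 2 r p d = ⊤ := by
  rw [h.tangent_eq_dotKer (Or.inl rfl), h.tangent_eq_dotKer (Or.inr rfl)]
  refine ⟨finrank_dotKer ?_, finrank_dotKer ?_, dotKer_sup_dotKer hc⟩ <;>
  · intro h0
    rw [h0] at hc
    simp [cross] at hc

end Conormal

/-! ### Cut-off fields and a monotonicity estimate -/

open scoped Manifold ContDiff in
/-- Smooth cut-off functions in a finite-dimensional space. -/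
theorem exists_cutoff {E : Type*} [NormedAddCommGroup E] [NormedSpace ℝ E]
    [FiniteDimensional ℝ E] {K V : Set E} (hK : IsCompact K) (hV : IsOpen V) (hKV : K ⊆ V) :
    ∃ χ : E → ℝ, ContDiff ℝ 1 χ ∧ HasCompactSupport χ ∧ tsupport χ ⊆ V ∧
      (∀ᶠ x in 𝓝ˢ K, χ x = 1) ∧ ∀ x, χ x ∈ Icc (0 : ℝ) 1 := by
  have : ProperSpace E := FiniteDimensional.proper ℝ E
  obtain ⟨t, ht, hKt, htV⟩ := exists_compact_between hK hV hKV
  obtain ⟨f, h1, h2, h3⟩ := exists_contMDiffMap_one_nhds_of_subset_interior (n := 1) 𝓘(ℝ, E)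
    hK.isClosed hKt
  have hsupp : tsupport f ⊆ t := closure_minimal (fun x hx ↦ by
    by_contra hxt
    exact hx (h2 x hxt)) ht.isClosed
  exact ⟨f, f.contMDiff.contDiff, ht.of_isClosed_subset (isClosed_tsupport f) hsupp,
    hsupp.trans htV, h1, h3⟩

theorem globalField_cutoff {E : Type*} [NormedAddCommGroup E] [NormedSpace ℝ E]
    {χ : E → ℝ} {X : E → E} (hχ : ContDiff ℝ 1 χ) (hc : HasCompactSupport χ)
    (hX : ∀ x ∈ tsupport χ, ContDiffAt ℝ 1 X x) : GlobalField fun x ↦ χ x • X x := by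
  have h1 : ContDiff ℝ 1 fun x ↦ χ x • X x := by
    refine contDiff_iff_contDiffAt.2 fun x ↦ ?_
    by_cases hx : x ∈ tsupport χ
    · exact hχ.contDiffAt.smul (hX x hx)
    · refine (contDiffAt_const (c := (0 : E))).congr_of_eventuallyEq ?_
      filter_upwards [notMem_tsupport_iff_eventuallyEq.1 hx] with y hy
      rw [hy]
      exact zero_smul ℝ (X y)
  have h2 : HasCompactSupport fun x ↦ χ x • X x := hc.smul_right
  obtain ⟨C, hC⟩ := h2.exists_bound_of_continuous h1.continuous
  exact ⟨h1.lipschitzWith_of_hasCompactSupport h2 one_ne_zero, C.toNNReal,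
    fun x ↦ (hC x).trans (Real.le_coe_toNNReal C)⟩

theorem mul_abs_sub_le_of_le_abs_deriv {φ ρ : ℝ → ℝ} {m : ℝ} {s t : ℝ}
    (h : ∀ x ∈ uIcc s t, HasDerivAt φ (ρ x) x) (hm : ∀ x ∈ uIcc s t, m ≤ |ρ x|) :
    m * |t - s| ≤ |φ t - φ s| := by
  wlog hst : s ≤ t generalizing s t
  · rw [abs_sub_comm t s, abs_sub_comm (φ t)]
    exact this (by rwa [uIcc_comm]) (by rwa [uIcc_comm]) (le_of_not_ge hst)
  rcases hst.eq_or_lt with rfl | hlt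
  · simp
  rw [uIcc_of_le hst] at h hm
  obtain ⟨c, hc, hc'⟩ := exists_hasDerivAt_eq_slope φ ρ hlt
    (fun x hx ↦ (h x hx).continuousAt.continuousWithinAt)
    (fun x hx ↦ h x (Ioo_subset_Icc_self hx))
  have h1 := hm c (Ioo_subset_Icc_self hc)
  have h2 : 0 < |t - s| := abs_pos.2 (by linarith)
  rwa [hc', abs_div, le_div_iff₀ h2] at h1

/-! ### Rarefaction curves as orbits of the characteristic field -/

section Rarefaction

variable {b : Bool} {F G : ℝ × ℝ → ℝ} {g p : ℝ × ℝ} {k : ℕ} {D : Set (ℝ × ℝ)}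

/-- Differentiating λ_k(w(ξ)) = ξ shows w' = (∇λ_k · r_k)⁻¹ r_k, so w is a reparametrized orbit. The
compact set `P` is the trace of w; it is fixed before `Y`, so the global field may be adapted to it
afterwards. -/
theorem exists_flow_of_mem_rarefactionCurve (hD : ∀ q ∈ D, Reg b F G q)
    (hp : p ∈ rarefactionCurve D F G k g) :
    ∃ P, IsCompact P ∧ P ⊆ D ∧ P ⊆ insert p (interior D) ∧
      ∀ Y, GlobalField Y → (∀ q ∈ P, Y q = field b F G k q) →
      ∃ T, flow Y g T = p ∧
        ∀ t ∈ uIcc 0 T, flow Y g t ∈ P ∧ (t ≠ T → flow Y g t ∈ interior D) := by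
  obtain ⟨hpD, w, w', hwg, hwp, hw⟩ := hp
  set ξ₀ := lam F G k g with hξ₀
  set ξ₁ := lam F G k p with hξ₁
  have hcont : ContinuousOn w (uIcc ξ₀ ξ₁) := fun ξ hξ ↦ (hw ξ hξ).2.2.1.continuousWithinAt
  have hwD : ∀ ξ ∈ uIcc ξ₀ ξ₁, w ξ ∈ D := by
    intro ξ hξ
    by_cases h : ξ = ξ₁
    · rw [h, hwp]; exact hpD
    · exact interior_subset ((hw ξ hξ).1 h)
  refine ⟨w '' uIcc ξ₀ ξ₁, isCompact_uIcc.image_of_continuousOn hcont, ?_, ?_, ?_⟩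
  · rintro _ ⟨ξ, hξ, rfl⟩
    exact hwD ξ hξ
  · rintro _ ⟨ξ, hξ, rfl⟩
    by_cases h : ξ = ξ₁
    · exact Or.inl (by rw [h, hwp])
    · exact Or.inr ((hw ξ hξ).1 h)
  intro Y hY hYP
  -- On a one-point parameter interval the differential equation carries no information, but then p
  -- = g.
  by_cases hne : ξ₀ = ξ₁
  · have hgp : g = p := by rw [← hwg, hne, hwp]
    refine ⟨0, by rw [hY.flow_zero, hgp], fun t ht ↦ ?_⟩
    have ht0 : t = 0 := by simpa using ht
    subst ht0
    rw [hY.flow_zero]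
    exact ⟨⟨ξ₀, left_mem_uIcc, hwg⟩, fun h ↦ absurd rfl h⟩
  set J := uIcc ξ₀ ξ₁ with hJ
  have huniq : UniqueDiffOn ℝ J := by
    rw [hJ, uIcc]
    exact uniqueDiffOn_Icc (by simpa [eq_comm] using hne)
  set X := field b F G k with hX
  set ρ : ℝ → ℝ := fun ξ ↦ (fderiv ℝ (lam F G k) (w ξ) (X (w ξ))) with hρ
  have hw' : ∀ ξ ∈ J, ρ ξ ≠ 0 ∧ w' ξ = (ρ ξ)⁻¹ • X (w ξ) := by
    intro ξ hξ
    obtain ⟨-, h2, h3, h4⟩ := hw ξ hξ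
    have hr := hD _ (hwD ξ hξ)
    have h4 : jac F G (w ξ) (w' ξ) = lam F G k (w ξ) • w' ξ := by rw [h4, h2]
    obtain ⟨c, hc⟩ := hr.exists_smul_field h4
    have h5 : HasDerivWithinAt (fun ξ ↦ lam F G k (w ξ))
        (fderiv ℝ (lam F G k) (w ξ) (w' ξ)) J ξ :=
      ((hr.lam1 k).differentiableAt one_ne_zero).hasFDerivAt.comp_hasDerivWithinAt ξ h3
    have h6 : HasDerivWithinAt (fun ξ ↦ lam F G k (w ξ)) 1 J ξ :=
      (hasDerivWithinAt_id ξ J).congr (fun x hx ↦ (hw x hx).2.1) (hw ξ hξ).2.1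
    have h7 := (huniq ξ hξ).eq_deriv _ h5 h6
    rw [hc, map_smul, smul_eq_mul] at h7
    have h8 : ρ ξ ≠ 0 := by
      intro h0
      have : fderiv ℝ (lam F G k) (w ξ) (X (w ξ)) = 0 := h0
      rw [this, mul_zero] at h7
      exact zero_ne_one h7
    refine ⟨h8, ?_⟩
    rw [hc, eq_inv_of_mul_eq_one_left h7]
  have hρc : ContinuousOn ρ J := fun ξ hξ ↦
    ((hD _ (hwD ξ hξ)).continuousAt_gnl k).comp_continuousWithinAt (hcont ξ hξ)
  have haff : ∀ t ∈ Icc (0 : ℝ) 1, ξ₀ + t * (ξ₁ - ξ₀) ∈ J := by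
    intro t ht
    rw [hJ]
    rcases le_total ξ₀ ξ₁ with h | h
    · rw [uIcc_of_le h]; exact ⟨by nlinarith [ht.1], by nlinarith [ht.2]⟩
    · rw [uIcc_of_ge h]; exact ⟨by nlinarith [ht.2], by nlinarith [ht.1]⟩
  set a₀ : ℝ → ℝ := fun t ↦ (ξ₁ - ξ₀) * (ρ (ξ₀ + t * (ξ₁ - ξ₀)))⁻¹ with ha₀
  have ha₀c : ContinuousOn a₀ (Icc 0 1) := by
    refine continuousOn_const.mul (ContinuousOn.inv₀ ?_ fun t ht ↦ (hw' _ (haff t ht)).1)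
    exact hρc.comp (by fun_prop) haff
  -- The rate of flow time is extended continuously to the whole line, so its integral is
  -- differentiable at every point.
  set a : ℝ → ℝ := IccExtend zero_le_one ((Icc 0 1).domRestrict a₀) with ha
  have hac : Continuous a := (continuousOn_iff_continuous_domRestrict.1 ha₀c).Icc_extend'
  have haa : ∀ t ∈ Icc (0 : ℝ) 1, a t = a₀ t := fun t ht ↦ by
    rw [ha, IccExtend_of_mem _ _ ht]; rfl
  have hA : ∀ t, HasDerivAt (fun t ↦ ∫ s in (0 : ℝ)..t, a s) (a t) t :=
    fun t ↦ (hac.integral_hasStrictDerivAt 0 t).hasDerivAt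
  have key := hY.eq_flow_of_hasDerivWithinAt (β := fun t ↦ w (ξ₀ + t * (ξ₁ - ξ₀))) (a := a)
    (A := fun t ↦ ∫ s in (0 : ℝ)..t, a s) (fun t _ ↦ (hA t).hasDerivWithinAt) (by simp)
    hac.continuousOn (fun t ht ↦ ?_)
  · have key' : ∀ t ∈ Icc (0 : ℝ) 1, w (ξ₀ + t * (ξ₁ - ξ₀)) =
        flow Y g (∫ s in (0 : ℝ)..t, a s) := fun t ht ↦ by
      have := key t ht
      simpa [hwg] using this
    refine ⟨∫ s in (0 : ℝ)..1, a s, ?_, fun t ht ↦ ?_⟩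
    · rw [← key' 1 (by simp), one_mul, add_sub_cancel, hwp]
    · have hcA : ContinuousOn (fun t ↦ ∫ s in (0 : ℝ)..t, a s) (uIcc 0 1) :=
        fun t _ ↦ (hA t).continuousAt.continuousWithinAt
      -- Every flow time between 0 and the total time is reached at some parameter, hence the whole
      -- orbit segment is the trace of w.
      have := intermediate_value_uIcc hcA
      rw [intervalIntegral.integral_same] at this
      obtain ⟨s, hs, hst⟩ := this ht
      rw [uIcc_of_le zero_le_one] at hs
      have hst' : ∫ s in (0 : ℝ)..s, a s = t := hst
      rw [← hst', ← key' s hs]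
      refine ⟨⟨_, haff s hs, rfl⟩, fun hne' ↦ (hw _ (haff s hs)).1 fun h ↦ hne' ?_⟩
      have : s = 1 := by
        have h1 : (s - 1) * (ξ₁ - ξ₀) = 0 := by linarith
        rcases mul_eq_zero.1 h1 with h2 | h2
        · linarith
        · exact absurd (sub_eq_zero.1 h2).symm hne
      rw [this]
  · have h1 : HasDerivWithinAt (fun t : ℝ ↦ ξ₀ + t * (ξ₁ - ξ₀)) (ξ₁ - ξ₀) (Icc 0 1) t := by
      simpa using (((hasDerivAt_id t).mul_const (ξ₁ - ξ₀)).const_add ξ₀).hasDerivWithinAt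
    have h2 := (hw _ (haff t ht)).2.2.1.scomp t h1 haff
    rw [(hw' _ (haff t ht)).2, smul_smul] at h2
    rw [haa t ht, hYP _ ⟨_, haff t ht, rfl⟩]
    exact h2

/-- Along an orbit λ_k is strictly monotone by genuine nonlinearity, so its inverse function
reparametrizes the orbit by the speed. -/
theorem mem_rarefactionCurve_of_curve {γ : ℝ → ℝ × ℝ} {T : ℝ} (hk : k = 1 ∨ k = 2)
    (hreg : ∀ t ∈ uIcc 0 T, Reg b F G (γ t))
    (hγ : ∀ t ∈ uIcc 0 T, HasDerivAt γ (field b F G k (γ t)) t)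
    (hint : ∀ t ∈ uIcc 0 T, t ≠ T → γ t ∈ interior D) (hT : γ T ∈ D) :
    γ T ∈ rarefactionCurve D F G k (γ 0) := by
  set I := uIcc 0 T with hI
  set φ : ℝ → ℝ := fun t ↦ lam F G k (γ t) with hφ
  set ρ : ℝ → ℝ := fun t ↦ fderiv ℝ (lam F G k) (γ t) (field b F G k (γ t)) with hρ
  have hρ0 : ∀ t ∈ I, ρ t ≠ 0 := fun t ht ↦ (hreg t ht).gnl k hk
  have hρc : ContinuousOn ρ I := fun t ht ↦
    ((hreg t ht).continuousAt_gnl k).comp_continuousWithinAt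
      (hγ t ht).continuousAt.continuousWithinAt
  have hφd : ∀ t ∈ I, HasDerivAt φ (ρ t) t := fun t ht ↦
    (((hreg t ht).lam1 k).differentiableAt one_ne_zero).hasFDerivAt.comp_hasDerivAt t (hγ t ht)
  obtain ⟨t₀, ht₀, hmin⟩ := isCompact_uIcc.exists_isMinOn (nonempty_uIcc (a := (0 : ℝ)) (b := T))
    hρc.abs
  have hm : 0 < |ρ t₀| := abs_pos.2 (hρ0 t₀ ht₀)
  -- This expansion estimate gives both the injectivity of λ_k along the orbit and the continuity of
  -- its inverse.
  have hexp : ∀ s ∈ I, ∀ t ∈ I, |ρ t₀| * |t - s| ≤ |φ t - φ s| := by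
    intro s hs t ht
    have hsub : uIcc s t ⊆ I := uIcc_subset_uIcc hs ht
    exact mul_abs_sub_le_of_le_abs_deriv (fun x hx ↦ hφd x (hsub hx))
      (fun x hx ↦ hmin (hsub hx))
  have hinj : InjOn φ I := by
    intro s hs t ht hst
    have := hexp s hs t ht
    rw [hst, sub_self, abs_zero] at this
    have h2 : |t - s| = 0 := by
      by_contra h3
      have : 0 < |t - s| := lt_of_le_of_ne (abs_nonneg _) (Ne.symm h3)
      nlinarith
    linarith [abs_eq_zero.1 h2]
  have hsurj : uIcc (φ 0) (φ T) ⊆ φ '' I := intermediate_value_uIcc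
    (fun t ht ↦ (hφd t ht).continuousAt.continuousWithinAt)
  set τ : ℝ → ℝ := Function.invFunOn φ I with hτ
  set J := uIcc (φ 0) (φ T) with hJ
  have hτ1 : ∀ ξ ∈ J, τ ξ ∈ I := fun ξ hξ ↦ Function.invFunOn_mem (hsurj hξ)
  have hτ2 : ∀ ξ ∈ J, φ (τ ξ) = ξ := fun ξ hξ ↦ Function.invFunOn_eq (hsurj hξ)
  have hτφ : ∀ t ∈ I, φ t ∈ J → τ (φ t) = t := fun t ht htJ ↦
    hinj (hτ1 _ htJ) ht (hτ2 _ htJ)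
  have hτc : ∀ ξ ∈ J, Tendsto τ (𝓝[J] ξ) (𝓝[I] (τ ξ)) := by
    intro ξ hξ
    refine tendsto_nhdsWithin_iff.2 ⟨?_, eventually_mem_nhdsWithin.mono fun x hx ↦ hτ1 x hx⟩
    rw [tendsto_iff_dist_tendsto_zero]
    have h1 : Tendsto (fun x ↦ |ρ t₀|⁻¹ * |x - ξ|) (𝓝[J] ξ) (𝓝 0) := by
      have : Continuous fun x ↦ |ρ t₀|⁻¹ * |x - ξ| := by fun_prop
      have h2 := this.tendsto ξ
      simp only [sub_self, abs_zero, mul_zero] at h2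
      exact h2.mono_left nhdsWithin_le_nhds
    refine squeeze_zero' (Eventually.of_forall fun _ ↦ dist_nonneg) ?_ h1
    filter_upwards [self_mem_nhdsWithin] with x hx
    have h3 := hexp _ (hτ1 ξ hξ) _ (hτ1 x hx)
    rw [hτ2 ξ hξ, hτ2 x hx] at h3
    rw [Real.dist_eq, inv_mul_eq_div, le_div_iff₀ hm]
    linarith
  have h0J : φ 0 ∈ J := left_mem_uIcc
  have hTJ : φ T ∈ J := right_mem_uIcc
  refine ⟨hT, fun ξ ↦ γ (τ ξ), fun ξ ↦ (ρ (τ ξ))⁻¹ • field b F G k (γ (τ ξ)), ?_, ?_, ?_⟩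
  · change γ (τ (φ 0)) = γ 0
    rw [hτφ 0 left_mem_uIcc h0J]
  · change γ (τ (φ T)) = γ T
    rw [hτφ T right_mem_uIcc hTJ]
  · intro ξ hξ
    change ξ ∈ J at hξ
    refine ⟨fun hne ↦ hint _ (hτ1 ξ hξ) fun h ↦ hne ?_, hτ2 ξ hξ, ?_, ?_⟩
    · change ξ = φ T
      rw [← h, hτ2 ξ hξ]
    · have h1 : HasDerivWithinAt τ (ρ (τ ξ))⁻¹ J ξ := by
        have h2 := ((hφd _ (hτ1 ξ hξ)).hasFDerivAt_equiv (hρ0 _ (hτ1 ξ hξ))).hasFDerivWithinAt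
          (s := I)
        have h3 := h2.of_local_left_inverse (hτc ξ hξ) hξ
          (eventually_mem_nhdsWithin.mono fun x hx ↦ hτ2 x hx)
        have h4 := h3.hasDerivWithinAt
        have e : ((ContinuousLinearEquiv.unitsEquivAut ℝ
            (Units.mk0 (ρ (τ ξ)) (hρ0 _ (hτ1 ξ hξ)))).symm : ℝ →L[ℝ] ℝ) 1 = (ρ (τ ξ))⁻¹ := by
          rw [ContinuousLinearEquiv.coe_coe, ContinuousLinearEquiv.symm_apply_eq]
          simp [hρ0 _ (hτ1 ξ hξ)]
        rwa [e] at h4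
      exact (hγ _ (hτ1 ξ hξ)).scomp_hasDerivWithinAt ξ h1
    · rw [map_smul, (hreg _ (hτ1 ξ hξ)).jac_field hk, smul_comm]
      congr 1
      exact hτ2 ξ hξ

end Rarefaction

/-! ### Countably many global fields that capture all orbits -/

/-- A compact exhaustion of an open set that is cofinal among its compact subsets. -/
theorem exists_compact_cover {E : Type*} [NormedAddCommGroup E] [NormedSpace ℝ E]
    [FiniteDimensional ℝ E] {U : Set E} (hU : IsOpen U) :
    ∃ K : ℕ → Set E, (∀ n, IsCompact (K n)) ∧ (∀ n, K n ⊆ U) ∧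
      ∀ P, IsCompact P → P ⊆ U → ∃ n, P ⊆ K n := by
  have : ProperSpace E := FiniteDimensional.proper ℝ E
  have : LocallyCompactSpace U := hU.locallyCompactSpace
  let K : CompactExhaustion U := default
  refine ⟨fun n ↦ Subtype.val '' K n, fun n ↦ (K.isCompact n).image continuous_subtype_val,
    fun n ↦ by rintro _ ⟨x, -, rfl⟩; exact x.2, fun P hP hPU ↦ ?_⟩
  have h1 : IsCompact (Subtype.val ⁻¹' P : Set U) :=
    Topology.IsInducing.subtypeVal.isCompact_preimage' hP (by simpa using hPU)
  obtain ⟨n, hn⟩ := K.exists_superset_of_isCompact h1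
  exact ⟨n, fun x hx ↦ ⟨⟨x, hPU hx⟩, hn hx, rfl⟩⟩

/-- Global fields that agree with a given field on larger and larger sets. -/
theorem exists_globalFields {E : Type*} [NormedAddCommGroup E] [NormedSpace ℝ E]
    [FiniteDimensional ℝ E] {U : Set E} (hU : IsOpen U) {X : E → E}
    (hX : ∀ x ∈ U, ContDiffAt ℝ 1 X x) :
    ∃ (Y : ℕ → E → E) (O : ℕ → Set E), (∀ n, GlobalField (Y n)) ∧ (∀ n, IsOpen (O n)) ∧
      (∀ n, O n ⊆ U) ∧ (∀ n, ∀ x ∈ O n, Y n x = X x) ∧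
      ∀ P, IsCompact P → P ⊆ U → ∃ n, P ⊆ O n := by
  obtain ⟨K, hK, hKU, hKP⟩ := exists_compact_cover hU
  choose χ h1 h2 h3 h4 h5 using fun n ↦ exists_cutoff (hK n) hU (hKU n)
  refine ⟨fun n x ↦ χ n x • X x, fun n ↦ interior {x | χ n x = 1} ∩ U,
    fun n ↦ globalField_cutoff (h1 n) (h2 n) fun x hx ↦ hX x (h3 n hx),
    fun n ↦ isOpen_interior.inter hU, fun n ↦ inter_subset_right, fun n x hx ↦ ?_,
    fun P hP hPU ↦ ?_⟩
  · have : χ n x = 1 := interior_subset (s := {x | χ n x = 1}) hx.1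
    simp [this]
  · obtain ⟨n, hn⟩ := hKP P hP hPU
    exact ⟨n, fun x hx ↦ ⟨subset_interior_iff_mem_nhdsSet.2 (h4 n) (hn hx), hPU hx⟩⟩

/-! ### Null sets of pairs from null sections -/

section Fubini

variable {A B : Type*} [MeasureSpace A] [MeasureSpace B] [SFinite (volume : Measure B)]

theorem ae_notMem_of_sections_right {S : Set (A × B)} (hS : MeasurableSet S)
    (h : ∀ x, volume {y | (x, y) ∈ S} = 0) : ∀ᵐ q : A × B, q ∉ S := by
  rw [ae_iff]
  simp only [not_not, ofPred_mem_eq]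
  rw [Measure.volume_eq_prod, Measure.measure_prod_null hS]
  exact Eventually.of_forall h

theorem ae_notMem_of_sections_left [SFinite (volume : Measure A)] {S : Set (A × B)}
    (hS : MeasurableSet S)
    (h : ∀ y, volume {x | (x, y) ∈ S} = 0) : ∀ᵐ q : A × B, q ∉ S := by
  have h1 := ae_notMem_of_sections_right (S := Prod.swap ⁻¹' S) (measurable_swap hS)
    (fun y ↦ h y)
  have h2 := (Measure.measurePreserving_swap (μ := (volume : Measure A))
    (ν := (volume : Measure B))).quasiMeasurePreserving.ae h1
  filter_upwards [h2] with q hq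
  exact hq

end Fubini

/-! ### Exceptional states when the other state is fixed -/

section Generic

variable {b : Bool} {F G : ℝ × ℝ → ℝ} {U : Set (ℝ × ℝ)}

/-- The Hugoniot function of both states. -/
def hug (F G : ℝ × ℝ → ℝ) (q : (ℝ × ℝ) × (ℝ × ℝ)) : ℝ := hugoniot F G q.1 q.2

section Partial

variable {l p : ℝ × ℝ}

theorem contDiffAt_hug (hl : Reg b F G l) (hp : Reg b F G p) : ContDiffAt ℝ 2 (hug F G) (l, p) :=
  contDiffAt_hugoniot (q := (l, p)) hl.F2 hl.G2 hp.F2 hp.G2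

theorem fderiv_partial_right {Y : Type*} [NormedAddCommGroup Y] [NormedSpace ℝ Y]
    {A B : Type*} [NormedAddCommGroup A] [NormedSpace ℝ A] [NormedAddCommGroup B]
    [NormedSpace ℝ B] {Φ : A × B → Y} {x : A} {y : B} (h : DifferentiableAt ℝ Φ (x, y)) (w : B) :
    fderiv ℝ Φ (x, y) (0, w) = fderiv ℝ (fun y ↦ Φ (x, y)) y w := by
  have := (h.hasFDerivAt.comp y (hasFDerivAt_prodMk_right x y)).fderiv
  change fderiv ℝ (fun y ↦ Φ (x, y)) y = _ at this
  rw [this]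
  simp

theorem fderiv_partial_left {Y : Type*} [NormedAddCommGroup Y] [NormedSpace ℝ Y]
    {A B : Type*} [NormedAddCommGroup A] [NormedSpace ℝ A] [NormedAddCommGroup B]
    [NormedSpace ℝ B] {Φ : A × B → Y} {x : A} {y : B} (h : DifferentiableAt ℝ Φ (x, y)) (v : A) :
    fderiv ℝ Φ (x, y) (v, 0) = fderiv ℝ (fun x ↦ Φ (x, y)) x v := by
  have := (HasFDerivAt.comp x (f := fun e ↦ (e, y)) h.hasFDerivAt
    (hasFDerivAt_prodMk_left x y)).fderiv
  change fderiv ℝ (fun x ↦ Φ (x, y)) x = _ at this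
  rw [this]
  simp

theorem fderiv_hug (hl : Reg b F G l) (hp : Reg b F G p) (v w : ℝ × ℝ) :
    fderiv ℝ (hug F G) (l, p) (v, w) =
      fderiv ℝ (hugoniot F G p) l v + fderiv ℝ (hugoniot F G l) p w := by
  have hd := (contDiffAt_hug hl hp).differentiableAt two_ne_zero
  have h1 : (v, w) = (v, (0 : ℝ × ℝ)) + ((0 : ℝ × ℝ), w) := by simp
  rw [h1, map_add, fderiv_partial_left hd, fderiv_partial_right hd]
  have h2 : (fun x ↦ hug F G (x, p)) = hugoniot F G p := funext fun x ↦ hugoniot_comm F G x p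
  rw [h2]
  rfl

end Partial

theorem regularManifold_fderiv_ne_zero (reg : RegularManifold U F G) {g p : ℝ × ℝ} (hg : g ∈ U)
    (hp : p ∈ U) (hne : p ≠ g) (h0 : hugoniot F G g p = 0) :
    fderiv ℝ (hugoniot F G g) p ≠ 0 := by
  intro h
  have := reg g hg p ⟨hp, hne⟩ h0
  rw [h] at this
  obtain ⟨x, hx⟩ := this 1
  exact zero_ne_one hx

theorem measure_hugoniot_eq_zero (hreg : ∀ p ∈ U, Reg b F G p) (reg : RegularManifold U F G)
    {g : ℝ × ℝ} (hg : g ∈ U) :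
    volume {p | p ∈ U ∧ p ≠ g ∧ hugoniot F G g p = 0} = 0 :=
  measure_regular_level_set_eq_zero (f := hugoniot F G g)
    (fun _ hz ↦ (contDiffAt_hugoniot_right (hreg _ hz.1).F2 (hreg _ hz.1).G2 g).of_le
      one_le_two) (fun _ hz ↦ hz.2.2)
    fun _ hz ↦ regularManifold_fderiv_ne_zero reg hg hz.1 hz.2.1 hz.2.2

/-- The sonic points of the Hugoniot locus are isolated. -/
theorem countable_sonic (hreg : ∀ p ∈ U, Reg b F G p) (reg : RegularManifold U F G)
    {l : ℝ × ℝ} (hl : l ∈ U) {k : ℕ} (hk : k = 1 ∨ k = 2) :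
    {p | p ∈ U ∧ p ≠ l ∧ hugoniot F G l p = 0 ∧ speed F G l p - lam F G k p = 0}.Countable := by
  set C := {p | p ∈ U ∧ p ≠ l ∧ hugoniot F G l p = 0 ∧ speed F G l p - lam F G k p = 0} with hC
  have hdisc : DiscreteTopology C := by
    rw [discreteTopology_subtype_iff]
    intro p hp
    obtain ⟨hpU, hpl, h0, hs⟩ := hp
    have hr := hreg p hpU
    have d1 := (contDiffAt_hugoniot_right hr.F2 hr.G2 l).differentiableAt two_ne_zero
    have d2 := (contDiffAt_speed_right hr.F2 hr.G2 hpl).differentiableAt two_ne_zero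
    have d3 := (hr.lam1 k).differentiableAt one_ne_zero
    have d := d1.hasFDerivAt.prodMk (d2.hasFDerivAt.sub d3.hasFDerivAt)
    set A := (fderiv ℝ (hugoniot F G l) p).prod
      (fderiv ℝ (speed F G l) p - fderiv ℝ (lam F G k) p) with hA
    -- Sonic points are non-degenerate zeros of a map of the plane, hence isolated, and a discrete
    -- subset of the plane is countable.
    have hinj : LinearMap.ker (A : ℝ × ℝ →ₗ[ℝ] ℝ × ℝ) = ⊥ := by
      rw [LinearMap.ker_eq_bot']
      intro v hv
      refine hr.eq_zero_of_sonic hk hpl h0 (sub_eq_zero.1 hs)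
        (regularManifold_fderiv_ne_zero reg hl hpU hpl h0) (congrArg Prod.fst hv) ?_
      exact sub_eq_zero.1 (congrArg Prod.snd hv)
    obtain ⟨c, hc, hanti⟩ := (A : ℝ × ℝ →ₗ[ℝ] ℝ × ℝ).exists_antilipschitzWith hinj
    have hev := d.eventually_ne (c := ((0, 0) : ℝ × ℝ)) ⟨c, hanti⟩
    have : ∀ᶠ q in 𝓝[≠] p, q ∉ C := by
      filter_upwards [hev] with q hq hqC
      exact hq (Prod.ext hqC.2.2.1 hqC.2.2.2)
    rw [← disjoint_iff]
    exact Filter.disjoint_principal_right.2 this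
  exact Set.countable_coe_iff.1 (countable_of_Lindelof_of_discrete (X := C))

theorem contDiffAt_speed_sub_lam (hreg : ∀ p ∈ U, Reg b F G p) {l p : ℝ × ℝ} (hl : l ∈ U)
    (hp : p ∈ U) (hne : p ≠ l) (k : ℕ) :
    ContDiffAt ℝ 1 (fun q : (ℝ × ℝ) × (ℝ × ℝ) ↦ speed F G q.1 q.2 - lam F G k q.1) (l, p) ∧
    ContDiffAt ℝ 1 (fun q : (ℝ × ℝ) × (ℝ × ℝ) ↦ speed F G q.1 q.2 - lam F G k q.2) (l, p) := by
  have h1 := (contDiffAt_speed (q := (l, p)) (hreg l hl).F2 (hreg l hl).G2 (hreg p hp).F2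
    (hreg p hp).G2 hne).of_le (m := 1) one_le_two
  exact ⟨h1.sub (((hreg l hl).lam1 k).comp (l, p) contDiffAt_fst),
    h1.sub (((hreg p hp).lam1 k).comp (l, p) contDiffAt_snd)⟩

/-- With the roles of the states exchanged, l is a sonic point on the Hugoniot locus of p and
non-degenerate by `Reg.eq_zero_of_sonic`. Hence l is locally a differentiable function of p and
stays in a null set with it. -/
theorem measure_sonic_over_null (hreg : ∀ p ∈ U, Reg b F G p) (reg : RegularManifold U F G)
    {Z : Set (ℝ × ℝ)} (hZ : volume Z = 0) {k : ℕ} (hk : k = 1 ∨ k = 2) :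
    volume {l | ∃ p, l ∈ U ∧ p ∈ U ∧ p ≠ l ∧ p ∈ Z ∧ hug F G (l, p) = 0 ∧
      speed F G l p - lam F G k l = 0} = 0 := by
  set Φ : (ℝ × ℝ) × (ℝ × ℝ) → ℝ × ℝ :=
    fun q ↦ (hug F G q, speed F G q.1 q.2 - lam F G k q.1) with hΦ
  have hd : ∀ l ∈ U, ∀ p ∈ U, p ≠ l → ContDiffAt ℝ 1 Φ (l, p) := fun l hl p hp hne ↦
    ((contDiffAt_hug (hreg l hl) (hreg p hp)).of_le one_le_two).prodMk
      (contDiffAt_speed_sub_lam hreg hl hp hne k).1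
  refine measure_mono_null ?_ (measure_solutions_over_null_eq_zero (Φ := Φ)
    (S := {q | q.1 ∈ U ∧ q.2 ∈ U ∧ q.2 ≠ q.1 ∧ q.2 ∈ Z ∧ Φ q = 0}) hZ ?_ ?_ rfl ?_ ?_)
  · rintro l ⟨p, h1, h2, h3, h4, h5, h6⟩
    exact ⟨(l, p), ⟨h1, h2, h3, h4, Prod.ext h5 h6⟩, rfl⟩
  · rintro ⟨l, p⟩ ⟨h1, h2, h3, -⟩
    exact hd l h1 p h2 h3
  · exact fun q hq ↦ hq.2.2.2.2
  · rintro ⟨l, p⟩ ⟨h1, h2, h3, -, h5⟩ v hv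
    have hr := hreg l h1
    rw [fderiv_partial_left ((hd l h1 p h2 h3).differentiableAt one_ne_zero)] at hv
    have e : (fun x ↦ Φ (x, p)) = fun x ↦ (hugoniot F G p x, speed F G p x - lam F G k x) := by
      funext x
      rw [hΦ]
      simp only [hug]
      rw [hugoniot_comm, speed_comm]
    have d1 := (contDiffAt_hugoniot_right hr.F2 hr.G2 p).differentiableAt two_ne_zero
    have d2 := (contDiffAt_speed_right hr.F2 hr.G2 (Ne.symm h3)).differentiableAt two_ne_zero
    have d3 := (hr.lam1 k).differentiableAt one_ne_zero
    have d := d1.hasFDerivAt.prodMk (d2.hasFDerivAt.sub d3.hasFDerivAt)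
    have e' := congrFun e l
    rw [h5] at e'
    rw [e] at hv
    erw [d.fderiv] at hv
    have h0 : hugoniot F G p l = 0 := (congrArg Prod.fst e').symm
    have hs : speed F G p l - lam F G k l = 0 := (congrArg Prod.snd e').symm
    refine hr.eq_zero_of_sonic hk (Ne.symm h3) h0 (sub_eq_zero.1 hs)
      (regularManifold_fderiv_ne_zero reg h2 h1 (Ne.symm h3) h0) (congrArg Prod.fst hv) ?_
    exact sub_eq_zero.1 (congrArg Prod.snd hv)
  · exact fun q hq ↦ hq.2.2.2.1

theorem fderiv_surjective_of_ne_zero {E : Type*} [NormedAddCommGroup E] [NormedSpace ℝ E]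
    {A : E →L[ℝ] ℝ} (h : A ≠ 0) : Function.Surjective A :=
  LinearMap.surjective_of_ne_zero (f := (A : E →ₗ[ℝ] ℝ)) fun h0 ↦
    h (by ext x; exact congrArg (fun g : E →ₗ[ℝ] ℝ ↦ g x) h0)

/-- The left state is the parameter. Moving p adjusts H_r(p) and moving l adjusts H_l(p) = H_p(l),
so the two equations together are submersive; a common tangent of the two loci is a critical
direction. -/
theorem measure_nontransverse_shock_shock (hreg : ∀ p ∈ U, Reg b F G p)
    (reg : RegularManifold U F G) {r : ℝ × ℝ} (hr : r ∈ U) :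
    volume {l | ∃ p, l ∈ U ∧ p ∈ U ∧ p ≠ l ∧ p ≠ r ∧ hug F G (l, p) = 0 ∧ hugoniot F G r p = 0 ∧
      cross (du (hugoniot F G l) p, dv (hugoniot F G l) p)
        (du (hugoniot F G r) p, dv (hugoniot F G r) p) = 0} = 0 := by
  set Φ : (ℝ × ℝ) × (ℝ × ℝ) → ℝ × ℝ := fun q ↦ (hug F G q, hugoniot F G r q.2) with hΦ
  have hd2 : ∀ p ∈ U, ContDiffAt ℝ 1 (hugoniot F G r) p := fun p hp ↦
    (contDiffAt_hugoniot_right (hreg p hp).F2 (hreg p hp).G2 r).of_le one_le_two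
  have hd : ∀ l ∈ U, ∀ p ∈ U, ContDiffAt ℝ 1 Φ (l, p) := fun l hl p hp ↦
    ((contDiffAt_hug (hreg l hl) (hreg p hp)).of_le one_le_two).prodMk
      ((hd2 p hp).comp (l, p) contDiffAt_snd)
  have hf : ∀ l ∈ U, ∀ p ∈ U, ∀ v w, fderiv ℝ Φ (l, p) (v, w) =
      (fderiv ℝ (hugoniot F G p) l v + fderiv ℝ (hugoniot F G l) p w,
        fderiv ℝ (hugoniot F G r) p w) := by
    intro l hl p hp v w
    have h1 := ((contDiffAt_hug (hreg l hl) (hreg p hp)).differentiableAt two_ne_zero).hasFDerivAt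
    have h2 : HasFDerivAt (fun q : (ℝ × ℝ) × (ℝ × ℝ) ↦ hugoniot F G r q.2) _ (l, p) :=
      HasFDerivAt.comp (l, p) (g := hugoniot F G r) (f := Prod.snd)
        ((hd2 p hp).differentiableAt one_ne_zero).hasFDerivAt
        hasFDerivAt_snd
    have h3 := (h1.prodMk h2).fderiv
    change fderiv ℝ Φ (l, p) = _ at h3
    rw [h3, ContinuousLinearMap.prod_apply, fderiv_hug (hreg l hl) (hreg p hp)]
    rfl
  refine measure_mono_null ?_ (measure_critical_parameters_eq_zero (μ := volume) (Φ := Φ)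
    (S := {q | q.1 ∈ U ∧ q.2 ∈ U ∧ q.2 ≠ q.1 ∧ q.2 ≠ r ∧ Φ q = 0 ∧
      cross (du (hugoniot F G q.1) q.2, dv (hugoniot F G q.1) q.2)
        (du (hugoniot F G r) q.2, dv (hugoniot F G r) q.2) = 0}) rfl ?_ ?_ ?_ ?_)
  · rintro l ⟨p, h1, h2, h3, h4, h5, h6, h7⟩
    exact ⟨(l, p), ⟨h1, h2, h3, h4, Prod.ext h5 h6, h7⟩, rfl⟩
  · rintro ⟨l, p⟩ ⟨h1, h2, -⟩
    exact hd l h1 p h2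
  · exact fun q hq ↦ hq.2.2.2.2.1
  · rintro ⟨l, p⟩ ⟨h1, h2, h3, h4, h5, -⟩ ⟨x, y⟩
    have e1 : hugoniot F G p l = 0 := by
      rw [hugoniot_comm]; exact congrArg Prod.fst h5
    obtain ⟨w, hw⟩ := fderiv_surjective_of_ne_zero
      (regularManifold_fderiv_ne_zero reg hr h2 h4 (congrArg Prod.snd h5)) y
    obtain ⟨v, hv⟩ := fderiv_surjective_of_ne_zero
      (regularManifold_fderiv_ne_zero reg h2 h1 (Ne.symm h3) e1)
      (x - fderiv ℝ (hugoniot F G l) p w)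
    exact ⟨(v, w), by rw [hf l h1 p h2, hv, hw, sub_add_cancel]⟩
  · rintro ⟨l, p⟩ ⟨h1, h2, h3, h4, h5, h6⟩
    have hne := regularManifold_fderiv_ne_zero reg hr h2 h4 (congrArg Prod.snd h5)
    refine ⟨(-dv (hugoniot F G r) p, du (hugoniot F G r) p), fun h0 ↦ hne ?_, ?_⟩
    · ext <;> rw [ContinuousLinearMap.comp_apply, fderiv_apply_eq]
      · have := congrArg Prod.snd h0
        simp only [Prod.snd_zero] at this
        simp [this]
      · have := congrArg Prod.fst h0
        simp only [Prod.fst_zero, neg_eq_zero] at this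
        simp [this]
    · rw [hf l h1 p h2, map_zero, fderiv_apply_eq, fderiv_apply_eq]
      unfold cross at h6
      refine Prod.ext ?_ ?_
      · simp only [Prod.fst_zero] at h6 ⊢
        linarith
      · simp only [Prod.snd_zero]
        ring

/-- The same argument with p confined to a curve: one equation, one unknown t, and moving l alone
makes it submersive. -/
theorem measure_nontransverse_shock_curve (hreg : ∀ p ∈ U, Reg b F G p)
    (reg : RegularManifold U F G) {γ : ℝ → ℝ × ℝ} (hγ : ContDiff ℝ 1 γ) :
    volume {l | ∃ t, l ∈ U ∧ γ t ∈ U ∧ γ t ≠ l ∧ hug F G (l, γ t) = 0 ∧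
      fderiv ℝ (hug F G) (l, γ t) (0, deriv γ t) = 0} = 0 := by
  set Φ : (ℝ × ℝ) × ℝ → ℝ := fun q ↦ hug F G (q.1, γ q.2) with hΦ
  have hd : ∀ l ∈ U, ∀ t, γ t ∈ U → ContDiffAt ℝ 1 Φ (l, t) := fun l hl t ht ↦
    ContDiffAt.comp (l, t) (g := hug F G) (f := fun q ↦ (q.1, γ q.2))
      ((contDiffAt_hug (hreg l hl) (hreg _ ht)).of_le one_le_two)
      (contDiffAt_fst.prodMk (hγ.contDiffAt.comp (l, t) contDiffAt_snd))
  have hf : ∀ l ∈ U, ∀ t, γ t ∈ U → ∀ v w, fderiv ℝ Φ (l, t) (v, w) =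
      fderiv ℝ (hug F G) (l, γ t) (v, w • deriv γ t) := by
    intro l hl t ht v w
    have h1 := ((contDiffAt_hug (hreg l hl) (hreg _ ht)).differentiableAt two_ne_zero).hasFDerivAt
    have h2 : HasFDerivAt (fun q : (ℝ × ℝ) × ℝ ↦ (q.1, γ q.2)) _ (l, t) :=
      hasFDerivAt_fst.prodMk (HasFDerivAt.comp (l, t) (g := γ) (f := Prod.snd)
        (hγ.differentiable one_ne_zero t).hasFDerivAt hasFDerivAt_snd)
    have h3 := (HasFDerivAt.comp (l, t) (g := hug F G) (f := fun q ↦ (q.1, γ q.2)) h1 h2).fderiv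
    change fderiv ℝ Φ (l, t) = _ at h3
    rw [h3]
    simp
  refine measure_mono_null ?_ (measure_critical_parameters_eq_zero (μ := volume) (Φ := Φ)
    (S := {q | q.1 ∈ U ∧ γ q.2 ∈ U ∧ γ q.2 ≠ q.1 ∧ hug F G (q.1, γ q.2) = 0 ∧
      fderiv ℝ (hug F G) (q.1, γ q.2) (0, deriv γ q.2) = 0}) rfl ?_ ?_ ?_ ?_)
  · rintro l ⟨t, ht⟩
    exact ⟨(l, t), ht, rfl⟩
  · rintro ⟨l, t⟩ ⟨h1, h2, -⟩
    exact hd l h1 t h2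
  · exact fun q hq ↦ hq.2.2.2.1
  · rintro ⟨l, t⟩ ⟨h1, h2, h3, h4, -⟩ x
    have e1 : hugoniot F G (γ t) l = 0 := by rw [hugoniot_comm]; exact h4
    obtain ⟨v, hv⟩ := fderiv_surjective_of_ne_zero
      (regularManifold_fderiv_ne_zero reg h2 h1 (Ne.symm h3) e1) x
    exact ⟨(v, 0), by rw [hf l h1 t h2, zero_smul, fderiv_hug (hreg l h1) (hreg _ h2), map_zero,
      add_zero, hv]⟩
  · rintro ⟨l, t⟩ ⟨h1, h2, h3, h4, h5⟩
    exact ⟨1, one_ne_zero, by rw [hf l h1 t h2, one_smul]; exact h5⟩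

end Generic

/-! ### Almost every pair of states is generic -/

section Generic

variable {b : Bool} {F G : ℝ × ℝ → ℝ} {U : Set (ℝ × ℝ)}

/-- The pairs of distinct states of `U`. -/
def offDiagonal (U : Set (ℝ × ℝ)) : Set ((ℝ × ℝ) × (ℝ × ℝ)) := {q | q.1 ∈ U ∧ q.2 ∈ U ∧ q.2 ≠ q.1}

theorem isOpen_offDiagonal (hU : IsOpen U) : IsOpen (offDiagonal U) :=
  (hU.preimage continuous_fst).inter ((hU.preimage continuous_snd).inter
    (isOpen_ne_fun continuous_snd continuous_fst))

/-- Fubini needs measurable exceptional sets. Keeping p away from both states confines `f` to a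
region where the shock speed is continuous. -/
theorem measurableSet_exists_on_hugoniot {Z : Type*} [TopologicalSpace Z] [T1Space Z]
    (hU : IsOpen U) (hF : ContinuousOn F U) (hG : ContinuousOn G U)
    {f : ((ℝ × ℝ) × (ℝ × ℝ)) × (ℝ × ℝ) → Z}
    (hf : ContinuousOn f {q | (q.1.1, q.2) ∈ offDiagonal U ∧ (q.1.2, q.2) ∈ offDiagonal U})
    (c : Z) :
    MeasurableSet {q : (ℝ × ℝ) × (ℝ × ℝ) | ∃ p, (q.1, p) ∈ offDiagonal U ∧
      (q.2, p) ∈ offDiagonal U ∧ hugoniot F G q.2 p = 0 ∧ f (q, p) = c} := by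
  set O : Set (((ℝ × ℝ) × (ℝ × ℝ)) × (ℝ × ℝ)) :=
    {q | (q.1.1, q.2) ∈ offDiagonal U ∧ (q.1.2, q.2) ∈ offDiagonal U} with hO
  have hOo : IsOpen O := by
    have h1 := isOpen_offDiagonal hU
    exact (h1.preimage (f := fun q : ((ℝ × ℝ) × (ℝ × ℝ)) × (ℝ × ℝ) ↦ (q.1.1, q.2))
      (by fun_prop)).inter (h1.preimage
        (f := fun q : ((ℝ × ℝ) × (ℝ × ℝ)) × (ℝ × ℝ) ↦ (q.1.2, q.2)) (by fun_prop))
  have hh : ContinuousOn (fun q : ((ℝ × ℝ) × (ℝ × ℝ)) × (ℝ × ℝ) ↦ hugoniot F G q.1.2 q.2) O := by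
    have a1 : ContinuousOn (fun q : ((ℝ × ℝ) × (ℝ × ℝ)) × (ℝ × ℝ) ↦ F q.2) O :=
      hF.comp (by fun_prop) fun q hq ↦ hq.1.2.1
    have a2 : ContinuousOn (fun q : ((ℝ × ℝ) × (ℝ × ℝ)) × (ℝ × ℝ) ↦ G q.2) O :=
      hG.comp (by fun_prop) fun q hq ↦ hq.1.2.1
    have a3 : ContinuousOn (fun q : ((ℝ × ℝ) × (ℝ × ℝ)) × (ℝ × ℝ) ↦ F q.1.2) O :=
      hF.comp (by fun_prop) fun q hq ↦ hq.2.1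
    have a4 : ContinuousOn (fun q : ((ℝ × ℝ) × (ℝ × ℝ)) × (ℝ × ℝ) ↦ G q.1.2) O :=
      hG.comp (by fun_prop) fun q hq ↦ hq.2.1
    exact ((a1.sub a3).mul (by fun_prop)).sub ((a2.sub a4).mul (by fun_prop))
  convert measurableSet_exists_zero hOo (hh.prodMk hf) ((0 : ℝ), c) using 1
  ext q
  refine exists_congr fun p ↦ ?_
  rw [Prod.mk.injEq, hO]
  exact ⟨fun h ↦ ⟨⟨h.1, h.2.1⟩, h.2.2⟩, fun h ↦ ⟨h.1.1, h.1.2, h.2⟩⟩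

theorem measurableSet_exists_on_flow {Z : Type*} [TopologicalSpace Z] [T1Space Z]
    (hU : IsOpen U) {Y : ℝ × ℝ → ℝ × ℝ} (hY : GlobalField Y) {W : Set (ℝ × ℝ)} (hW : IsOpen W)
    {f : (ℝ × ℝ) × (ℝ × ℝ) → Z} (hf : ContinuousOn f (offDiagonal U)) (c : Z) :
    MeasurableSet {q : (ℝ × ℝ) × (ℝ × ℝ) | ∃ t : ℝ, (flow Y q.2 t ∈ W ∧
      (q.1, flow Y q.2 t) ∈ offDiagonal U) ∧ f (q.1, flow Y q.2 t) = c} := by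
  have hc : Continuous fun q : ((ℝ × ℝ) × (ℝ × ℝ)) × ℝ ↦ flow Y q.1.2 q.2 :=
    hY.continuous_uncurry_flow.comp (by fun_prop : Continuous
      fun q : ((ℝ × ℝ) × (ℝ × ℝ)) × ℝ ↦ (q.1.2, q.2))
  have hc2 : Continuous fun q : ((ℝ × ℝ) × (ℝ × ℝ)) × ℝ ↦ (q.1.1, flow Y q.1.2 q.2) := by
    fun_prop
  exact measurableSet_exists_zero (f := fun q : ((ℝ × ℝ) × (ℝ × ℝ)) × ℝ ↦
      f (q.1.1, flow Y q.1.2 q.2))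
    ((hW.preimage hc).inter ((isOpen_offDiagonal hU).preimage hc2))
    (hf.comp hc2.continuousOn fun q hq ↦ hq.2) c

/-- The generic properties of a pair of states, as seen from the first one. -/
structure Generic (U : Set (ℝ × ℝ)) (b : Bool) (F G : ℝ × ℝ → ℝ) (l r : ℝ × ℝ) : Prop where
  hugoniot_ne : hugoniot F G l r ≠ 0
  notMem_rarefaction : ∀ k : ℕ, l ∉ rarefactionCurve U F G k r
  shock_shock : ∀ p ∈ U, p ≠ l → p ≠ r → hugoniot F G l p = 0 → hugoniot F G r p = 0 →
    cross (du (hugoniot F G l) p, dv (hugoniot F G l) p)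
      (du (hugoniot F G r) p, dv (hugoniot F G r) p) ≠ 0
  shock_rarefaction : ∀ k : ℕ, ∀ p ∈ rarefactionCurve U F G k r, p ≠ l → hugoniot F G l p = 0 →
    fderiv ℝ (hugoniot F G l) p (field b F G k p) ≠ 0
  not_sonic : ∀ k : ℕ, k = 1 ∨ k = 2 → ∀ p ∈ U, p ≠ l → hugoniot F G l p = 0 →
    ((p ≠ r ∧ hugoniot F G r p = 0) ∨ ∃ j : ℕ, p ∈ rarefactionCurve U F G j r) →
    speed F G l p ≠ lam F G k p ∧ speed F G l p ≠ lam F G k l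

theorem continuousOn_hug_of_reg (hreg : ∀ p ∈ U, Reg b F G p) :
    ContinuousOn (hug F G) (offDiagonal U) := fun q hq ↦
  (contDiffAt_hug (hreg q.1 hq.1) (hreg q.2 hq.2.1)).continuousAt.continuousWithinAt

theorem continuousOn_fderiv_hug (hreg : ∀ p ∈ U, Reg b F G p) :
    ContinuousOn (fderiv ℝ (hug F G)) (offDiagonal U) := fun q hq ↦
  ((contDiffAt_hug (hreg q.1 hq.1) (hreg q.2 hq.2.1)).fderiv_right (m := 0)
    (by norm_num)).continuousAt.continuousWithinAt

theorem ae_hugoniot_ne (hU : IsOpen U) (hreg : ∀ p ∈ U, Reg b F G p)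
    (reg : RegularManifold U F G) :
    ∀ᵐ q : (ℝ × ℝ) × (ℝ × ℝ), q.1 ∈ U → q.2 ∈ U → q.2 ≠ q.1 → hugoniot F G q.1 q.2 ≠ 0 := by
  -- Nothing has to be projected out here, so a dummy real variable takes the place of the
  -- existential one.
  have hm := measurableSet_exists_zero (A := (ℝ × ℝ) × (ℝ × ℝ)) (B := ℝ)
    (f := fun q ↦ hug F G q.1) ((isOpen_offDiagonal hU).preimage continuous_fst)
    ((continuousOn_hug_of_reg hreg).comp continuous_fst.continuousOn fun _ h ↦ h) 0
  refine (ae_notMem_of_sections_right hm fun l ↦ ?_).mono fun q hq h1 h2 h3 h4 ↦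
    hq ⟨0, ⟨h1, h2, h3⟩, h4⟩
  by_cases hl : l ∈ U
  · refine measure_mono_null ?_ (measure_hugoniot_eq_zero hreg reg hl)
    rintro p ⟨t, h1, h2⟩
    exact ⟨h1.2.1, h1.2.2, h2⟩
  · convert measure_empty (μ := (volume : Measure (ℝ × ℝ)))
    rw [eq_empty_iff_forall_notMem]
    rintro p ⟨t, h1, -⟩
    exact hl h1.1

theorem ae_notMem_range_flow {Y : ℝ × ℝ → ℝ × ℝ} (hY : GlobalField Y) :
    ∀ᵐ q : (ℝ × ℝ) × (ℝ × ℝ), ∀ t, flow Y q.2 t ≠ q.1 := by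
  have hc : Continuous fun q : ((ℝ × ℝ) × (ℝ × ℝ)) × ℝ ↦ flow Y q.1.2 q.2 - q.1.1 :=
    (hY.continuous_uncurry_flow.comp (by fun_prop : Continuous
      fun q : ((ℝ × ℝ) × (ℝ × ℝ)) × ℝ ↦ (q.1.2, q.2))).sub (by fun_prop)
  have hm := measurableSet_exists_zero isOpen_univ hc.continuousOn (0 : ℝ × ℝ)
  refine (ae_notMem_of_sections_left hm fun r ↦ ?_).mono fun q hq t h ↦
    hq ⟨t, trivial, sub_eq_zero.2 h⟩
  refine measure_mono_null ?_ (measure_range_curve_eq_zero (hY.contDiff_flow r) (by simp))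
  rintro l ⟨t, -, h⟩
  exact ⟨t, sub_eq_zero.1 h⟩

theorem ae_shock_shock (hU : IsOpen U) (hreg : ∀ p ∈ U, Reg b F G p)
    (reg : RegularManifold U F G) :
    ∀ᵐ q : (ℝ × ℝ) × (ℝ × ℝ), q.1 ∈ U → q.2 ∈ U → ∀ p ∈ U, p ≠ q.1 → p ≠ q.2 →
      hugoniot F G q.1 p = 0 → hugoniot F G q.2 p = 0 →
      cross (du (hugoniot F G q.1) p, dv (hugoniot F G q.1) p)
        (du (hugoniot F G q.2) p, dv (hugoniot F G q.2) p) ≠ 0 := by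
  set S : Set (((ℝ × ℝ) × (ℝ × ℝ)) × (ℝ × ℝ)) :=
    {q | (q.1.1, q.2) ∈ offDiagonal U ∧ (q.1.2, q.2) ∈ offDiagonal U} with hS
  -- `D` expresses the differential of H_l at p as a jointly continuous function of (l, p), which
  -- the measurability argument needs.
  set D : ((ℝ × ℝ) × (ℝ × ℝ)) → ℝ × ℝ := fun q ↦
    (fderiv ℝ (hug F G) q (0, (1, 0)), fderiv ℝ (hug F G) q (0, (0, 1))) with hD
  have hDc : ContinuousOn D (offDiagonal U) :=
    ((continuousOn_fderiv_hug hreg).clm_apply continuousOn_const).prodMk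
      ((continuousOn_fderiv_hug hreg).clm_apply continuousOn_const)
  have hDe : ∀ l ∈ U, ∀ p ∈ U, D (l, p) = (du (hugoniot F G l) p, dv (hugoniot F G l) p) := by
    intro l hl p hp
    rw [hD]
    simp only [fderiv_hug (hreg l hl) (hreg p hp), map_zero, zero_add]
    rfl
  have d1 : ContinuousOn (fun q : ((ℝ × ℝ) × (ℝ × ℝ)) × (ℝ × ℝ) ↦ D (q.1.1, q.2)) S :=
    hDc.comp (by fun_prop) fun q hq ↦ hq.1
  have d2 : ContinuousOn (fun q : ((ℝ × ℝ) × (ℝ × ℝ)) × (ℝ × ℝ) ↦ D (q.1.2, q.2)) S :=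
    hDc.comp (by fun_prop) fun q hq ↦ hq.2
  have d3 : ContinuousOn (fun q : ((ℝ × ℝ) × (ℝ × ℝ)) × (ℝ × ℝ) ↦ hug F G (q.1.1, q.2)) S :=
    (continuousOn_hug_of_reg hreg).comp (by fun_prop) fun q hq ↦ hq.1
  have d4 : ContinuousOn (fun q : ((ℝ × ℝ) × (ℝ × ℝ)) × (ℝ × ℝ) ↦
      cross (D (q.1.1, q.2)) (D (q.1.2, q.2))) S :=
    (d1.fst.mul d2.snd).sub (d1.snd.mul d2.fst)
  have hm := measurableSet_exists_on_hugoniot (F := F) (G := G) hU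
    (fun p hp ↦ (hreg p hp).F2.continuousAt.continuousWithinAt)
    (fun p hp ↦ (hreg p hp).G2.continuousAt.continuousWithinAt) (d3.prodMk d4) ((0 : ℝ), (0 : ℝ))
  refine (ae_notMem_of_sections_left hm fun r ↦ ?_).mono
    fun q hq h1 h2 p hp h3 h4 h5 h6 h7 ↦ hq ⟨p, ⟨h1, hp, h3⟩, ⟨h2, hp, h4⟩, h6, Prod.ext h5 ?_⟩
  · by_cases hr : r ∈ U
    · refine measure_mono_null ?_ (measure_nontransverse_shock_shock hreg reg hr)
      rintro l ⟨p, h1, h2, h3, h4⟩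
      refine ⟨p, h1.1, h1.2.1, h1.2.2, h2.2.2, congrArg Prod.fst h4, h3, ?_⟩
      rw [← hDe l h1.1 p h1.2.1, ← hDe r hr p h1.2.1]
      exact congrArg Prod.snd h4
    · convert measure_empty (μ := (volume : Measure (ℝ × ℝ)))
      rw [eq_empty_iff_forall_notMem]
      rintro l ⟨p, -, h1, -⟩
      exact hr h1.1
  · simp only
    rw [hDe q.1 h1 p hp, hDe q.2 h2 p hp]
    exact h7

theorem ae_shock_flow (hU : IsOpen U) (hreg : ∀ p ∈ U, Reg b F G p)
    (reg : RegularManifold U F G) {Y : ℝ × ℝ → ℝ × ℝ} (hY : GlobalField Y) {W : Set (ℝ × ℝ)}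
    (hW : IsOpen W) :
    ∀ᵐ q : (ℝ × ℝ) × (ℝ × ℝ), q.1 ∈ U → ∀ t, flow Y q.2 t ∈ W → flow Y q.2 t ∈ U →
      flow Y q.2 t ≠ q.1 → hugoniot F G q.1 (flow Y q.2 t) = 0 →
      fderiv ℝ (hugoniot F G q.1) (flow Y q.2 t) (Y (flow Y q.2 t)) ≠ 0 := by
  have h1 : ContinuousOn (fun q : (ℝ × ℝ) × (ℝ × ℝ) ↦ fderiv ℝ (hug F G) q (0, Y q.2))
      (offDiagonal U) := (continuousOn_fderiv_hug hreg).clm_apply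
    (continuous_const.prodMk (hY.continuous.comp continuous_snd)).continuousOn
  have hm := measurableSet_exists_on_flow hU hY hW
    ((continuousOn_hug_of_reg hreg).prodMk h1) ((0 : ℝ), (0 : ℝ))
  refine (ae_notMem_of_sections_left hm fun r ↦ ?_).mono
    fun q hq h1 t ht h2 h3 h4 h5 ↦ hq ⟨t, ⟨ht, h1, h2, h3⟩, Prod.ext h4 ?_⟩
  · refine measure_mono_null ?_ (measure_nontransverse_shock_curve hreg reg (hY.contDiff_flow r))
    rintro l ⟨t, ⟨-, h1, h2, h3⟩, h4⟩
    refine ⟨t, h1, h2, h3, congrArg Prod.fst h4, ?_⟩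
    rw [(hY.hasDerivAt_flow r t).deriv]
    exact congrArg Prod.snd h4
  · simp only
    rw [fderiv_hug (hreg _ h1) (hreg _ h2), map_zero, zero_add]
    exact h5

theorem continuousOn_sonic (hreg : ∀ p ∈ U, Reg b F G p) (k : ℕ) :
    ContinuousOn (fun q : (ℝ × ℝ) × (ℝ × ℝ) ↦ speed F G q.1 q.2 - lam F G k q.1)
      (offDiagonal U) ∧
    ContinuousOn (fun q : (ℝ × ℝ) × (ℝ × ℝ) ↦ speed F G q.1 q.2 - lam F G k q.2)
      (offDiagonal U) :=
  ⟨fun _ hq ↦ (contDiffAt_speed_sub_lam hreg hq.1 hq.2.1 hq.2.2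
    k).1.continuousAt.continuousWithinAt, fun _ hq ↦ (contDiffAt_speed_sub_lam hreg hq.1 hq.2.1
    hq.2.2 k).2.continuousAt.continuousWithinAt⟩

/-- The two equalities use opposite sections. For speed = λ_k(l), fix r: p lies in the null Hugoniot
locus of r, so the sonic base states l form a null set. For speed = λ_k(p), fix l: there are
countably many sonic p, and r lies on the Hugoniot locus of one of them. -/
theorem ae_not_sonic_hugoniot (hU : IsOpen U) (hreg : ∀ p ∈ U, Reg b F G p)
    (reg : RegularManifold U F G) {k : ℕ} (hk : k = 1 ∨ k = 2) :
    ∀ᵐ q : (ℝ × ℝ) × (ℝ × ℝ), q.1 ∈ U → q.2 ∈ U → ∀ p ∈ U, p ≠ q.1 → p ≠ q.2 →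
      hugoniot F G q.1 p = 0 → hugoniot F G q.2 p = 0 →
      speed F G q.1 p ≠ lam F G k p ∧ speed F G q.1 p ≠ lam F G k q.1 := by
  set S : Set (((ℝ × ℝ) × (ℝ × ℝ)) × (ℝ × ℝ)) :=
    {q | (q.1.1, q.2) ∈ offDiagonal U ∧ (q.1.2, q.2) ∈ offDiagonal U} with hS
  have hcF : ContinuousOn F U := fun p hp ↦ (hreg p hp).F2.continuousAt.continuousWithinAt
  have hcG : ContinuousOn G U := fun p hp ↦ (hreg p hp).G2.continuousAt.continuousWithinAt
  have lift : ∀ f : (ℝ × ℝ) × (ℝ × ℝ) → ℝ, ContinuousOn f (offDiagonal U) →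
      ContinuousOn (fun q : ((ℝ × ℝ) × (ℝ × ℝ)) × (ℝ × ℝ) ↦
        (hug F G (q.1.1, q.2), f (q.1.1, q.2))) S := fun f hf ↦
    ((continuousOn_hug_of_reg hreg).prodMk hf).comp
      (f := fun q : ((ℝ × ℝ) × (ℝ × ℝ)) × (ℝ × ℝ) ↦ (q.1.1, q.2)) (by fun_prop)
      fun q hq ↦ hq.1
  have m1 := measurableSet_exists_on_hugoniot (F := F) (G := G) hU hcF hcG
    (lift _ (continuousOn_sonic hreg k).1) ((0 : ℝ), (0 : ℝ))
  have m2 := measurableSet_exists_on_hugoniot (F := F) (G := G) hU hcF hcG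
    (lift _ (continuousOn_sonic hreg k).2) ((0 : ℝ), (0 : ℝ))
  have a1 := ae_notMem_of_sections_left m1 fun r ↦ ?_
  · have a2 := ae_notMem_of_sections_right m2 fun l ↦ ?_
    · filter_upwards [a1, a2] with q q1 q2 h1 h2 p hp h3 h4 h5 h6
      exact ⟨fun h ↦ q2 ⟨p, ⟨h1, hp, h3⟩, ⟨h2, hp, h4⟩, h6, Prod.ext h5 (sub_eq_zero.2 h)⟩,
        fun h ↦ q1 ⟨p, ⟨h1, hp, h3⟩, ⟨h2, hp, h4⟩, h6, Prod.ext h5 (sub_eq_zero.2 h)⟩⟩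
    · by_cases hl : l ∈ U
      · refine measure_mono_null ?_ ((measure_biUnion_null_iff
          (countable_sonic hreg reg hl hk)).2 fun p hp ↦ measure_hugoniot_eq_zero hreg reg hp.1)
        rintro r ⟨p, h1, h2, h3, h4⟩
        refine mem_iUnion₂.2 ⟨p, ⟨h1.2.1, h1.2.2, congrArg Prod.fst h4, congrArg Prod.snd h4⟩,
          h2.1, Ne.symm h2.2.2, ?_⟩
        rw [hugoniot_comm]
        exact h3
      · convert measure_empty (μ := (volume : Measure (ℝ × ℝ)))
        rw [eq_empty_iff_forall_notMem]
        rintro r ⟨p, h1, -⟩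
        exact hl h1.1
  · by_cases hr : r ∈ U
    · refine measure_mono_null ?_ (measure_sonic_over_null hreg reg
        (measure_hugoniot_eq_zero hreg reg hr) hk)
      rintro l ⟨p, h1, h2, h3, h4⟩
      exact ⟨p, h1.1, h1.2.1, h1.2.2, ⟨h1.2.1, h2.2.2, h3⟩, congrArg Prod.fst h4,
        congrArg Prod.snd h4⟩
    · convert measure_empty (μ := (volume : Measure (ℝ × ℝ)))
      rw [eq_empty_iff_forall_notMem]
      rintro l ⟨p, -, h1, -⟩
      exact hr h1.1

/-- As for two shocks, with orbits in place of the Hugoniot locus of r. For fixed l, reversing the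
flow puts r on the orbit of one of countably many sonic points. -/
theorem ae_not_sonic_flow (hU : IsOpen U) (hreg : ∀ p ∈ U, Reg b F G p)
    (reg : RegularManifold U F G) {k : ℕ} (hk : k = 1 ∨ k = 2) {Y : ℝ × ℝ → ℝ × ℝ}
    (hY : GlobalField Y) :
    ∀ᵐ q : (ℝ × ℝ) × (ℝ × ℝ), q.1 ∈ U → ∀ t, flow Y q.2 t ∈ U →
      flow Y q.2 t ≠ q.1 → hugoniot F G q.1 (flow Y q.2 t) = 0 →
      speed F G q.1 (flow Y q.2 t) ≠ lam F G k (flow Y q.2 t) ∧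
      speed F G q.1 (flow Y q.2 t) ≠ lam F G k q.1 := by
  have m1 := measurableSet_exists_on_flow hU hY isOpen_univ
    ((continuousOn_hug_of_reg hreg).prodMk (continuousOn_sonic hreg k).1) ((0 : ℝ), (0 : ℝ))
  have m2 := measurableSet_exists_on_flow hU hY isOpen_univ
    ((continuousOn_hug_of_reg hreg).prodMk (continuousOn_sonic hreg k).2) ((0 : ℝ), (0 : ℝ))
  have a1 := ae_notMem_of_sections_left m1 fun r ↦ ?_
  · have a2 := ae_notMem_of_sections_right m2 fun l ↦ ?_
    · filter_upwards [a1, a2] with q q1 q2 h1 t h2 h3 h4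
      exact ⟨fun h ↦ q2 ⟨t, ⟨trivial, h1, h2, h3⟩, Prod.ext h4 (sub_eq_zero.2 h)⟩,
        fun h ↦ q1 ⟨t, ⟨trivial, h1, h2, h3⟩, Prod.ext h4 (sub_eq_zero.2 h)⟩⟩
    · by_cases hl : l ∈ U
      · refine measure_mono_null ?_ ((measure_biUnion_null_iff
          (countable_sonic hreg reg hl hk)).2 fun p hp ↦
            measure_range_curve_eq_zero (hY.contDiff_flow p) (by simp))
        rintro r ⟨t, ⟨-, h1⟩, h4⟩
        exact mem_iUnion₂.2 ⟨flow Y r t, ⟨h1.2.1, h1.2.2, congrArg Prod.fst h4,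
          congrArg Prod.snd h4⟩, -t, hY.flow_flow_neg r t⟩
      · convert measure_empty (μ := (volume : Measure (ℝ × ℝ)))
        rw [eq_empty_iff_forall_notMem]
        rintro r ⟨p, ⟨-, h1⟩, -⟩
        exact hl h1.1
  · refine measure_mono_null ?_ (measure_sonic_over_null hreg reg
      (measure_range_curve_eq_zero (hY.contDiff_flow r) (by simp)) hk)
    rintro l ⟨t, ⟨-, h1⟩, h4⟩
    exact ⟨flow Y r t, h1.1, h1.2.1, h1.2.2, ⟨t, rfl⟩, congrArg Prod.fst h4, congrArg Prod.snd h4⟩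

/-- Almost every pair of states is generic. -/
theorem ae_generic (hU : IsOpen U) (hreg : ∀ p ∈ U, Reg b F G p)
    (reg : RegularManifold U F G) :
    ∀ᵐ q : (ℝ × ℝ) × (ℝ × ℝ), q.1 ∈ U → q.2 ∈ U → Generic U b F G q.1 q.2 := by
  choose Y O hY hO hOU hYO hP using fun k : ℕ ↦
    exists_globalFields hU (X := field b F G k) fun p hp ↦ (hreg p hp).field1 k
  -- Each rarefaction curve has compact trace and so is an orbit of one of countably many global
  -- fields; a countable intersection of full sets then covers all of them.
  have rare : ∀ (k : ℕ) (r p : ℝ × ℝ), p ∈ rarefactionCurve U F G k r →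
      ∃ n t, flow (Y k n) r t = p ∧ p ∈ O k n := by
    intro k r p hp
    obtain ⟨P, hPc, hPU, -, h⟩ := exists_flow_of_mem_rarefactionCurve hreg hp
    obtain ⟨n, hn⟩ := hP k P hPc hPU
    obtain ⟨T, hT, hT'⟩ := h (Y k n) (hY k n) fun q hq ↦ hYO k n q (hn hq)
    exact ⟨n, T, hT, hn (hT ▸ (hT' T right_mem_uIcc).1)⟩
  have a1 := ae_hugoniot_ne hU hreg reg
  have a2 : ∀ᵐ q : (ℝ × ℝ) × (ℝ × ℝ), ∀ k n t, flow (Y k n) q.2 t ≠ q.1 :=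
    ae_all_iff.2 fun k ↦ ae_all_iff.2 fun n ↦ ae_notMem_range_flow (hY k n)
  have a3 := ae_shock_shock hU hreg reg
  have a4 := ae_all_iff.2 fun k ↦ ae_all_iff.2 fun n ↦
    ae_shock_flow hU hreg reg (hY k n) (hO k n)
  have a5 := fun k (hk : k = 1 ∨ k = 2) ↦ ae_not_sonic_hugoniot hU hreg reg hk
  have a6 := fun k (hk : k = 1 ∨ k = 2) ↦ ae_all_iff.2 fun j ↦ ae_all_iff.2 fun n ↦
    ae_not_sonic_flow hU hreg reg hk (hY j n)
  filter_upwards [a1, a2, a3, a4, a5 1 (Or.inl rfl), a5 2 (Or.inr rfl), a6 1 (Or.inl rfl),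
    a6 2 (Or.inr rfl)] with q q1 q2 q3 q4 q51 q52 q61 q62 hl hr
  -- An orbit starts at its base point, so avoiding orbits also separates the two states.
  have hne : q.2 ≠ q.1 := fun h ↦ q2 0 0 0 (by rw [(hY 0 0).flow_zero, h])
  refine ⟨q1 hl hr hne, fun k h ↦ ?_, q3 hl hr, fun k p hp h1 h2 ↦ ?_,
    fun k hk p hp h1 h2 h3 ↦ ?_⟩
  · obtain ⟨n, t, ht, -⟩ := rare k _ _ h
    exact q2 k n t ht
  · obtain ⟨n, t, ht, hpO⟩ := rare k _ _ hp
    have := q4 k n hl t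
    rw [ht, hYO k n p hpO] at this
    exact this hpO (hOU k n hpO) h1 h2
  · rcases h3 with ⟨h3, h4⟩ | ⟨j, hj⟩
    · rcases hk with rfl | rfl
      exacts [q51 hl hr p hp h1 h3 h2 h4, q52 hl hr p hp h1 h3 h2 h4]
    · obtain ⟨n, t, ht, hpO⟩ := rare j _ _ hj
      rw [← ht] at hp h1 h2 ⊢
      rcases hk with rfl | rfl
      exacts [q61 j n hl t hp h1 h2, q62 j n hl t hp h1 h2]

theorem ae_restrict_generic (hU : IsOpen U) (hreg : ∀ p ∈ U, Reg b F G p)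
    (reg : RegularManifold U F G) :
    ∀ᵐ q : (ℝ × ℝ) × (ℝ × ℝ) ∂(volume.restrict (U ×ˢ U)), q.1 ∈ U ∧ q.2 ∈ U ∧
      Generic U b F G q.1 q.2 ∧ Generic U b F G q.2 q.1 := by
  rw [ae_restrict_iff' (hU.prod hU).measurableSet]
  have h1 := ae_generic hU hreg reg
  have h2 := (Measure.measurePreserving_swap (μ := (volume : Measure (ℝ × ℝ)))
    (ν := (volume : Measure (ℝ × ℝ)))).quasiMeasurePreserving.ae h1
  filter_upwards [h1, h2] with q q1 q2 hq
  exact ⟨hq.1, hq.2, q1 hq.1 hq.2, q2 hq.2 hq.1⟩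

end Generic

/-! ### Compactness along ultrafilters -/

section Ultrafilter

variable {ι E : Type*} {𝒰 : Ultrafilter ι}

theorem exists_tendsto_of_eventually_mem [TopologicalSpace E] {K : Set E} (hK : IsCompact K)
    {p : ι → E} (hp : ∀ᶠ x in 𝒰, p x ∈ K) : ∃ q ∈ K, Tendsto p 𝒰 (𝓝 q) := by
  obtain ⟨q, hq, hle⟩ := hK.ultrafilter_le_nhds (𝒰.map p) (le_principal_iff.2 hp)
  exact ⟨q, hq, hle⟩

/-- A property that holds eventually along each convergent family in a compact set holds
eventually on the whole compact set. -/
theorem eventually_forall_mem [TopologicalSpace E] {K : Set E} (hK : IsCompact K)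
    {P : ι → E → Prop} (h : ∀ (p : ι → E) (q : E), (∀ᶠ x in 𝒰, p x ∈ K) → q ∈ K →
      Tendsto p 𝒰 (𝓝 q) → ∀ᶠ x in 𝒰, P x (p x)) : ∀ᶠ x in 𝒰, ∀ p ∈ K, P x p := by
  -- Along an ultrafilter the failure of an eventual property is itself eventual, so the
  -- counterexamples form a family, and it converges by compactness.
  by_contra hn
  have h1 : ∀ᶠ x in 𝒰, ∃ p, p ∈ K ∧ ¬ P x p := by
    filter_upwards [Ultrafilter.eventually_not.2 hn] with x hx
    push Not at hx
    exact hx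
  have : Nonempty E := h1.exists.elim fun _ h ↦ ⟨h.choose⟩
  obtain ⟨p, hp⟩ := h1.choice
  obtain ⟨q, hq, hpq⟩ := exists_tendsto_of_eventually_mem hK (hp.mono fun x hx ↦ hx.1)
  obtain ⟨x, h2, h3⟩ := ((h p q (hp.mono fun x hx ↦ hx.1) hq hpq).and hp).exists
  exact h3.2 h2

/-- There is a family of positive numbers that tends to zero. -/
def HasGauge (l : Filter ι) : Prop := ∃ e : ι → ℝ, (∀ x, 0 < e x) ∧ Tendsto e l (𝓝 0)

variable [PseudoMetricSpace E]

/-- For each index a point is chosen whose distance to `z₀` is within the gauge of the infimum. Such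
near-minimizers converge without a diagonal argument. -/
theorem exists_tendsto_of_forall_closedBall {l : Filter ι} [l.NeBot] (hl : HasGauge l) {z₀ : E}
    {Q : ι → E → Prop}
    (h : ∀ ρ > 0, ∀ᶠ x in l, ∃ z ∈ Metric.closedBall z₀ ρ, Q x z) :
    ∃ z : ι → E, Tendsto z l (𝓝 z₀) ∧ ∀ᶠ x in l, Q x (z x) := by
  obtain ⟨e, he, he0⟩ := hl
  have : Nonempty E := ⟨z₀⟩
  have h1 : ∀ᶠ x in l, ∃ z, Q x z ∧ ∀ z', Q x z' → dist z z₀ ≤ dist z' z₀ + e x := by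
    filter_upwards [h 1 one_pos] with x ⟨z, _, hz⟩
    have hbdd : BddBelow ((dist · z₀) '' {z | Q x z}) := ⟨0, by
      rintro _ ⟨z, -, rfl⟩; exact dist_nonneg⟩
    obtain ⟨_, ⟨w, hw, rfl⟩, hlt⟩ := exists_lt_of_csInf_lt (s := (dist · z₀) '' {z | Q x z})
      ⟨_, z, hz, rfl⟩ (lt_add_of_pos_right (sInf ((dist · z₀) '' {z | Q x z})) (he x))
    exact ⟨w, hw, fun z' hz' ↦ hlt.le.trans
      (add_le_add_left (csInf_le hbdd ⟨z', hz', rfl⟩) _)⟩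
  have : Nonempty E := ⟨z₀⟩
  obtain ⟨z, hz⟩ := h1.choice
  refine ⟨z, ?_, hz.mono fun x hx ↦ hx.1⟩
  rw [Metric.tendsto_nhds]
  intro ε hε
  filter_upwards [hz, h (ε / 2) (half_pos hε), he0.eventually (gt_mem_nhds (half_pos hε))]
    with x hx ⟨z', h1, h2⟩ h3
  have := hx.2 z' h2
  rw [Metric.mem_closedBall] at h1
  linarith

/-- A property that holds eventually along each family that tends to a point holds
eventually on a neighbourhood of that point. -/
theorem exists_closedBall_of_forall_tendsto (hl : HasGauge (𝒰 : Filter ι)) {z₀ : E}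
    {P : ι → E → Prop}
    (h : ∀ z : ι → E, Tendsto z 𝒰 (𝓝 z₀) → ∀ᶠ x in 𝒰, P x (z x)) :
    ∃ ρ > 0, ∀ᶠ x in 𝒰, ∀ z ∈ Metric.closedBall z₀ ρ, P x z := by
  by_contra! hn
  obtain ⟨z, hz, hz'⟩ := exists_tendsto_of_forall_closedBall hl (z₀ := z₀)
    (Q := fun x z ↦ ¬ P x z) hn
  obtain ⟨x, h1, h2⟩ := ((h z hz).and hz').exists
  exact h2 h1

end Ultrafilter

/-- Families of maps whose derivatives converge to an invertible map have zeros near approximate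
zeros. -/
theorem exists_tendsto_zero {ι V W : Type*} {𝒰 : Ultrafilter ι}
    [NormedAddCommGroup V] [NormedSpace ℝ V] [CompleteSpace V] [Nontrivial V] [NormedAddCommGroup W]
    [NormedSpace ℝ W] (hl : HasGauge (𝒰 : Filter ι)) {Φ : ι → V → W}
    {Φ' : ι → V → V →L[ℝ] W} {z₀ : V} (A : V ≃L[ℝ] W)
    (hd : ∀ z : ι → V, Tendsto z 𝒰 (𝓝 z₀) → ∀ᶠ x in 𝒰, HasFDerivAt (Φ x) (Φ' x (z x)) (z x))
    (hc : ∀ z : ι → V, Tendsto z 𝒰 (𝓝 z₀) → Tendsto (fun x ↦ Φ' x (z x)) 𝒰 (𝓝 (A : V →L[ℝ] W)))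
    (h0 : Tendsto (fun x ↦ Φ x z₀) 𝒰 (𝓝 0)) :
    ∃ z : ι → V, Tendsto z 𝒰 (𝓝 z₀) ∧ ∀ᶠ x in 𝒰, Φ x (z x) = 0 := by
  refine exists_tendsto_of_forall_closedBall hl (z₀ := z₀) (Q := fun x z ↦ Φ x z = 0)
    fun ρ hρ ↦ ?_
  set N : NNReal := A.toNonlinearRightInverse.nnnorm with hN
  have hNpos : 0 < N := A.norm_symm_pos
  obtain ⟨σ, hσ, hσ'⟩ := exists_closedBall_of_forall_tendsto hl (z₀ := z₀)
    (P := fun x z ↦ HasFDerivAt (Φ x) (Φ' x z) z ∧ ‖Φ' x z - A‖ ≤ (N⁻¹ / 2 : NNReal)) fun z hz ↦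
      (hd z hz).and (((tendsto_iff_norm_sub_tendsto_zero.1 (hc z hz)).eventually
        (gt_mem_nhds (NNReal.coe_pos.2 (half_pos (inv_pos.2 hNpos))))).mono fun x hx ↦ hx.le)
  have hτ0 : 0 < min ρ σ := lt_min hρ hσ
  -- This is the radius of the ball around Φ x z₀ that is covered by the image of the ball of radius
  -- min ρ σ: the expansion rate N⁻¹ of `A`, less the derivative error N⁻¹ / 2.
  have hgap : 0 < ((N : ℝ)⁻¹ - (N⁻¹ / 2 : NNReal)) * min ρ σ := by
    have : 0 < (N : ℝ)⁻¹ := inv_pos.2 hNpos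
    push_cast
    have : 0 < (N : ℝ)⁻¹ - (N : ℝ)⁻¹ / 2 := by linarith
    positivity
  filter_upwards [hσ', (tendsto_iff_norm_sub_tendsto_zero.1 h0).eventually
    (gt_mem_nhds hgap)] with x hx hx0
  have happ : ApproximatesLinearOn (Φ x) (A : V →L[ℝ] W) (Metric.closedBall z₀ σ)
      (N⁻¹ / 2 : NNReal) := by
    intro u hu v hv
    exact (convex_closedBall z₀ σ).norm_image_sub_le_of_norm_hasFDerivWithin_le'
      (fun z hz ↦ (hx z hz).1.hasFDerivWithinAt) (fun z hz ↦ (hx z hz).2) hv hu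
  obtain ⟨z, hz, hz0⟩ := happ.surjOn_closedBall_of_nonlinearRightInverse
    A.toNonlinearRightInverse hτ0.le (Metric.closedBall_subset_closedBall (min_le_right ρ σ))
    (show (0 : W) ∈ _ by
      rw [Metric.mem_closedBall, dist_comm, dist_eq_norm]
      exact hx0.le)
  exact ⟨z, Metric.closedBall_subset_closedBall (min_le_left ρ σ) hz, hz0⟩

/-! ### Families of systems that converge in C²(K) -/

/-- Continuous convergence on `K` along an ultrafilter. -/
def ContConv {ι E Y : Type*} [TopologicalSpace E] [TopologicalSpace Y] (𝒰 : Ultrafilter ι)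
    (K : Set E) (φ : ι → E → Y) (ψ : E → Y) : Prop :=
  ∀ (p : ι → E) (q : E), (∀ᶠ x in 𝒰, p x ∈ K) → Tendsto p 𝒰 (𝓝 q) →
    Tendsto (fun x ↦ φ x (p x)) 𝒰 (𝓝 (ψ q))

theorem tendsto_clm_apply {ι V W : Type*} [NormedAddCommGroup V] [NormedSpace ℝ V]
    [NormedAddCommGroup W] [NormedSpace ℝ W] {l : Filter ι} {A : ι → V →L[ℝ] W} {A₀ : V →L[ℝ] W}
    {v : ι → V} {v₀ : V} (hA : Tendsto A l (𝓝 A₀)) (hv : Tendsto v l (𝓝 v₀)) :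
    Tendsto (fun x ↦ A x (v x)) l (𝓝 (A₀ v₀)) :=
  ((isBoundedBilinearMap_apply (𝕜 := ℝ) (E := V) (F := W)).continuous.tendsto (A₀, v₀)).comp
    (hA.prodMk_nhds hv)

/-- Convergence of families of fluxes in `C²(K)`. -/
structure FluxConv {ι : Type*} (𝒰 : Ultrafilter ι) (K : Set (ℝ × ℝ)) (f : ι → ℝ × ℝ → ℝ)
    (f₀ : ℝ × ℝ → ℝ) : Prop where
  contDiffAt : ∀ x, ∀ p ∈ K, ContDiffAt ℝ 2 (f x) p
  val : ContConv 𝒰 K f f₀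
  der : ContConv 𝒰 K (fun x ↦ fderiv ℝ (f x)) (fderiv ℝ f₀)
  der2 : ContConv 𝒰 K (fun x ↦ fderiv ℝ (fderiv ℝ (f x))) (fderiv ℝ (fderiv ℝ f₀))

/-- A family of systems that converges to a regular one on a compact set. -/
structure Perturb {ι : Type*} (𝒰 : Ultrafilter ι) (K : Set (ℝ × ℝ)) (b : Bool)
    (F₀ G₀ : ℝ × ℝ → ℝ) (F G : ι → ℝ × ℝ → ℝ) : Prop where
  isCompact : IsCompact K
  reg : ∀ p ∈ K, Reg b F₀ G₀ p
  convF : FluxConv 𝒰 K F F₀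
  convG : FluxConv 𝒰 K G G₀
  gauge : HasGauge (𝒰 : Filter ι)

namespace Perturb

variable {ι : Type*} {𝒰 : Ultrafilter ι} {K : Set (ℝ × ℝ)} {b : Bool} {F₀ G₀ : ℝ × ℝ → ℝ}
  {F G : ι → ℝ × ℝ → ℝ} {p : ι → ℝ × ℝ} {q : ℝ × ℝ} {g : ι → ℝ × ℝ} {g₀ : ℝ × ℝ}

theorem mem (h : Perturb 𝒰 K b F₀ G₀ F G) (hp : ∀ᶠ x in 𝒰, p x ∈ K) (hpq : Tendsto p 𝒰 (𝓝 q)) :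
    q ∈ K :=
  h.isCompact.isClosed.mem_of_tendsto hpq hp

theorem tendsto_jet (h : Perturb 𝒰 K b F₀ G₀ F G) (hp : ∀ᶠ x in 𝒰, p x ∈ K)
    (hpq : Tendsto p 𝒰 (𝓝 q)) :
    Tendsto (fun x ↦ jet (F x) (G x) (p x)) 𝒰 (𝓝 (jet F₀ G₀ q)) := by
  have h1 : Tendsto (fun x ↦ fderiv ℝ (F x) (p x)) 𝒰 (𝓝 (fderiv ℝ F₀ q)) :=
    h.convF.der p q hp hpq
  have h2 : Tendsto (fun x ↦ fderiv ℝ (G x) (p x)) 𝒰 (𝓝 (fderiv ℝ G₀ q)) :=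
    h.convG.der p q hp hpq
  exact h1.prodMk_nhds h2

theorem tendsto_lam (h : Perturb 𝒰 K b F₀ G₀ F G) (k : ℕ) (hp : ∀ᶠ x in 𝒰, p x ∈ K)
    (hpq : Tendsto p 𝒰 (𝓝 q)) :
    Tendsto (fun x ↦ lam (F x) (G x) k (p x)) 𝒰 (𝓝 (lam F₀ G₀ k q)) := by
  simp only [lam_eq_jetLam]
  have hc : ContinuousAt (jetLam k) (jet F₀ G₀ q) :=
    (contDiffAt_jetLam (n := 1) (h.reg q (h.mem hp hpq)).disc_pos).continuousAt
  exact Tendsto.comp hc (h.tendsto_jet hp hpq)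

theorem tendsto_field (h : Perturb 𝒰 K b F₀ G₀ F G) (k : ℕ) (hp : ∀ᶠ x in 𝒰, p x ∈ K)
    (hpq : Tendsto p 𝒰 (𝓝 q)) :
    Tendsto (fun x ↦ field b (F x) (G x) k (p x)) 𝒰 (𝓝 (field b F₀ G₀ k q)) := by
  have hc : ContinuousAt (jetField b k) (jet F₀ G₀ q) :=
    (contDiffAt_jetField (n := 1) (h.reg q (h.mem hp hpq)).disc_pos).continuousAt
  exact Tendsto.comp hc (h.tendsto_jet hp hpq)

theorem eventually_disc_pos (h : Perturb 𝒰 K b F₀ G₀ F G) (hp : ∀ᶠ x in 𝒰, p x ∈ K)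
    (hpq : Tendsto p 𝒰 (𝓝 q)) : ∀ᶠ x in 𝒰, 0 < jetDisc (jet (F x) (G x) (p x)) := by
  have hc : Tendsto jetDisc (𝓝 (jet F₀ G₀ q)) (𝓝 (jetDisc (jet F₀ G₀ q))) :=
    (contDiff_jetDisc (n := 0)).continuous.tendsto _
  exact (hc.comp (h.tendsto_jet hp hpq)).eventually
    (lt_mem_nhds (h.reg q (h.mem hp hpq)).disc_pos)

end Perturb

/-- By the chain rule the gradient of a characteristic speed depends continuously on the first two
derivatives of the fluxes; C² convergence thus controls genuine nonlinearity. -/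
theorem fderiv_lam {F G : ℝ × ℝ → ℝ} {p : ℝ × ℝ} (hF : ContDiffAt ℝ 2 F p)
    (hG : ContDiffAt ℝ 2 G p) (hd : 0 < jetDisc (jet F G p)) (k : ℕ) :
    fderiv ℝ (lam F G k) p = (fderiv ℝ (jetLam k) (jet F G p)).comp
      ((fderiv ℝ (fderiv ℝ F) p).prod (fderiv ℝ (fderiv ℝ G) p)) := by
  have h1 := ((hF.fderiv_right (m := 1) (by norm_num)).differentiableAt one_ne_zero).hasFDerivAt
  have h2 := ((hG.fderiv_right (m := 1) (by norm_num)).differentiableAt one_ne_zero).hasFDerivAt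
  have h3 := ((contDiffAt_jetLam (n := 1) (k := k) hd).differentiableAt one_ne_zero).hasFDerivAt
  exact (h3.comp p (h1.prodMk h2)).fderiv

namespace Perturb

variable {ι : Type*} {𝒰 : Ultrafilter ι} {K : Set (ℝ × ℝ)} {b : Bool} {F₀ G₀ : ℝ × ℝ → ℝ}
  {F G : ι → ℝ × ℝ → ℝ} {p : ι → ℝ × ℝ} {q : ℝ × ℝ} {g : ι → ℝ × ℝ} {g₀ : ℝ × ℝ}

theorem tendsto_fderiv_lam (h : Perturb 𝒰 K b F₀ G₀ F G) (k : ℕ) (hp : ∀ᶠ x in 𝒰, p x ∈ K)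
    (hpq : Tendsto p 𝒰 (𝓝 q)) :
    Tendsto (fun x ↦ fderiv ℝ (lam (F x) (G x) k) (p x)) 𝒰 (𝓝 (fderiv ℝ (lam F₀ G₀ k) q)) := by
  have hq := h.reg q (h.mem hp hpq)
  rw [fderiv_lam hq.F2 hq.G2 hq.disc_pos]
  have h1 : Tendsto (fun x ↦ fderiv ℝ (jetLam k) (jet (F x) (G x) (p x))) 𝒰
      (𝓝 (fderiv ℝ (jetLam k) (jet F₀ G₀ q))) :=
    (((contDiffAt_jetLam (n := 1) hq.disc_pos).fderiv_right (m := 0)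
      (by simp)).continuousAt.tendsto).comp (h.tendsto_jet hp hpq)
  have h2 : Tendsto (fun x ↦ (fderiv ℝ (fderiv ℝ (F x)) (p x)).prod
      (fderiv ℝ (fderiv ℝ (G x)) (p x))) 𝒰
      (𝓝 ((fderiv ℝ (fderiv ℝ F₀) q).prod (fderiv ℝ (fderiv ℝ G₀) q))) :=
    ((ContinuousLinearMap.prodₗᵢ (𝕜 := ℝ) (E := ℝ × ℝ) (F := ℝ × ℝ →L[ℝ] ℝ)
      (G := ℝ × ℝ →L[ℝ] ℝ) ℝ).continuous.tendsto _).comp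
      ((h.convF.der2 p q hp hpq).prodMk_nhds (h.convG.der2 p q hp hpq))
  have h3 : Tendsto (fun x ↦ (fderiv ℝ (jetLam k) (jet (F x) (G x) (p x))).comp
      ((fderiv ℝ (fderiv ℝ (F x)) (p x)).prod (fderiv ℝ (fderiv ℝ (G x)) (p x)))) 𝒰
      (𝓝 ((fderiv ℝ (jetLam k) (jet F₀ G₀ q)).comp
        ((fderiv ℝ (fderiv ℝ F₀) q).prod (fderiv ℝ (fderiv ℝ G₀) q)))) :=
    (isBoundedBilinearMap_comp.continuous.tendsto _).comp (h1.prodMk_nhds h2)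
  refine h3.congr' ?_
  filter_upwards [hp, h.eventually_disc_pos hp hpq] with x hx hd
  exact (fderiv_lam (h.convF.contDiffAt x _ hx) (h.convG.contDiffAt x _ hx) hd k).symm

theorem tendsto_gnl (h : Perturb 𝒰 K b F₀ G₀ F G) (k : ℕ) (hp : ∀ᶠ x in 𝒰, p x ∈ K)
    (hpq : Tendsto p 𝒰 (𝓝 q)) :
    Tendsto (fun x ↦ fderiv ℝ (lam (F x) (G x) k) (p x) (field b (F x) (G x) k (p x))) 𝒰
      (𝓝 (fderiv ℝ (lam F₀ G₀ k) q (field b F₀ G₀ k q))) :=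
  tendsto_clm_apply (h.tendsto_fderiv_lam k hp hpq) (h.tendsto_field k hp hpq)

/-- The inequalities in `Reg` pass from the limit to each convergent family of points, and
compactness of `K` makes this uniform. -/
theorem eventually_reg (h : Perturb 𝒰 K b F₀ G₀ F G) :
    ∀ᶠ x in 𝒰, ∀ p ∈ K, Reg b (F x) (G x) p := by
  refine eventually_forall_mem h.isCompact fun p q hp hq hpq ↦ ?_
  have hr := h.reg q hq
  filter_upwards [hp, h.eventually_disc_pos hp hpq,
    (((continuous_jetEntry b).tendsto _).comp (h.tendsto_jet hp hpq)).eventually_ne hr.entry_ne,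
    (h.tendsto_gnl 1 hp hpq).eventually_ne (hr.gnl 1 (Or.inl rfl)),
    (h.tendsto_gnl 2 hp hpq).eventually_ne (hr.gnl 2 (Or.inr rfl))] with x h1 h2 h3 h4 h5
  refine ⟨h.convF.contDiffAt x _ h1, h.convG.contDiffAt x _ h1, h2, h3, ?_⟩
  rintro k (rfl | rfl)
  exacts [h4, h5]

/-- The speeds of the rarefaction waves vary at a uniform rate. -/
theorem exists_gnl_lower_bound (h : Perturb 𝒰 K b F₀ G₀ F G) {k : ℕ} (hk : k = 1 ∨ k = 2) :
    ∃ m > 0, ∀ᶠ x in 𝒰, ∀ p ∈ K,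
      m ≤ |fderiv ℝ (lam (F x) (G x) k) p (field b (F x) (G x) k p)| := by
  obtain ⟨m, hm, hm'⟩ : ∃ m > 0, ∀ p ∈ K, m ≤ |fderiv ℝ (lam F₀ G₀ k) p (field b F₀ G₀ k p)| := by
    rcases K.eq_empty_or_nonempty with rfl | hne
    · exact ⟨1, one_pos, by simp⟩
    · obtain ⟨p, hp, hmin⟩ := h.isCompact.exists_isMinOn hne (f := fun p ↦
        |fderiv ℝ (lam F₀ G₀ k) p (field b F₀ G₀ k p)|) fun p hp ↦
          ((h.reg p hp).continuousAt_gnl k).abs.continuousWithinAt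
      exact ⟨_, abs_pos.2 ((h.reg p hp).gnl k hk), fun q hq ↦ hmin hq⟩
  refine ⟨m / 2, half_pos hm, eventually_forall_mem h.isCompact fun p q hp hq hpq ↦ ?_⟩
  refine ((h.tendsto_gnl k hp hpq).abs.eventually (lt_mem_nhds
    (lt_of_lt_of_le (half_lt_self hm) (hm' q hq)))).mono fun x hx ↦ hx.le

theorem tendsto_hugoniot (h : Perturb 𝒰 K b F₀ G₀ F G) (hg : ∀ᶠ x in 𝒰, g x ∈ K)
    (hgg : Tendsto g 𝒰 (𝓝 g₀)) (hp : ∀ᶠ x in 𝒰, p x ∈ K) (hpq : Tendsto p 𝒰 (𝓝 q)) :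
    Tendsto (fun x ↦ hugoniot (F x) (G x) (g x) (p x)) 𝒰 (𝓝 (hugoniot F₀ G₀ g₀ q)) := by
  have a1 := h.convF.val p q hp hpq
  have a2 := h.convF.val g g₀ hg hgg
  have a3 := h.convG.val p q hp hpq
  have a4 := h.convG.val g g₀ hg hgg
  exact ((a1.sub a2).mul (hpq.snd_nhds.sub hgg.snd_nhds)).sub
    ((a3.sub a4).mul (hpq.fst_nhds.sub hgg.fst_nhds))

theorem tendsto_fderiv_hugoniot (h : Perturb 𝒰 K b F₀ G₀ F G) (hg : ∀ᶠ x in 𝒰, g x ∈ K)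
    (hgg : Tendsto g 𝒰 (𝓝 g₀)) (hp : ∀ᶠ x in 𝒰, p x ∈ K) (hpq : Tendsto p 𝒰 (𝓝 q)) :
    Tendsto (fun x ↦ fderiv ℝ (hugoniot (F x) (G x) (g x)) (p x)) 𝒰
      (𝓝 (fderiv ℝ (hugoniot F₀ G₀ g₀) q)) := by
  have hr := h.reg q (h.mem hp hpq)
  rw [(hasFDerivAt_hugoniot (hr.F2.differentiableAt two_ne_zero)
    (hr.G2.differentiableAt two_ne_zero) g₀).fderiv]
  have a1 := h.convF.val p q hp hpq
  have a2 := h.convF.val g g₀ hg hgg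
  have a3 := h.convG.val p q hp hpq
  have a4 := h.convG.val g g₀ hg hgg
  have d1 := h.convF.der p q hp hpq
  have d3 := h.convG.der p q hp hpq
  have e1 := hpq.fst_nhds.sub hgg.fst_nhds
  have e2 := hpq.snd_nhds.sub hgg.snd_nhds
  refine (((e2.smul d1).add ((a1.sub a2).smul_const (ContinuousLinearMap.snd ℝ ℝ ℝ))).sub
    ((e1.smul d3).add ((a3.sub a4).smul_const (ContinuousLinearMap.fst ℝ ℝ ℝ)))).congr' ?_
  filter_upwards [hp] with x hx
  exact (hasFDerivAt_hugoniot ((h.convF.contDiffAt x _ hx).differentiableAt two_ne_zero)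
    ((h.convG.contDiffAt x _ hx).differentiableAt two_ne_zero) (g x)).fderiv.symm

theorem tendsto_speed (h : Perturb 𝒰 K b F₀ G₀ F G) (hg : ∀ᶠ x in 𝒰, g x ∈ K)
    (hgg : Tendsto g 𝒰 (𝓝 g₀)) (hp : ∀ᶠ x in 𝒰, p x ∈ K) (hpq : Tendsto p 𝒰 (𝓝 q))
    (hne : q ≠ g₀) :
    Tendsto (fun x ↦ speed (F x) (G x) (g x) (p x)) 𝒰 (𝓝 (speed F₀ G₀ g₀ q)) := by
  have a1 := h.convF.val p q hp hpq
  have a2 := h.convF.val g g₀ hg hgg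
  have a3 := h.convG.val p q hp hpq
  have a4 := h.convG.val g g₀ hg hgg
  have e1 := hpq.fst_nhds.sub hgg.fst_nhds
  have e2 := hpq.snd_nhds.sub hgg.snd_nhds
  exact (((a1.sub a2).mul e1).add ((a3.sub a4).mul e2)).div ((e1.pow 2).add (e2.pow 2))
    (normSq_pos hne).ne'

theorem tendsto_conormal (h : Perturb 𝒰 K b F₀ G₀ F G) (k : ℕ) (hg : ∀ᶠ x in 𝒰, g x ∈ K)
    (hgg : Tendsto g 𝒰 (𝓝 g₀)) (hp : ∀ᶠ x in 𝒰, p x ∈ K) (hpq : Tendsto p 𝒰 (𝓝 q)) (c : Wave) :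
    Tendsto (fun x ↦ conormal b (F x) (G x) k (g x) (p x) c) 𝒰 (𝓝 (conormal b F₀ G₀ k g₀ q c)) := by
  cases c
  · have := h.tendsto_fderiv_hugoniot hg hgg hp hpq
    exact (tendsto_clm_apply this tendsto_const_nhds).prodMk_nhds
      (tendsto_clm_apply this tendsto_const_nhds)
  · have := h.tendsto_field k hp hpq
    exact this.snd_nhds.neg.prodMk_nhds this.fst_nhds

end Perturb

/-! ### Global extensions of the characteristic fields and limits of rarefaction curves -/

theorem exists_globalField_eqOn {E : Type*} [NormedAddCommGroup E] [NormedSpace ℝ E]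
    [FiniteDimensional ℝ E] {K : Set E} (hK : IsCompact K) {X : E → E}
    (hX : ∀ p ∈ K, ContDiffAt ℝ 1 X p) : ∃ Z, GlobalField Z ∧ ∀ p ∈ K, Z p = X p := by
  obtain ⟨χ, h1, h2, h3, h4, -⟩ := exists_cutoff hK
    (isOpen_interior (s := {x | ContDiffAt ℝ 1 X x}))
    fun p hp ↦ mem_interior_iff_mem_nhds.2 ((hX p hp).eventually (by simp))
  refine ⟨fun x ↦ χ x • X x, globalField_cutoff h1 h2 fun x hx ↦ interior_subset (h3 hx),
    fun p hp ↦ ?_⟩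
  change χ p • X p = X p
  rw [h4.self_of_nhdsSet p hp, one_smul]

theorem globalField_zero {E : Type*} [NormedAddCommGroup E] [NormedSpace ℝ E] :
    GlobalField fun _ : E ↦ (0 : E) :=
  ⟨⟨0, LipschitzWith.const 0⟩, 0, by simp⟩

theorem exists_mul_eq_of_mem_uIcc {s t T : ℝ} (h : t ∈ uIcc s T) :
    ∃ θ ∈ Icc (0 : ℝ) 1, t = s + θ * (T - s) := by
  rw [← segment_eq_uIcc, segment_eq_image'] at h
  obtain ⟨θ, hθ, rfl⟩ := h
  exact ⟨θ, hθ, rfl⟩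

theorem add_mul_mem_uIcc {s T θ : ℝ} (h : θ ∈ Icc (0 : ℝ) 1) : s + θ * (T - s) ∈ uIcc s T := by
  rw [← segment_eq_uIcc, segment_eq_image']
  exact ⟨θ, h, rfl⟩

/-- Global fields that extend the characteristic fields from `K`. -/
structure FieldExt {ι : Type*} (𝒰 : Ultrafilter ι) (K : Set (ℝ × ℝ)) (b : Bool)
    (F₀ G₀ : ℝ × ℝ → ℝ) (F G : ι → ℝ × ℝ → ℝ) (k : ℕ) (Y : ℝ × ℝ → ℝ × ℝ)
    (Z : ι → ℝ × ℝ → ℝ × ℝ) : Prop where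
  globalY : GlobalField Y
  globalZ : ∀ x, GlobalField (Z x)
  eqY : ∀ p ∈ K, Y p = field b F₀ G₀ k p
  eqZ : ∀ᶠ x in 𝒰, ∀ p ∈ K, Z x p = field b (F x) (G x) k p

section

variable {ι : Type*} {𝒰 : Ultrafilter ι} {K : Set (ℝ × ℝ)} {b : Bool} {F₀ G₀ : ℝ × ℝ → ℝ}
  {F G : ι → ℝ × ℝ → ℝ} {p p' : ι → ℝ × ℝ} {q : ℝ × ℝ} {g : ι → ℝ × ℝ} {g₀ : ℝ × ℝ} {k : ℕ}
  {Y : ℝ × ℝ → ℝ × ℝ} {Z : ι → ℝ × ℝ → ℝ × ℝ}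

theorem Perturb.exists_fieldExt (h : Perturb 𝒰 K b F₀ G₀ F G) (k : ℕ) :
    ∃ Y Z, FieldExt 𝒰 K b F₀ G₀ F G k Y Z := by
  obtain ⟨Y, hY, hY'⟩ := exists_globalField_eqOn h.isCompact fun p hp ↦ (h.reg p hp).field1 k
  have : ∀ x, ∃ Z, GlobalField Z ∧ ((∀ p ∈ K, Reg b (F x) (G x) p) →
      ∀ p ∈ K, Z p = field b (F x) (G x) k p) := by
    intro x
    by_cases hx : ∀ p ∈ K, Reg b (F x) (G x) p
    · obtain ⟨Z, hZ, hZ'⟩ := exists_globalField_eqOn h.isCompact fun p hp ↦ (hx p hp).field1 k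
      exact ⟨Z, hZ, fun _ ↦ hZ'⟩
    -- A default field for the indices whose system is not regular on `K`; these are negligible for
    -- the ultrafilter.
    · exact ⟨_, globalField_zero, fun h ↦ absurd h hx⟩
  choose Z hZ hZ' using this
  exact ⟨Y, Z, hY, hZ, hY', h.eventually_reg.mono hZ'⟩

/-- The extensions are close to each other only on `K`, which is why the perturbed orbits are
assumed to stay there. -/
theorem FieldExt.tendsto_flow (hYZ : FieldExt 𝒰 K b F₀ G₀ F G k Y Z)
    (h : Perturb 𝒰 K b F₀ G₀ F G) (hg : Tendsto g 𝒰 (𝓝 g₀)) {t : ι → ℝ} {t₀ : ℝ}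
    (ht : Tendsto t 𝒰 (𝓝 t₀))
    (hK : ∀ᶠ x in 𝒰, ∀ τ ∈ uIcc 0 (t x), flow (Z x) (g x) τ ∈ K) :
    Tendsto (fun x ↦ flow (Z x) (g x) (t x)) 𝒰 (𝓝 (flow Y g₀ t₀)) := by
  refine hYZ.globalY.tendsto_flow hYZ.globalZ hg ht fun ε hε ↦ ?_
  have : ∀ᶠ x in 𝒰, ∀ p ∈ K, ‖Z x p - Y p‖ ≤ ε := by
    refine eventually_forall_mem h.isCompact fun p q hp hq hpq ↦ ?_
    have h1 := (h.tendsto_field k hp hpq).sub (hYZ.globalY.continuous.continuousAt.tendsto.comp hpq)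
    have h2 := h1.norm
    rw [hYZ.eqY q hq, sub_self, norm_zero] at h2
    filter_upwards [h2.eventually (gt_mem_nhds hε), hYZ.eqZ, hp] with x hx hZ hpx
    rw [hZ _ hpx]
    exact hx.le
  filter_upwards [this, hK] with x hx hKx t ht
  exact hx _ (hKx t ht)

/-- Genuine nonlinearity bounds elapsed time by the change of the characteristic speed. So flow
times stay bounded, and points of one orbit that merge in the limit have merging times. -/
theorem FieldExt.exists_time_bound (hYZ : FieldExt 𝒰 K b F₀ G₀ F G k Y Z)
    (h : Perturb 𝒰 K b F₀ G₀ F G) (hk : k = 1 ∨ k = 2) :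
    ∃ m > 0, ∀ᶠ x in 𝒰, ∀ g s t, (∀ τ ∈ uIcc s t, flow (Z x) g τ ∈ K) →
      m * |t - s| ≤
        |lam (F x) (G x) k (flow (Z x) g t) - lam (F x) (G x) k (flow (Z x) g s)| := by
  obtain ⟨m, hm, hm'⟩ := h.exists_gnl_lower_bound hk
  refine ⟨m, hm, ?_⟩
  filter_upwards [hm', hYZ.eqZ, h.eventually_reg] with x hx hZ hr g s t hst
  refine mul_abs_sub_le_of_le_abs_deriv (φ := fun t ↦ lam (F x) (G x) k (flow (Z x) g t))
    (ρ := fun t ↦ fderiv ℝ (lam (F x) (G x) k) (flow (Z x) g t)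
      (field b (F x) (G x) k (flow (Z x) g t))) (fun τ hτ ↦ ?_) fun τ hτ ↦ hx _ (hst τ hτ)
  have h1 := (hYZ.globalZ x).hasDerivAt_flow g τ
  rw [hZ _ (hst τ hτ)] at h1
  exact (((hr _ (hst τ hτ)).lam1 k).differentiableAt one_ne_zero).hasFDerivAt.comp_hasDerivAt τ h1

/-- Rarefaction curves are described by flow times that converge. -/
theorem FieldExt.exists_times (hYZ : FieldExt 𝒰 K b F₀ G₀ F G k Y Z)
    (h : Perturb 𝒰 K b F₀ G₀ F G) (hk : k = 1 ∨ k = 2) (hgK : ∀ᶠ x in 𝒰, g x ∈ K)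
    (hg : Tendsto g 𝒰 (𝓝 g₀)) (hpq : Tendsto p 𝒰 (𝓝 q))
    (hp : ∀ᶠ x in 𝒰, p x ∈ rarefactionCurve K (F x) (G x) k (g x)) :
    ∃ (T : ι → ℝ) (T₀ : ℝ), Tendsto T 𝒰 (𝓝 T₀) ∧ flow Y g₀ T₀ = q ∧
      ∀ᶠ x in 𝒰, flow (Z x) (g x) (T x) = p x ∧ ∀ τ ∈ uIcc 0 (T x), flow (Z x) (g x) τ ∈ K := by
  have hpK : ∀ᶠ x in 𝒰, p x ∈ K := hp.mono fun x hx ↦ hx.1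
  have h1 : ∀ᶠ x in 𝒰, ∃ T, flow (Z x) (g x) T = p x ∧
      ∀ τ ∈ uIcc 0 T, flow (Z x) (g x) τ ∈ K := by
    filter_upwards [hp, h.eventually_reg, hYZ.eqZ] with x hx hr hZ
    obtain ⟨P, -, hPK, -, hP⟩ := exists_flow_of_mem_rarefactionCurve hr hx
    obtain ⟨T, hT, hT'⟩ := hP (Z x) (hYZ.globalZ x) fun q hq ↦ hZ q (hPK hq)
    exact ⟨T, hT, fun τ hτ ↦ hPK (hT' τ hτ).1⟩
  obtain ⟨T, hT⟩ := h1.choice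
  obtain ⟨m, hm, hm'⟩ := hYZ.exists_time_bound h hk
  have hlim : Tendsto (fun x ↦ |lam (F x) (G x) k (p x) - lam (F x) (G x) k (g x)|) 𝒰
      (𝓝 |lam F₀ G₀ k q - lam F₀ G₀ k g₀|) :=
    ((h.tendsto_lam k hpK hpq).sub (h.tendsto_lam k hgK hg)).abs
  set R := (|lam F₀ G₀ k q - lam F₀ G₀ k g₀| + 1) / m with hR
  have hTR : ∀ᶠ x in 𝒰, T x ∈ Icc (-R) R := by
    filter_upwards [hT, hm', hlim.eventually (gt_mem_nhds (lt_add_one _))] with x hx hmx hlx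
    have := hmx (g x) 0 (T x) hx.2
    rw [hx.1, (hYZ.globalZ x).flow_zero, sub_zero] at this
    rw [mem_Icc, ← abs_le, hR, le_div_iff₀ hm]
    linarith
  obtain ⟨T₀, -, hT₀⟩ := exists_tendsto_of_eventually_mem isCompact_Icc hTR
  refine ⟨T, T₀, hT₀, ?_, hT⟩
  refine tendsto_nhds_unique (hYZ.tendsto_flow h hg hT₀ (hT.mono fun x hx ↦ hx.2)) ?_
  exact hpq.congr' (hT.mono fun x hx ↦ hx.1.symm)

/-- Limits of points of rarefaction curves. -/
theorem Perturb.mem_rarefactionCurve_of_tendsto (h : Perturb 𝒰 K b F₀ G₀ F G)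
    (hk : k = 1 ∨ k = 2) {U : Set (ℝ × ℝ)} (hU : IsOpen U) (hKU : K ⊆ U)
    (hgK : ∀ᶠ x in 𝒰, g x ∈ K) (hg : Tendsto g 𝒰 (𝓝 g₀)) (hpq : Tendsto p 𝒰 (𝓝 q))
    (hp : ∀ᶠ x in 𝒰, p x ∈ rarefactionCurve K (F x) (G x) k (g x)) :
    q ∈ rarefactionCurve U F₀ G₀ k g₀ := by
  obtain ⟨Y, Z, hYZ⟩ := h.exists_fieldExt k
  obtain ⟨T, T₀, hT, hTq, hT'⟩ := hYZ.exists_times h hk hgK hg hpq hp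
  -- An intermediate point of the limit orbit is the limit of the points at the same fraction of the
  -- perturbed flow times.
  have hK : ∀ τ ∈ uIcc 0 T₀, flow Y g₀ τ ∈ K := by
    intro τ hτ
    obtain ⟨θ, hθ, rfl⟩ := exists_mul_eq_of_mem_uIcc hτ
    have hsub : ∀ᶠ x in 𝒰, ∀ τ ∈ uIcc 0 (0 + θ * (T x - 0)), flow (Z x) (g x) τ ∈ K :=
      hT'.mono fun x hx τ hτ ↦ hx.2 τ (uIcc_subset_uIcc left_mem_uIcc (add_mul_mem_uIcc hθ) hτ)
    refine h.mem (hsub.mono fun x hx ↦ hx _ right_mem_uIcc)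
      (hYZ.tendsto_flow h hg (((hT.sub_const 0).const_mul θ).const_add 0) hsub)
  -- The limit orbit may touch the boundary of `K` before its end point, so it is claimed as a
  -- rarefaction curve in `U` only.
  have := mem_rarefactionCurve_of_curve (D := U) (γ := flow Y g₀) (T := T₀) hk
    (fun t ht ↦ h.reg _ (hK t ht))
    (fun t ht ↦ by
      rw [← hYZ.eqY _ (hK t ht)]
      exact hYZ.globalY.hasDerivAt_flow g₀ t)
    (fun t ht _ ↦ by
      rw [hU.interior_eq]
      exact hKU (hK t ht)) (hKU (hK T₀ right_mem_uIcc))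
  rwa [hYZ.globalY.flow_zero, hTq] at this

/-- The secants through two families of points are asymptotically annihilated by `θ`. -/
def Secant {ι : Type*} (𝒰 : Ultrafilter ι) (θ : ℝ × ℝ) (p p' : ι → ℝ × ℝ) : Prop :=
  ∀ ε > 0, ∀ᶠ x in 𝒰, |dot θ (p x - p' x)| ≤ ε * ‖p x - p' x‖

theorem abs_dot_le (θ v : ℝ × ℝ) : |dot θ v| ≤ 2 * ‖θ‖ * ‖v‖ := by
  have h1 := norm_fst_le θ
  have h2 := norm_snd_le θ
  have h3 := norm_fst_le v
  have h4 := norm_snd_le v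
  rw [Real.norm_eq_abs] at h1 h2 h3 h4
  calc |dot θ v| ≤ |θ.1 * v.1| + |θ.2 * v.2| := abs_add_le _ _
    _ = |θ.1| * |v.1| + |θ.2| * |v.2| := by rw [abs_mul, abs_mul]
    _ ≤ ‖θ‖ * ‖v‖ + ‖θ‖ * ‖v‖ := by gcongr
    _ = _ := by ring

/-- By Cramer's rule two independent covectors recover a vector up to a constant factor, so a secant
that is o of its own length under both of them must vanish. -/
theorem Secant.eventually_eq {θ θ' : ℝ × ℝ} (h1 : Secant 𝒰 θ p p') (h2 : Secant 𝒰 θ' p p')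
    (hc : cross θ θ' ≠ 0) : ∀ᶠ x in 𝒰, p x = p' x := by
  set C := ‖θ‖ + ‖θ'‖ + 1 with hC
  have hCpos : 0 < C := by positivity
  -- With this choice Cramer's rule bounds |cross θ θ'| ‖v‖ by half of itself.
  set ε := |cross θ θ'| / (4 * C) with hε
  have hε0 : 0 < ε := by positivity
  filter_upwards [h1 ε hε0, h2 ε hε0] with x h1 h2
  set v := p x - p' x with hv
  have e1 : |cross θ θ' * v.1| ≤ 2 * C * (ε * ‖v‖) := by
    have : cross θ θ' * v.1 = θ'.2 * dot θ v - θ.2 * dot θ' v := by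
      simp only [cross, dot]; ring
    have k1 := norm_snd_le θ
    have k2 := norm_snd_le θ'
    rw [Real.norm_eq_abs] at k1 k2
    rw [this]
    calc _ ≤ |θ'.2 * dot θ v| + |θ.2 * dot θ' v| := abs_sub _ _
      _ ≤ C * (ε * ‖v‖) + C * (ε * ‖v‖) := by
        rw [abs_mul, abs_mul]
        gcongr
        · linarith [norm_nonneg θ]
        · linarith [norm_nonneg θ']
      _ = _ := by ring
  have e2 : |cross θ θ' * v.2| ≤ 2 * C * (ε * ‖v‖) := by
    have : cross θ θ' * v.2 = θ.1 * dot θ' v - θ'.1 * dot θ v := by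
      simp only [cross, dot]; ring
    have k1 := norm_fst_le θ
    have k2 := norm_fst_le θ'
    rw [Real.norm_eq_abs] at k1 k2
    rw [this]
    calc _ ≤ |θ.1 * dot θ' v| + |θ'.1 * dot θ v| := abs_sub _ _
      _ ≤ C * (ε * ‖v‖) + C * (ε * ‖v‖) := by
        rw [abs_mul, abs_mul]
        gcongr
        · linarith [norm_nonneg θ']
        · linarith [norm_nonneg θ]
      _ = _ := by ring
  have e3 : |cross θ θ'| * ‖v‖ ≤ 2 * C * (ε * ‖v‖) := by
    rw [Prod.norm_def, mul_max_of_nonneg _ _ (abs_nonneg _), Real.norm_eq_abs, Real.norm_eq_abs,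
      ← abs_mul, ← abs_mul]
    exact max_le e1 e2
  have e4 : 2 * C * (ε * ‖v‖) = |cross θ θ'| * ‖v‖ / 2 := by
    rw [hε]; field_simp; ring
  have e5 : |cross θ θ'| * ‖v‖ = 0 := by
    have : 0 ≤ |cross θ θ'| * ‖v‖ := by positivity
    linarith
  rcases mul_eq_zero.1 e5 with e | e
  · exact absurd (abs_eq_zero.1 e) hc
  · exact sub_eq_zero.1 (norm_eq_zero.1 e)

end

/-! ### Secants of the two kinds of wave curves -/

section Secants

variable {ι : Type*} {𝒰 : Ultrafilter ι} {K : Set (ℝ × ℝ)} {b : Bool} {F₀ G₀ : ℝ × ℝ → ℝ}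
  {F G : ι → ℝ × ℝ → ℝ} {p p' : ι → ℝ × ℝ} {q : ℝ × ℝ} {g : ι → ℝ × ℝ} {g₀ : ℝ × ℝ} {k : ℕ}
  {Y : ℝ × ℝ → ℝ × ℝ} {Z : ι → ℝ × ℝ → ℝ × ℝ}

/-- Both points lie on one orbit, at times S and T with a common limit. The velocity in between is
uniformly close to the eigenvector X at q, so the secant is (T - S) X up to o(|T - S|). -/
theorem Perturb.secant_rarefaction (h : Perturb 𝒰 K b F₀ G₀ F G)
    (hk : k = 1 ∨ k = 2) (hgK : ∀ᶠ x in 𝒰, g x ∈ K) (hg : Tendsto g 𝒰 (𝓝 g₀))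
    (hpq : Tendsto p 𝒰 (𝓝 q)) (hpq' : Tendsto p' 𝒰 (𝓝 q))
    (hp : ∀ᶠ x in 𝒰, p x ∈ rarefactionCurve K (F x) (G x) k (g x))
    (hp' : ∀ᶠ x in 𝒰, p' x ∈ rarefactionCurve K (F x) (G x) k (g x)) :
    Secant 𝒰 (conormal b F₀ G₀ k g₀ q Wave.rarefaction) p p' := by
  have hpK : ∀ᶠ x in 𝒰, p x ∈ K := hp.mono fun x hx ↦ hx.1
  have hpK' : ∀ᶠ x in 𝒰, p' x ∈ K := hp'.mono fun x hx ↦ hx.1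
  obtain ⟨Y, Z, hYZ⟩ := h.exists_fieldExt k
  obtain ⟨T, T₀, hT, hTq, hT'⟩ := hYZ.exists_times h hk hgK hg hpq hp
  obtain ⟨S, S₀, hS, hSq, hS'⟩ := hYZ.exists_times h hk hgK hg hpq' hp'
  obtain ⟨m, hm, hm'⟩ := hYZ.exists_time_bound h hk
  have hsub : ∀ᶠ x in 𝒰, ∀ τ ∈ uIcc (S x) (T x), flow (Z x) (g x) τ ∈ K := by
    filter_upwards [hT', hS'] with x hx hx' τ hτ
    rcases uIcc_subset_uIcc_union_uIcc (b := 0) hτ with h1 | h1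
    · exact hx'.2 τ (by rwa [uIcc_comm])
    · exact hx.2 τ h1
  have hST : S₀ = T₀ := by
    have h1 : Tendsto (fun x ↦ m * |T x - S x|) 𝒰 (𝓝 (m * |T₀ - S₀|)) :=
      ((hT.sub hS).abs).const_mul m
    have h2 : Tendsto (fun x ↦ |lam (F x) (G x) k (p x) - lam (F x) (G x) k (p' x)|) 𝒰
        (𝓝 |lam F₀ G₀ k q - lam F₀ G₀ k q|) :=
      ((h.tendsto_lam k hpK hpq).sub (h.tendsto_lam k hpK' hpq')).abs
    have h3 := le_of_tendsto_of_tendsto h1 h2 (by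
      filter_upwards [hm', hsub, hT', hS'] with x h1 h2 h3 h4
      have := h1 (g x) (S x) (T x) h2
      rwa [h3.1, h4.1] at this)
    rw [sub_self, abs_zero] at h3
    have h4 : |T₀ - S₀| ≤ 0 := by
      by_contra hn
      have := mul_pos hm (not_le.1 hn)
      linarith
    have := abs_nonpos_iff.1 h4
    linarith
  set X := field b F₀ G₀ k q with hX
  have hqK := h.mem hpK hpq
  have hX0 : 0 < ‖X‖ := norm_pos_iff.2 ((h.reg q hqK).field_ne_zero k)
  have hfld : ∀ η > 0, ∀ᶠ x in 𝒰, ∀ τ ∈ uIcc (S x) (T x),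
      ‖Z x (flow (Z x) (g x) τ) - X‖ ≤ η := by
    intro η hη
    have h1 : ∀ᶠ x in 𝒰, ∀ θ ∈ Icc (0 : ℝ) 1,
        ‖Z x (flow (Z x) (g x) (S x + θ * (T x - S x))) - X‖ ≤ η := by
      refine eventually_forall_mem isCompact_Icc fun θ θ₀ hθ _ hθθ ↦ ?_
      have ht : Tendsto (fun x ↦ S x + θ x * (T x - S x)) 𝒰 (𝓝 T₀) := by
        have := hS.add (hθθ.mul (hT.sub hS))
        rwa [hST, sub_self, mul_zero, add_zero] at this
      have hK : ∀ᶠ x in 𝒰, ∀ τ ∈ uIcc 0 (S x + θ x * (T x - S x)), flow (Z x) (g x) τ ∈ K := by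
        filter_upwards [hsub, hS', hθ] with x h1 h2 h3 τ hτ
        rcases uIcc_subset_uIcc_union_uIcc (b := S x) hτ with h4 | h4
        · exact h2.2 τ h4
        · exact h1 τ (uIcc_subset_uIcc left_mem_uIcc (add_mul_mem_uIcc h3) h4)
      have h2 := hYZ.tendsto_flow h hg ht hK
      rw [hTq] at h2
      have h3 := ((h.tendsto_field k (hK.mono fun x hx ↦ hx _ right_mem_uIcc) h2).sub_const X).norm
      rw [sub_self, norm_zero] at h3
      filter_upwards [h3.eventually (gt_mem_nhds hη), hYZ.eqZ, hK] with x h4 h5 h6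
      rw [h5 _ (h6 _ right_mem_uIcc)]
      exact h4.le
    filter_upwards [h1] with x hx τ hτ
    obtain ⟨θ, hθ, rfl⟩ := exists_mul_eq_of_mem_uIcc hτ
    exact hx θ hθ
  intro ε hε
  set η := min (‖X‖ / 2) (ε / 4) with hη
  have hη0 : 0 < η := lt_min (by positivity) (by positivity)
  filter_upwards [hfld η hη0, hT', hS'] with x hx hTx hSx
  have hd : ‖(p x - p' x) - (T x - S x) • X‖ ≤ η * |T x - S x| := by
    have := Convex.norm_image_sub_le_of_norm_hasDerivWithin_le (s := uIcc (S x) (T x))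
      (f := fun τ ↦ flow (Z x) (g x) τ - τ • X) (f' := fun τ ↦ Z x (flow (Z x) (g x) τ) - X)
      (C := η) (x := S x) (y := T x) (fun τ _ ↦ by
        have h1 := ((hYZ.globalZ x).hasDerivAt_flow (g x) τ).sub
          ((hasDerivAt_id τ).smul_const X)
        rw [one_smul] at h1
        exact h1.hasDerivWithinAt) hx (convex_uIcc _ _) left_mem_uIcc right_mem_uIcc
    rw [hTx.1, hSx.1, Real.norm_eq_abs] at this
    have e : p x - p' x - (T x - S x) • X = p x - T x • X - (p' x - S x • X) := by
      rw [sub_smul]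
      abel
    rwa [e]
  set v := p x - p' x with hv
  -- Since X ≠ 0, an error in terms of the time difference is also an error in terms of the length
  -- of the secant.
  have hT2 : |T x - S x| * ‖X‖ ≤ 2 * ‖v‖ := by
    have h1 : ‖(T x - S x) • X‖ ≤ ‖v‖ + ‖v - (T x - S x) • X‖ := by
      calc ‖(T x - S x) • X‖ = ‖v - (v - (T x - S x) • X)‖ := by rw [sub_sub_cancel]
        _ ≤ _ := norm_sub_le _ _
    rw [norm_smul, Real.norm_eq_abs] at h1
    have h2 : η * |T x - S x| ≤ ‖X‖ / 2 * |T x - S x| := by gcongr; exact min_le_left _ _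
    nlinarith
  have hdot : dot (conormal b F₀ G₀ k g₀ q Wave.rarefaction) v =
      dot (conormal b F₀ G₀ k g₀ q Wave.rarefaction) (v - (T x - S x) • X) := by
    simp only [dot, conormal, ← hX, Prod.fst_sub, Prod.snd_sub, Prod.smul_fst, Prod.smul_snd,
      smul_eq_mul]
    ring
  have hnorm : ‖conormal b F₀ G₀ k g₀ q Wave.rarefaction‖ = ‖X‖ := by
    rw [conormal, ← hX, Prod.norm_def, Prod.norm_def, norm_neg, max_comm]
  calc |dot (conormal b F₀ G₀ k g₀ q Wave.rarefaction) v|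
      ≤ 2 * ‖X‖ * ‖v - (T x - S x) • X‖ := by
        rw [hdot, ← hnorm]
        exact abs_dot_le _ _
    _ ≤ 2 * ‖X‖ * (ε / 4 * |T x - S x|) := by
        gcongr
        exact hd.trans (by gcongr; exact min_le_right _ _)
    _ = ε / 2 * (|T x - S x| * ‖X‖) := by ring
    _ ≤ ε / 2 * (2 * ‖v‖) := by gcongr
    _ = ε * ‖v‖ := by ring

theorem dot_conormal_shock (b : Bool) (F G : ℝ × ℝ → ℝ) (k : ℕ) (g p v : ℝ × ℝ) :
    dot (conormal b F G k g p Wave.shock) v = fderiv ℝ (hugoniot F G g) p v := by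
  rw [fderiv_apply_eq, dot, conormal]
  ring

/-- This version needs no convex neighbourhood of q inside `K`; it serves for limits on the
boundary, where the linearization error is supplied at nearby points of `K`. -/
theorem Perturb.secant_shock_of_small (h : Perturb 𝒰 K b F₀ G₀ F G) {a : ι → ℝ × ℝ} {e : ι → ℝ}
    (he : Tendsto e 𝒰 (𝓝 0)) (hgK : ∀ᶠ x in 𝒰, g x ∈ K) (hg : Tendsto g 𝒰 (𝓝 g₀))
    (ha : ∀ᶠ x in 𝒰, a x ∈ K) (haq : Tendsto a 𝒰 (𝓝 q))
    (hsmall : ∀ᶠ x in 𝒰, |fderiv ℝ (hugoniot (F x) (G x) (g x)) (a x) (p x - p' x)| ≤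
      e x * ‖p x - p' x‖) :
    Secant 𝒰 (conormal b F₀ G₀ k g₀ q Wave.shock) p p' := by
  intro ε hε
  have h1 := tendsto_iff_norm_sub_tendsto_zero.1 (h.tendsto_fderiv_hugoniot hgK hg ha haq)
  filter_upwards [h1.eventually (gt_mem_nhds (half_pos hε)), he.eventually
    (gt_mem_nhds (half_pos hε)), hsmall] with x h1 h2 h3
  rw [dot_conormal_shock]
  set v := p x - p' x with hv
  set A := fderiv ℝ (hugoniot (F x) (G x) (g x)) (a x) with hA
  set A₀ := fderiv ℝ (hugoniot F₀ G₀ g₀) q with hA₀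
  have h4 : A₀ v = A v - (A - A₀) v := by simp
  calc |A₀ v| ≤ |A v| + |(A - A₀) v| := by rw [h4]; exact abs_sub _ _
    _ ≤ e x * ‖v‖ + ‖A - A₀‖ * ‖v‖ := add_le_add h3 ((A - A₀).le_opNorm v)
    _ ≤ ε / 2 * ‖v‖ + ε / 2 * ‖v‖ := by gcongr
    _ = ε * ‖v‖ := by ring

/-- At an interior point the mean value inequality on a small ball applies: both values of the
Hugoniot function vanish, and its differential is uniformly close to the limit differential. -/
theorem Perturb.secant_shock (h : Perturb 𝒰 K b F₀ G₀ F G)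
    (hgK : ∀ᶠ x in 𝒰, g x ∈ K) (hg : Tendsto g 𝒰 (𝓝 g₀)) (hq : q ∈ interior K)
    (hpq : Tendsto p 𝒰 (𝓝 q)) (hpq' : Tendsto p' 𝒰 (𝓝 q))
    (hp : ∀ᶠ x in 𝒰, hugoniot (F x) (G x) (g x) (p x) = 0)
    (hp' : ∀ᶠ x in 𝒰, hugoniot (F x) (G x) (g x) (p' x) = 0) :
    Secant 𝒰 (conormal b F₀ G₀ k g₀ q Wave.shock) p p' := by
  intro ε hε
  obtain ⟨ρ, hρ, hρ'⟩ := exists_closedBall_of_forall_tendsto h.gauge (z₀ := q)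
    (P := fun x z ↦ z ∈ K ∧
      ‖fderiv ℝ (hugoniot (F x) (G x) (g x)) z - fderiv ℝ (hugoniot F₀ G₀ g₀) q‖ ≤ ε)
    fun z hz ↦ by
      have hzK : ∀ᶠ x in 𝒰, z x ∈ K := hz.eventually (mem_interior_iff_mem_nhds.1 hq)
      have h1 := tendsto_iff_norm_sub_tendsto_zero.1 (h.tendsto_fderiv_hugoniot hgK hg hzK hz)
      exact hzK.and ((h1.eventually (gt_mem_nhds hε)).mono fun x hx ↦ hx.le)
  filter_upwards [hρ', hpq.eventually (Metric.closedBall_mem_nhds q hρ),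
    hpq'.eventually (Metric.closedBall_mem_nhds q hρ), hp, hp'] with x h1 h2 h3 h4 h5
  have := (convex_closedBall q ρ).norm_image_sub_le_of_norm_hasFDerivWithin_le'
    (f := hugoniot (F x) (G x) (g x)) (f' := fderiv ℝ (hugoniot (F x) (G x) (g x)))
    (fun z hz ↦ ((contDiffAt_hugoniot_right (h.convF.contDiffAt x z (h1 z hz).1)
      (h.convG.contDiffAt x z (h1 z hz).1) (g x)).differentiableAt
        two_ne_zero).hasFDerivAt.hasFDerivWithinAt)
    (fun z hz ↦ (h1 z hz).2) h3 h2
  rw [h4, h5, sub_self, zero_sub, norm_neg] at this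
  rw [dot_conormal_shock]
  exact this

end Secants

/-! ### Persistence of rarefaction curves -/

section Branch

variable {ι : Type*} {𝒰 : Ultrafilter ι} {K : Set (ℝ × ℝ)} {b : Bool} {F₀ G₀ : ℝ × ℝ → ℝ}
  {F G : ι → ℝ × ℝ → ℝ} {q : ℝ × ℝ} {g : ι → ℝ × ℝ} {g₀ : ℝ × ℝ} {k : ℕ}

/-- Rarefaction curves persist under perturbations. -/
theorem Perturb.exists_branch (h : Perturb 𝒰 K b F₀ G₀ F G) (hk : k = 1 ∨ k = 2)
    (hg : Tendsto g 𝒰 (𝓝 g₀)) (hq : q ∈ rarefactionCurve K F₀ G₀ k g₀) (hqK : q ∈ interior K) :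
    ∃ (γ : ι → ℝ → ℝ × ℝ) (T₀ : ℝ), ∀ t : ι → ℝ, Tendsto t 𝒰 (𝓝 T₀) →
      Tendsto (fun x ↦ γ x (t x)) 𝒰 (𝓝 q) ∧ ∀ᶠ x in 𝒰,
        γ x (t x) ∈ rarefactionCurve K (F x) (G x) k (g x) ∧
        HasDerivAt (γ x) (field b (F x) (G x) k (γ x (t x))) (t x) := by
  obtain ⟨P, hP, -, hPi, hPflow⟩ := exists_flow_of_mem_rarefactionCurve h.reg hq
  have hPK : P ⊆ interior K := hPi.trans (insert_subset hqK subset_rfl)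
  -- Cutting off inside `K` makes the fields converge uniformly on the whole plane, so the flows
  -- converge with no prior knowledge that the orbits stay in `K`.
  obtain ⟨χ, c1, c2, c3, c4, c5⟩ := exists_cutoff hP isOpen_interior hPK
  have c3' : tsupport χ ⊆ K := c3.trans interior_subset
  set Y : ℝ × ℝ → ℝ × ℝ := fun p ↦ χ p • field b F₀ G₀ k p with hYdef
  have hY : GlobalField Y := globalField_cutoff c1 c2 fun p hp ↦ (h.reg p (c3' hp)).field1 k
  have : ∀ x, ∃ Z : ℝ × ℝ → ℝ × ℝ, GlobalField Z ∧ ((∀ p ∈ K, Reg b (F x) (G x) p) →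
      Z = fun p ↦ χ p • field b (F x) (G x) k p) := by
    intro x
    by_cases hx : ∀ p ∈ K, Reg b (F x) (G x) p
    · exact ⟨_, globalField_cutoff c1 c2 fun p hp ↦ (hx p (c3' hp)).field1 k, fun _ ↦ rfl⟩
    · exact ⟨_, globalField_zero, fun h ↦ absurd h hx⟩
  choose Z hZ hZ' using this
  have hZe : ∀ᶠ x in 𝒰, Z x = fun p ↦ χ p • field b (F x) (G x) k p := h.eventually_reg.mono hZ'
  have hclose : ∀ ε > 0, ∀ᶠ x in 𝒰, ∀ p, ‖Z x p - Y p‖ ≤ ε := by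
    intro ε hε
    have h1 : ∀ᶠ x in 𝒰, ∀ p ∈ K, ‖field b (F x) (G x) k p - field b F₀ G₀ k p‖ ≤ ε := by
      refine eventually_forall_mem h.isCompact fun p q hp hq hpq ↦ ?_
      have h1 := ((h.tendsto_field k hp hpq).sub
        (((h.reg q hq).field1 k).continuousAt.tendsto.comp hpq)).norm
      rw [sub_self, norm_zero] at h1
      exact (h1.eventually (gt_mem_nhds hε)).mono fun x hx ↦ hx.le
    filter_upwards [h1, hZe] with x hx hZx p
    rw [hZx, hYdef]
    change ‖χ p • field b (F x) (G x) k p - χ p • field b F₀ G₀ k p‖ ≤ ε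
    by_cases hp : p ∈ tsupport χ
    · rw [← smul_sub, norm_smul, Real.norm_eq_abs, abs_of_nonneg (c5 p).1]
      exact (mul_le_of_le_one_left (norm_nonneg _) (c5 p).2).trans (hx p (c3' hp))
    · rw [image_eq_zero_of_notMem_tsupport hp, zero_smul, zero_smul, sub_self, norm_zero]
      exact hε.le
  have hflow : ∀ (t : ι → ℝ) (t₀ : ℝ), Tendsto t 𝒰 (𝓝 t₀) →
      Tendsto (fun x ↦ flow (Z x) (g x) (t x)) 𝒰 (𝓝 (flow Y g₀ t₀)) := fun t t₀ ht ↦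
    hY.tendsto_flow hZ hg ht fun ε hε ↦ (hclose ε hε).mono fun x hx τ _ ↦ hx _
  obtain ⟨T₀, hT₀, hT₀'⟩ := hPflow Y hY fun p hp ↦ by
    rw [hYdef]
    change χ p • field b F₀ G₀ k p = _
    rw [c4.self_of_nhdsSet p hp, one_smul]
  set W := interior {p | χ p = 1} ∩ interior K with hW
  have hWo : IsOpen W := isOpen_interior.inter isOpen_interior
  have hPW : P ⊆ W := fun p hp ↦ ⟨subset_interior_iff_mem_nhdsSet.2 c4 hp, hPK hp⟩
  refine ⟨fun x ↦ flow (Z x) (g x), T₀, fun t ht ↦ ⟨hT₀ ▸ hflow t T₀ ht, ?_⟩⟩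
  -- The fraction θ of the perturbed orbit tends to a point of `P`; compactness of [0, 1] makes the
  -- inclusion in the open set `W` uniform in θ.
  have hmem : ∀ᶠ x in 𝒰, ∀ θ ∈ Icc (0 : ℝ) 1, flow (Z x) (g x) (0 + θ * (t x - 0)) ∈ W := by
    refine eventually_forall_mem isCompact_Icc fun θ θ₀ _ hθ₀ hθ ↦ ?_
    refine (hflow _ _ ((hθ.mul (ht.sub_const 0)).const_add 0)).eventually (hWo.mem_nhds (hPW ?_))
    exact (hT₀' _ (add_mul_mem_uIcc hθ₀)).1
  filter_upwards [hmem, hZe, h.eventually_reg] with x hx hZx hr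
  have hx' : ∀ τ ∈ uIcc 0 (t x), flow (Z x) (g x) τ ∈ W := by
    intro τ hτ
    obtain ⟨θ, hθ, rfl⟩ := exists_mul_eq_of_mem_uIcc hτ
    exact hx θ hθ
  have hder : ∀ τ ∈ uIcc 0 (t x), HasDerivAt (flow (Z x) (g x))
      (field b (F x) (G x) k (flow (Z x) (g x) τ)) τ := by
    intro τ hτ
    have h1 := (hZ x).hasDerivAt_flow (g x) τ
    have h2 : Z x (flow (Z x) (g x) τ) = field b (F x) (G x) k (flow (Z x) (g x) τ) := by
      have h3 := congrFun hZx (flow (Z x) (g x) τ)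
      rw [h3, interior_subset (s := {p | χ p = 1}) (hx' τ hτ).1, one_smul]
    rwa [h2] at h1
  refine ⟨?_, hder _ right_mem_uIcc⟩
  have := mem_rarefactionCurve_of_curve (D := K) (γ := flow (Z x) (g x)) (T := t x) hk
    (fun τ hτ ↦ hr _ (interior_subset (hx' τ hτ).2)) hder (fun τ hτ _ ↦ (hx' τ hτ).2)
    (interior_subset (hx' _ right_mem_uIcc).2)
  rwa [(hZ x).flow_zero] at this

end Branch

/-! ### Wave curves of generic states -/

section Waves

variable {b : Bool} {F G : ℝ × ℝ → ℝ} {D U : Set (ℝ × ℝ)} {l r p g : ℝ × ℝ} {c d : Wave} {k : ℕ}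

theorem fullCurve_subset : fullCurve D F G k g c ⊆ D := by
  cases c <;> exact fun p hp ↦ hp.1

theorem forwardOne_subset : forwardOne D F G l c ⊆ fullCurve D F G 1 l c := by
  cases c
  · rintro p ⟨hp, s, hs, -⟩
    exact ⟨hp, hs.hugoniot_eq_zero⟩
  · exact fun p hp ↦ hp.1

theorem backwardTwo_subset : backwardTwo D F G r c ⊆ fullCurve D F G 2 r c := by
  cases c
  · rintro p ⟨hp, s, hs, -⟩
    exact ⟨hp, hs.symm.hugoniot_eq_zero⟩
  · exact fun p hp ↦ hp.1

/-- λ_1 drops across a 1-shock but not along the forward rarefaction part. -/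
theorem forwardOne_kind_unique (h1 : p ∈ forwardOne D F G l c) (h2 : p ∈ forwardOne D F G l d) :
    c = d := by
  cases c <;> cases d
  · rfl
  · obtain ⟨-, s, -, e1, e2, -⟩ := h1
    exact absurd h2.2 (not_le.2 (e2.trans e1))
  · obtain ⟨-, s, -, e1, e2, -⟩ := h2
    exact absurd h1.2 (not_le.2 (e2.trans e1))
  · rfl

theorem backwardTwo_kind_unique (h1 : p ∈ backwardTwo D F G r c)
    (h2 : p ∈ backwardTwo D F G r d) : c = d := by
  cases c <;> cases d
  · rfl
  · obtain ⟨-, s, -, e1, e2, -⟩ := h1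
    exact absurd h2.2 (not_le.2 (e2.trans e1))
  · obtain ⟨-, s, -, e1, e2, -⟩ := h2
    exact absurd h1.2 (not_le.2 (e2.trans e1))
  · rfl

/-- The curve is parametrized by λ_k itself, so equal speeds mean equal points. -/
theorem lam_ne_of_mem_rarefactionCurve (h : p ∈ rarefactionCurve D F G k g) (hne : p ≠ g) :
    lam F G k p ≠ lam F G k g := by
  obtain ⟨-, w, w', h1, h2, -⟩ := h
  intro h3
  rw [h3, h1] at h2
  exact hne h2.symm

/-- Generic pairs of states have transverse wave curves. -/
theorem Generic.cross_conormal_ne (hreg : ∀ p ∈ U, Reg b F G p) (h1 : Generic U b F G l r)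
    (h2 : Generic U b F G r l) (hp : p ∈ fullCurve U F G 1 l c)
    (hp' : p ∈ fullCurve U F G 2 r d) :
    p ≠ l ∧ p ≠ r ∧ cross (conormal b F G 1 l p c) (conormal b F G 2 r p d) ≠ 0 := by
  have hpl : p ≠ l := by
    rintro rfl
    cases d
    · exact h2.hugoniot_ne hp'.2
    · exact h1.notMem_rarefaction 2 hp'
  have hpr : p ≠ r := by
    rintro rfl
    cases c
    · exact h1.hugoniot_ne hp.2
    · exact h2.notMem_rarefaction 1 hp
  refine ⟨hpl, hpr, ?_⟩
  cases c <;> cases d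
  · exact h1.shock_shock p hp.1 hpl hpr hp.2 hp'.2
  · have := h1.shock_rarefaction 2 p hp' hpl hp.2
    rw [fderiv_apply_eq] at this
    intro h
    apply this
    simp only [cross, conormal] at h
    linear_combination h
  · have := h2.shock_rarefaction 1 p hp hpr hp'.2
    rw [fderiv_apply_eq] at this
    intro h
    apply this
    simp only [cross, conormal] at h
    linear_combination -h
  · have := (hreg p hp.1).cross_field_field
    intro h
    apply this
    simp only [cross, conormal] at h ⊢
    linear_combination h

theorem Generic.sonic_side (hne : p ≠ r) (hp : p ∈ fullCurve U F G k r d) :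
    (p ≠ r ∧ hugoniot F G r p = 0) ∨ ∃ j : ℕ, p ∈ rarefactionCurve U F G j r := by
  cases d
  exacts [Or.inl ⟨hne, hp.2⟩, Or.inr ⟨k, hp⟩]

end Waves

/-! ### Closedness and openness of the Lax conditions -/

section Limits

variable {ι : Type*} {𝒰 : Ultrafilter ι} {K U : Set (ℝ × ℝ)} {b : Bool} {F₀ G₀ : ℝ × ℝ → ℝ}
  {F G : ι → ℝ × ℝ → ℝ} {p p' l r : ι → ℝ × ℝ} {q l₀ r₀ : ℝ × ℝ} {g : ι → ℝ × ℝ} {g₀ : ℝ × ℝ}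
  {k : ℕ} {c d : Wave}

theorem Perturb.mem_fullCurve_of_tendsto (h : Perturb 𝒰 K b F₀ G₀ F G)
    (hk : k = 1 ∨ k = 2) (hU : IsOpen U) (hKU : K ⊆ U)
    (hgK : ∀ᶠ x in 𝒰, g x ∈ K) (hg : Tendsto g 𝒰 (𝓝 g₀)) (hpq : Tendsto p 𝒰 (𝓝 q))
    (hp : ∀ᶠ x in 𝒰, p x ∈ fullCurve K (F x) (G x) k (g x) c) :
    q ∈ fullCurve U F₀ G₀ k g₀ c := by
  have hpK := hp.mono fun x hx ↦ fullCurve_subset hx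
  cases c
  · refine ⟨hKU (h.mem hpK hpq), tendsto_nhds_unique (h.tendsto_hugoniot hgK hg hpK hpq) ?_⟩
    exact tendsto_const_nhds.congr' (hp.mono fun x hx ↦ hx.2.symm)
  · exact h.mem_rarefactionCurve_of_tendsto hk hU hKU hgK hg hpq hp

theorem Perturb.secant (h : Perturb 𝒰 K b F₀ G₀ F G) (hk : k = 1 ∨ k = 2)
    (hgK : ∀ᶠ x in 𝒰, g x ∈ K) (hg : Tendsto g 𝒰 (𝓝 g₀)) (hq : q ∈ interior K)
    (hpq : Tendsto p 𝒰 (𝓝 q)) (hpq' : Tendsto p' 𝒰 (𝓝 q))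
    (hp : ∀ᶠ x in 𝒰, p x ∈ fullCurve K (F x) (G x) k (g x) c)
    (hp' : ∀ᶠ x in 𝒰, p' x ∈ fullCurve K (F x) (G x) k (g x) c) :
    Secant 𝒰 (conormal b F₀ G₀ k g₀ q c) p p' := by
  cases c
  · exact h.secant_shock hgK hg hq hpq hpq' (hp.mono fun x hx ↦ hx.2) (hp'.mono fun x hx ↦ hx.2)
  · exact h.secant_rarefaction hk hgK hg hpq hpq' hp hp'

/-- Limits of points of forward wave curves. -/
theorem Perturb.mem_forwardOne_of_tendsto (h : Perturb 𝒰 K b F₀ G₀ F G)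
    (hU : IsOpen U) (hKU : K ⊆ U) (hreg : ∀ p ∈ U, Reg b F₀ G₀ p)
    (h1 : Generic U b F₀ G₀ l₀ r₀) (h2 : Generic U b F₀ G₀ r₀ l₀)
    (hlK : ∀ᶠ x in 𝒰, l x ∈ K) (hl : Tendsto l 𝒰 (𝓝 l₀)) (hpq : Tendsto p 𝒰 (𝓝 q))
    (hp : ∀ᶠ x in 𝒰, p x ∈ forwardOne K (F x) (G x) (l x) c)
    (hq : q ∈ fullCurve U F₀ G₀ 2 r₀ d) : q ∈ forwardOne U F₀ G₀ l₀ c := by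
  have hfull := hp.mono fun x hx ↦ forwardOne_subset hx
  have hpK := hfull.mono fun x hx ↦ fullCurve_subset hx
  have hq1 := h.mem_fullCurve_of_tendsto (Or.inl rfl) hU hKU hlK hl hpq hfull
  obtain ⟨hql, hqr, -⟩ := h1.cross_conormal_ne hreg h2 hq1 hq
  have hlam := fun k ↦ h.tendsto_lam k hpK hpq
  have hlaml := fun k ↦ h.tendsto_lam k hlK hl
  cases c
  · have hs := h.tendsto_speed hlK hl hpK hpq hql
    have hlax : ∀ᶠ x in 𝒰, speed (F x) (G x) (l x) (p x) ≤ lam (F x) (G x) 1 (l x) ∧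
        lam (F x) (G x) 1 (p x) ≤ speed (F x) (G x) (l x) (p x) ∧
        speed (F x) (G x) (l x) (p x) ≤ lam (F x) (G x) 2 (p x) := by
      filter_upwards [hp] with x ⟨_, s, hs, e1, e2, e3⟩
      have hne : p x ≠ l x := by
        intro hne
        rw [hne] at e2
        exact lt_irrefl _ (e1.trans e2)
      rw [← hs.eq_speed hne]
      exact ⟨e1.le, e2.le, e3.le⟩
    -- The limit yields only weak Lax inequalities. Equality would make q sonic, which genericity
    -- forbids because q also lies on a full curve of the right state.
    have i1 := le_of_tendsto_of_tendsto hs (hlaml 1) (hlax.mono fun x hx ↦ hx.1)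
    have i2 := le_of_tendsto_of_tendsto (hlam 1) hs (hlax.mono fun x hx ↦ hx.2.1)
    have i3 := le_of_tendsto_of_tendsto hs (hlam 2) (hlax.mono fun x hx ↦ hx.2.2)
    have n1 := h1.not_sonic 1 (Or.inl rfl) q hq1.1 hql hq1.2 (Generic.sonic_side hqr hq)
    have n2 := h1.not_sonic 2 (Or.inr rfl) q hq1.1 hql hq1.2 (Generic.sonic_side hqr hq)
    exact ⟨hq1.1, _, rankineHugoniot_speed hq1.2 hql, i1.lt_of_ne n1.2, i2.lt_of_ne n1.1.symm,
      i3.lt_of_ne n2.1⟩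
  · exact ⟨hq1, le_of_tendsto_of_tendsto (hlaml 1) (hlam 1) (hp.mono fun x hx ↦ hx.2)⟩

/-- Limits of points of backward wave curves. -/
theorem Perturb.mem_backwardTwo_of_tendsto (h : Perturb 𝒰 K b F₀ G₀ F G)
    (hU : IsOpen U) (hKU : K ⊆ U) (hreg : ∀ p ∈ U, Reg b F₀ G₀ p)
    (h1 : Generic U b F₀ G₀ l₀ r₀) (h2 : Generic U b F₀ G₀ r₀ l₀)
    (hrK : ∀ᶠ x in 𝒰, r x ∈ K) (hr : Tendsto r 𝒰 (𝓝 r₀)) (hpq : Tendsto p 𝒰 (𝓝 q))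
    (hp : ∀ᶠ x in 𝒰, p x ∈ backwardTwo K (F x) (G x) (r x) c)
    (hq : q ∈ fullCurve U F₀ G₀ 1 l₀ d) : q ∈ backwardTwo U F₀ G₀ r₀ c := by
  have hfull := hp.mono fun x hx ↦ backwardTwo_subset hx
  have hpK := hfull.mono fun x hx ↦ fullCurve_subset hx
  have hq1 := h.mem_fullCurve_of_tendsto (Or.inr rfl) hU hKU hrK hr hpq hfull
  obtain ⟨hql, hqr, -⟩ := h1.cross_conormal_ne hreg h2 hq hq1
  have hlam := fun k ↦ h.tendsto_lam k hpK hpq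
  have hlamr := fun k ↦ h.tendsto_lam k hrK hr
  cases c
  · have hs := h.tendsto_speed hrK hr hpK hpq hqr
    have hlax : ∀ᶠ x in 𝒰, speed (F x) (G x) (r x) (p x) ≤ lam (F x) (G x) 2 (p x) ∧
        lam (F x) (G x) 2 (r x) ≤ speed (F x) (G x) (r x) (p x) ∧
        lam (F x) (G x) 1 (p x) ≤ speed (F x) (G x) (r x) (p x) := by
      filter_upwards [hp] with x ⟨_, s, hs, e1, e2, e3⟩
      have hne : p x ≠ r x := by
        intro hne
        rw [hne] at e1
        exact lt_irrefl _ (e1.trans e2)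
      rw [← hs.symm.eq_speed hne]
      exact ⟨e1.le, e2.le, e3.le⟩
    have i1 := le_of_tendsto_of_tendsto hs (hlam 2) (hlax.mono fun x hx ↦ hx.1)
    have i2 := le_of_tendsto_of_tendsto (hlamr 2) hs (hlax.mono fun x hx ↦ hx.2.1)
    have i3 := le_of_tendsto_of_tendsto (hlam 1) hs (hlax.mono fun x hx ↦ hx.2.2)
    have n1 := h2.not_sonic 1 (Or.inl rfl) q hq1.1 hqr hq1.2 (Generic.sonic_side hql hq)
    have n2 := h2.not_sonic 2 (Or.inr rfl) q hq1.1 hqr hq1.2 (Generic.sonic_side hql hq)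
    exact ⟨hq1.1, _, (rankineHugoniot_speed hq1.2 hqr).symm, i1.lt_of_ne n2.1,
      i2.lt_of_ne n2.2.symm, i3.lt_of_ne n1.1.symm⟩
  · exact ⟨hq1, le_of_tendsto_of_tendsto (hlam 2) (hlamr 2) (hp.mono fun x hx ↦ hx.2)⟩

/-- The strict Lax conditions are open. -/
theorem Perturb.eventually_mem_forwardOne (h : Perturb 𝒰 K b F₀ G₀ F G)
    (hlK : ∀ᶠ x in 𝒰, l x ∈ K) (hl : Tendsto l 𝒰 (𝓝 l₀)) (hpq : Tendsto p 𝒰 (𝓝 q))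
    (hp : ∀ᶠ x in 𝒰, p x ∈ fullCurve K (F x) (G x) 1 (l x) c)
    (hq : q ∈ forwardOne U F₀ G₀ l₀ c) (hne : q ≠ l₀) :
    ∀ᶠ x in 𝒰, p x ∈ forwardOne K (F x) (G x) (l x) c := by
  have hpK := hp.mono fun x hx ↦ fullCurve_subset hx
  have hlam := fun k ↦ h.tendsto_lam k hpK hpq
  have hlaml := fun k ↦ h.tendsto_lam k hlK hl
  cases c
  · have hs := h.tendsto_speed hlK hl hpK hpq hne
    obtain ⟨-, s, hRH, e1, e2, e3⟩ := hq
    rw [hRH.eq_speed hne] at e1 e2 e3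
    filter_upwards [hp, hs.eventually_lt (hlaml 1) e1, (hlam 1).eventually_lt hs e2,
      hs.eventually_lt (hlam 2) e3, (hpq.sub hl).eventually_ne (sub_ne_zero.2 hne)]
      with x hx i1 i2 i3 i4
    exact ⟨hx.1, _, rankineHugoniot_speed hx.2 (sub_ne_zero.1 i4), i1, i2, i3⟩
  · filter_upwards [hp, (hlaml 1).eventually_lt (hlam 1)
      (hq.2.lt_of_ne (lam_ne_of_mem_rarefactionCurve hq.1 hne).symm)] with x hx hx'
    exact ⟨hx, hx'.le⟩

/-- The strict Lax conditions are open. -/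
theorem Perturb.eventually_mem_backwardTwo (h : Perturb 𝒰 K b F₀ G₀ F G)
    (hrK : ∀ᶠ x in 𝒰, r x ∈ K) (hr : Tendsto r 𝒰 (𝓝 r₀)) (hpq : Tendsto p 𝒰 (𝓝 q))
    (hp : ∀ᶠ x in 𝒰, p x ∈ fullCurve K (F x) (G x) 2 (r x) c)
    (hq : q ∈ backwardTwo U F₀ G₀ r₀ c) (hne : q ≠ r₀) :
    ∀ᶠ x in 𝒰, p x ∈ backwardTwo K (F x) (G x) (r x) c := by
  have hpK := hp.mono fun x hx ↦ fullCurve_subset hx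
  have hlam := fun k ↦ h.tendsto_lam k hpK hpq
  have hlamr := fun k ↦ h.tendsto_lam k hrK hr
  cases c
  · have hs := h.tendsto_speed hrK hr hpK hpq hne
    obtain ⟨-, s, hRH, e1, e2, e3⟩ := hq
    rw [hRH.symm.eq_speed hne] at e1 e2 e3
    filter_upwards [hp, hs.eventually_lt (hlam 2) e1, (hlamr 2).eventually_lt hs e2,
      (hlam 1).eventually_lt hs e3, (hpq.sub hr).eventually_ne (sub_ne_zero.2 hne)]
      with x hx i1 i2 i3 i4
    exact ⟨hx.1, _, (rankineHugoniot_speed hx.2 (sub_ne_zero.1 i4)).symm, i1, i2, i3⟩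
  · filter_upwards [hp, (hlam 2).eventually_lt (hlamr 2)
      (hq.2.lt_of_ne (lam_ne_of_mem_rarefactionCurve hq.1 hne))] with x hx hx'
    exact ⟨hx, hx'.le⟩

end Limits

/-! ### Finiteness and transversality of the perturbed intersections -/

section Transversality

/-- An infinite subset of a compact set accumulates at some a, and strict differentiability at a
controls all pairs of points near it, even if a is on the boundary of `K`. -/
theorem exists_secant_of_infinite {E : Type*} [NormedAddCommGroup E] [NormedSpace ℝ E]
    {S K : Set E} (hK : IsCompact K) (hSK : S ⊆ K) (hS : S.Infinite) {f f' : E → ℝ}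
    (hf : ∀ a ∈ K, ContDiffAt ℝ 2 f a) (hf' : ∀ a ∈ K, ContDiffAt ℝ 2 f' a) {e : ℝ} (he : 0 < e) :
    ∃ y : E × E × E, y.1 ∈ K ∧ y.2.1 ∈ S ∧ y.2.2 ∈ S ∧ y.2.1 ≠ y.2.2 ∧
      dist y.2.1 y.1 < e ∧ dist y.2.2 y.1 < e ∧
      |f y.2.1 - f y.2.2 - fderiv ℝ f y.1 (y.2.1 - y.2.2)| ≤ e * ‖y.2.1 - y.2.2‖ ∧
      |f' y.2.1 - f' y.2.2 - fderiv ℝ f' y.1 (y.2.1 - y.2.2)| ≤ e * ‖y.2.1 - y.2.2‖ := by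
  obtain ⟨a, haK, ha⟩ := hS.exists_accPt_of_subset_isCompact hK hSK
  have key : ∀ {f : E → ℝ}, ContDiffAt ℝ 2 f a → ∀ᶠ z : E × E in 𝓝 (a, a),
      |f z.1 - f z.2 - fderiv ℝ f a (z.1 - z.2)| ≤ e * ‖z.1 - z.2‖ := fun hf ↦
    (hf.hasStrictFDerivAt two_ne_zero).isLittleO.def he
  have hev := (key (hf a haK)).and (key (hf' a haK))
  rw [nhds_prod_eq] at hev
  obtain ⟨N, hN, hN'⟩ := mem_prod_self_iff.1 hev
  have hN2 : N ∩ Metric.ball a e ∈ 𝓝 a := inter_mem hN (Metric.ball_mem_nhds a he)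
  rw [accPt_iff_nhds] at ha
  obtain ⟨p, ⟨⟨hpN, hpe⟩, hpS⟩, hpa⟩ := ha _ hN2
  obtain ⟨p', ⟨⟨⟨hpN', hpe'⟩, hpp⟩, hpS'⟩, -⟩ := ha _
    (inter_mem hN2 (isOpen_ne.mem_nhds (x := a) (Ne.symm hpa : a ≠ p)))
  have := hN' (mk_mem_prod hpN hpN')
  exact ⟨(a, p, p'), haK, hpS, hpS', Ne.symm hpp, hpe, hpe', this.1, this.2⟩

variable {ι : Type*} {𝒰 : Ultrafilter ι} {K U : Set (ℝ × ℝ)} {b : Bool} {F₀ G₀ : ℝ × ℝ → ℝ}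
  {F G : ι → ℝ × ℝ → ℝ} {l r : ι → ℝ × ℝ} {l₀ r₀ : ℝ × ℝ}

/-- Infinite intersections would contain pairs of distinct points closer than the gauge. Their
secants would be annihilated in the limit by two conormals that genericity makes independent. -/
theorem Perturb.eventually_finite (h : Perturb 𝒰 K b F₀ G₀ F G)
    (hU : IsOpen U) (hKU : K ⊆ U) (hreg : ∀ p ∈ U, Reg b F₀ G₀ p)
    (h1 : Generic U b F₀ G₀ l₀ r₀) (h2 : Generic U b F₀ G₀ r₀ l₀)
    (hlK : ∀ᶠ x in 𝒰, l x ∈ K) (hl : Tendsto l 𝒰 (𝓝 l₀))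
    (hrK : ∀ᶠ x in 𝒰, r x ∈ K) (hr : Tendsto r 𝒰 (𝓝 r₀)) (c d : Wave) :
    ∀ᶠ x in 𝒰, (fullCurve K (F x) (G x) 1 (l x) c ∩
      fullCurve K (F x) (G x) 2 (r x) d).Finite := by
  by_contra hn
  obtain ⟨e, he, he0⟩ := h.gauge
  have hex := (Ultrafilter.eventually_not.2 hn).mono fun x hx ↦ exists_secant_of_infinite
    h.isCompact (fun p hp ↦ fullCurve_subset hp.1) hx
    (f := hugoniot (F x) (G x) (l x)) (f' := hugoniot (F x) (G x) (r x))
    (fun a ha ↦ contDiffAt_hugoniot_right (h.convF.contDiffAt x a ha)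
      (h.convG.contDiffAt x a ha) _)
    (fun a ha ↦ contDiffAt_hugoniot_right (h.convF.contDiffAt x a ha)
      (h.convG.contDiffAt x a ha) _) (he x)
  obtain ⟨y, hy⟩ := hex.choice
  obtain ⟨q, hq, hyq⟩ := exists_tendsto_of_eventually_mem h.isCompact (hy.mono fun x hx ↦ hx.1)
  have hto : ∀ {z : ι → ℝ × ℝ}, (∀ᶠ x in 𝒰, dist (z x) (y x).1 < e x) → Tendsto z 𝒰 (𝓝 q) := by
    intro z hz
    refine (tendsto_iff_of_dist ?_).2 hyq
    exact squeeze_zero' (Eventually.of_forall fun x ↦ dist_nonneg) (hz.mono fun x hx ↦ hx.le) he0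
  have hp := hto (z := fun x ↦ (y x).2.1) (hy.mono fun x hx ↦ hx.2.2.2.2.1)
  have hp' := hto (z := fun x ↦ (y x).2.2) (hy.mono fun x hx ↦ hx.2.2.2.2.2.1)
  have m1 : ∀ᶠ x in 𝒰, (y x).2.1 ∈ fullCurve K (F x) (G x) 1 (l x) c :=
    hy.mono fun x hx ↦ hx.2.1.1
  have m2 : ∀ᶠ x in 𝒰, (y x).2.1 ∈ fullCurve K (F x) (G x) 2 (r x) d :=
    hy.mono fun x hx ↦ hx.2.1.2
  have m1' : ∀ᶠ x in 𝒰, (y x).2.2 ∈ fullCurve K (F x) (G x) 1 (l x) c :=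
    hy.mono fun x hx ↦ hx.2.2.1.1
  have m2' : ∀ᶠ x in 𝒰, (y x).2.2 ∈ fullCurve K (F x) (G x) 2 (r x) d :=
    hy.mono fun x hx ↦ hx.2.2.1.2
  have hc := (h1.cross_conormal_ne hreg h2
    (h.mem_fullCurve_of_tendsto (Or.inl rfl) hU hKU hlK hl hp m1)
    (h.mem_fullCurve_of_tendsto (Or.inr rfl) hU hKU hrK hr hp m2)).2.2
  have s1 : Secant 𝒰 (conormal b F₀ G₀ 1 l₀ q c) (fun x ↦ (y x).2.1) fun x ↦ (y x).2.2 := by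
    cases c
    · refine h.secant_shock_of_small he0 hlK hl (hy.mono fun x hx ↦ hx.1) hyq ?_
      filter_upwards [hy, m1, m1'] with x hx hx1 hx2
      have := hx.2.2.2.2.2.2.1
      rwa [hx1.2, hx2.2, sub_self, zero_sub, abs_neg] at this
    · exact h.secant_rarefaction (Or.inl rfl) hlK hl hp hp' m1 m1'
  have s2 : Secant 𝒰 (conormal b F₀ G₀ 2 r₀ q d) (fun x ↦ (y x).2.1) fun x ↦ (y x).2.2 := by
    cases d
    · refine h.secant_shock_of_small he0 hrK hr (hy.mono fun x hx ↦ hx.1) hyq ?_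
      filter_upwards [hy, m2, m2'] with x hx hx1 hx2
      have := hx.2.2.2.2.2.2.2
      rwa [hx1.2, hx2.2, sub_self, zero_sub, abs_neg] at this
    · exact h.secant_rarefaction (Or.inr rfl) hrK hr hp hp' m2 m2'
  obtain ⟨x, e1, e2⟩ := ((s1.eventually_eq s2 hc).and hy).exists
  exact e2.2.2.2.1 e1

/-- A family of intersection points has its limit on both unperturbed curves. The conormals are
independent there and converge along the family. -/
theorem Perturb.eventually_transverse (h : Perturb 𝒰 K b F₀ G₀ F G)
    (hU : IsOpen U) (hKU : K ⊆ U) (hreg : ∀ p ∈ U, Reg b F₀ G₀ p)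
    (h1 : Generic U b F₀ G₀ l₀ r₀) (h2 : Generic U b F₀ G₀ r₀ l₀)
    (hlK : ∀ᶠ x in 𝒰, l x ∈ K) (hl : Tendsto l 𝒰 (𝓝 l₀))
    (hrK : ∀ᶠ x in 𝒰, r x ∈ K) (hr : Tendsto r 𝒰 (𝓝 r₀)) (c d : Wave) :
    ∀ᶠ x in 𝒰, ∀ p ∈ K, p ∈ fullCurve K (F x) (G x) 1 (l x) c →
      p ∈ fullCurve K (F x) (G x) 2 (r x) d →
      Module.finrank ℝ (tangent (F x) (G x) 1 (l x) p c) = 1 ∧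
      Module.finrank ℝ (tangent (F x) (G x) 2 (r x) p d) = 1 ∧
      tangent (F x) (G x) 1 (l x) p c ⊔ tangent (F x) (G x) 2 (r x) p d = ⊤ := by
  refine eventually_forall_mem h.isCompact fun p q hp hq hpq ↦ ?_
  by_cases hin : ∀ᶠ x in 𝒰, p x ∈ fullCurve K (F x) (G x) 1 (l x) c ∧
      p x ∈ fullCurve K (F x) (G x) 2 (r x) d
  · have hc := (h1.cross_conormal_ne hreg h2
      (h.mem_fullCurve_of_tendsto (Or.inl rfl) hU hKU hlK hl hpq (hin.mono fun x hx ↦ hx.1))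
      (h.mem_fullCurve_of_tendsto (Or.inr rfl) hU hKU hrK hr hpq (hin.mono fun x hx ↦ hx.2))).2.2
    have t1 := h.tendsto_conormal 1 hlK hl hp hpq c
    have t2 := h.tendsto_conormal 2 hrK hr hp hpq d
    have t3 := (t1.fst_nhds.mul t2.snd_nhds).sub (t1.snd_nhds.mul t2.fst_nhds)
    filter_upwards [t3.eventually_ne hc, h.eventually_reg, hp] with x hx hr hpx _ _
    exact (hr _ hpx).transverse hx
  · filter_upwards [Ultrafilter.eventually_not.2 hin] with x hx i1 i2
    exact absurd ⟨i1, i2⟩ hx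

end Transversality

theorem exists_equiv_of_ker_eq_bot {V : Type*} [NormedAddCommGroup V] [NormedSpace ℝ V]
    [FiniteDimensional ℝ V] {L : V →L[ℝ] V} (hL : ∀ v, L v = 0 → v = 0) :
    ∃ A : V ≃L[ℝ] V, (A : V →L[ℝ] V) = L := by
  have hinj : Function.Injective L.toLinearMap := (injective_iff_map_eq_zero _).2 hL
  refine ⟨(LinearEquiv.ofInjectiveEndo L.toLinearMap hinj).toContinuousLinearEquiv, ?_⟩
  ext v
  rfl

theorem tendsto_smulRight {ι V W : Type*} [NormedAddCommGroup V] [NormedSpace ℝ V]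
    [NormedAddCommGroup W] [NormedSpace ℝ W] {u : Filter ι} (φ : V →L[ℝ] ℝ) {X : ι → W} {X₀ : W}
    (hX : Tendsto X u (𝓝 X₀)) :
    Tendsto (fun x ↦ φ.smulRight (X x)) u (𝓝 (φ.smulRight X₀)) :=
  ((ContinuousLinearMap.smulRightL ℝ V W φ).continuous.tendsto X₀).comp hX

/-! ### Persistence of transverse intersections -/

section Existence

variable {ι : Type*} {𝒰 : Ultrafilter ι} {K U : Set (ℝ × ℝ)} {b : Bool} {F₀ G₀ : ℝ × ℝ → ℝ}
  {F G : ι → ℝ × ℝ → ℝ} {l r g g' : ι → ℝ × ℝ} {m l₀ r₀ g₀ g₀' : ℝ × ℝ} {k : ℕ}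

theorem Perturb.exists_shock_shock (h : Perturb 𝒰 K b F₀ G₀ F G)
    (hgK : ∀ᶠ x in 𝒰, g x ∈ K) (hg : Tendsto g 𝒰 (𝓝 g₀))
    (hgK' : ∀ᶠ x in 𝒰, g' x ∈ K) (hg' : Tendsto g' 𝒰 (𝓝 g₀')) (hmK : m ∈ interior K)
    (hm : hugoniot F₀ G₀ g₀ m = 0) (hm' : hugoniot F₀ G₀ g₀' m = 0)
    (hc : cross (du (hugoniot F₀ G₀ g₀) m, dv (hugoniot F₀ G₀ g₀) m)
      (du (hugoniot F₀ G₀ g₀') m, dv (hugoniot F₀ G₀ g₀') m) ≠ 0) :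
    ∃ p : ι → ℝ × ℝ, Tendsto p 𝒰 (𝓝 m) ∧ ∀ᶠ x in 𝒰,
      hugoniot (F x) (G x) (g x) (p x) = 0 ∧ hugoniot (F x) (G x) (g' x) (p x) = 0 := by
  have hK : ∀ z : ι → ℝ × ℝ, Tendsto z 𝒰 (𝓝 m) → ∀ᶠ x in 𝒰, z x ∈ K := fun z hz ↦
    hz.eventually (mem_interior_iff_mem_nhds.1 hmK)
  obtain ⟨A, hA⟩ := exists_equiv_of_ker_eq_bot (L := (fderiv ℝ (hugoniot F₀ G₀ g₀) m).prod
    (fderiv ℝ (hugoniot F₀ G₀ g₀') m)) fun v hv ↦ by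
      have e1 := congrArg Prod.fst hv
      have e2 := congrArg Prod.snd hv
      simp only [ContinuousLinearMap.prod_apply, fderiv_apply_eq, Prod.fst_zero,
        Prod.snd_zero] at e1 e2
      simp only [cross] at hc
      refine Prod.ext ?_ ?_
      · refine (mul_eq_zero.1 (?_ : _ * v.1 = 0)).resolve_left hc
        linear_combination (dv (hugoniot F₀ G₀ g₀') m) * e1 - (dv (hugoniot F₀ G₀ g₀) m) * e2
      · refine (mul_eq_zero.1 (?_ : _ * v.2 = 0)).resolve_left hc
        linear_combination (du (hugoniot F₀ G₀ g₀) m) * e2 - (du (hugoniot F₀ G₀ g₀') m) * e1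
  obtain ⟨p, hp, hp'⟩ := exists_tendsto_zero h.gauge (z₀ := m) A
    (Φ := fun x z ↦ (hugoniot (F x) (G x) (g x) z, hugoniot (F x) (G x) (g' x) z))
    (Φ' := fun x z ↦ (fderiv ℝ (hugoniot (F x) (G x) (g x)) z).prod
      (fderiv ℝ (hugoniot (F x) (G x) (g' x)) z))
    (fun z hz ↦ by
      filter_upwards [hK z hz] with x hx
      have hd := fun g ↦ ((contDiffAt_hugoniot_right (h.convF.contDiffAt x _ hx)
        (h.convG.contDiffAt x _ hx) g).differentiableAt two_ne_zero).hasFDerivAt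
      exact (hd (g x)).prodMk (hd (g' x)))
    (fun z hz ↦ by
      rw [hA]
      exact ((ContinuousLinearMap.prodₗᵢ (𝕜 := ℝ) (E := ℝ × ℝ) (F := ℝ) (G := ℝ)
        ℝ).continuous.tendsto _).comp ((h.tendsto_fderiv_hugoniot hgK hg (hK z hz) hz).prodMk_nhds
          (h.tendsto_fderiv_hugoniot hgK' hg' (hK z hz) hz)))
    (by
      have hcst := tendsto_const_nhds (x := m) (f := (𝒰 : Filter ι))
      have := (h.tendsto_hugoniot hgK hg (hK _ hcst) hcst).prodMk_nhds
        (h.tendsto_hugoniot hgK' hg' (hK _ hcst) hcst)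
      rwa [hm, hm'] at this)
  exact ⟨p, hp, hp'.mono fun x hx ↦ Prod.mk_eq_zero.1 hx⟩

/-- The unknown is the flow time along the perturbed rarefaction branch, which leaves one scalar
equation with nonzero derivative. -/
theorem Perturb.exists_rarefaction_shock (h : Perturb 𝒰 K b F₀ G₀ F G) (hk : k = 1 ∨ k = 2)
    (hg : Tendsto g 𝒰 (𝓝 g₀))
    (hgK' : ∀ᶠ x in 𝒰, g' x ∈ K) (hg' : Tendsto g' 𝒰 (𝓝 g₀')) (hmK : m ∈ interior K)
    (hm : m ∈ rarefactionCurve K F₀ G₀ k g₀) (hm' : hugoniot F₀ G₀ g₀' m = 0)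
    (hc : fderiv ℝ (hugoniot F₀ G₀ g₀') m (field b F₀ G₀ k m) ≠ 0) :
    ∃ p : ι → ℝ × ℝ, Tendsto p 𝒰 (𝓝 m) ∧ ∀ᶠ x in 𝒰,
      p x ∈ rarefactionCurve K (F x) (G x) k (g x) ∧ hugoniot (F x) (G x) (g' x) (p x) = 0 := by
  obtain ⟨γ, T₀, hγ⟩ := h.exists_branch hk hg hm hmK
  have hK : ∀ z : ι → ℝ, Tendsto z 𝒰 (𝓝 T₀) → ∀ᶠ x in 𝒰, γ x (z x) ∈ K := fun z hz ↦
    (hγ z hz).1.eventually (mem_interior_iff_mem_nhds.1 hmK)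
  obtain ⟨A, hA⟩ := exists_equiv_of_ker_eq_bot
    (L := (1 : ℝ →L[ℝ] ℝ).smulRight (fderiv ℝ (hugoniot F₀ G₀ g₀') m (field b F₀ G₀ k m)))
    fun v hv ↦ by
      have : v * fderiv ℝ (hugoniot F₀ G₀ g₀') m (field b F₀ G₀ k m) = 0 := hv
      exact (mul_eq_zero.1 this).resolve_right hc
  obtain ⟨t, ht, ht'⟩ := exists_tendsto_zero h.gauge (z₀ := T₀) A
    (Φ := fun x t ↦ hugoniot (F x) (G x) (g' x) (γ x t))
    (Φ' := fun x t ↦ (1 : ℝ →L[ℝ] ℝ).smulRight (fderiv ℝ (hugoniot (F x) (G x) (g' x)) (γ x t)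
      (field b (F x) (G x) k (γ x t))))
    (fun z hz ↦ by
      filter_upwards [hK z hz, (hγ z hz).2] with x hx hx'
      have hd := ((contDiffAt_hugoniot_right (h.convF.contDiffAt x _ hx)
        (h.convG.contDiffAt x _ hx) (g' x)).differentiableAt two_ne_zero).hasFDerivAt
      refine (hd.comp_hasDerivAt (z x) hx'.2).hasFDerivAt.congr_fderiv ?_
      ext
      simp)
    (fun z hz ↦ by
      rw [hA]
      exact tendsto_smulRight _ (tendsto_clm_apply
        (h.tendsto_fderiv_hugoniot hgK' hg' (hK z hz) (hγ z hz).1)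
        (h.tendsto_field k (hK z hz) (hγ z hz).1)))
    (by
      have hcst := tendsto_const_nhds (x := T₀) (f := (𝒰 : Filter ι))
      have := h.tendsto_hugoniot hgK' hg' (hK _ hcst) (hγ _ hcst).1
      rwa [hm'] at this)
  exact ⟨fun x ↦ γ x (t x), (hγ t ht).1, ((hγ t ht).2.and ht').mono fun x hx ↦ ⟨hx.1.1, hx.2⟩⟩

/-- The unknowns are the two flow times. The differential has the columns r₁ and -r₂, which are
independent by strict hyperbolicity. -/
theorem Perturb.exists_rarefaction_rarefaction (h : Perturb 𝒰 K b F₀ G₀ F G)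
    (hg : Tendsto g 𝒰 (𝓝 g₀)) (hg' : Tendsto g' 𝒰 (𝓝 g₀')) (hmK : m ∈ interior K)
    (hm : m ∈ rarefactionCurve K F₀ G₀ 1 g₀) (hm' : m ∈ rarefactionCurve K F₀ G₀ 2 g₀') :
    ∃ p : ι → ℝ × ℝ, Tendsto p 𝒰 (𝓝 m) ∧ ∀ᶠ x in 𝒰,
      p x ∈ rarefactionCurve K (F x) (G x) 1 (g x) ∧
      p x ∈ rarefactionCurve K (F x) (G x) 2 (g' x) := by
  obtain ⟨γ, T₀, hγ⟩ := h.exists_branch (Or.inl rfl) hg hm hmK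
  obtain ⟨β, S₀, hβ⟩ := h.exists_branch (Or.inr rfl) hg' hm' hmK
  have hKγ : ∀ z : ι → ℝ, Tendsto z 𝒰 (𝓝 T₀) → ∀ᶠ x in 𝒰, γ x (z x) ∈ K := fun z hz ↦
    (hγ z hz).1.eventually (mem_interior_iff_mem_nhds.1 hmK)
  have hKβ : ∀ z : ι → ℝ, Tendsto z 𝒰 (𝓝 S₀) → ∀ᶠ x in 𝒰, β x (z x) ∈ K := fun z hz ↦
    (hβ z hz).1.eventually (mem_interior_iff_mem_nhds.1 hmK)
  have hc := (h.reg m (interior_subset hmK)).cross_field_field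
  set φ₁ := ContinuousLinearMap.fst ℝ ℝ ℝ with hφ₁
  set φ₂ := ContinuousLinearMap.snd ℝ ℝ ℝ with hφ₂
  obtain ⟨A, hA⟩ := exists_equiv_of_ker_eq_bot
    (L := φ₁.smulRight (field b F₀ G₀ 1 m) - φ₂.smulRight (field b F₀ G₀ 2 m)) fun v hv ↦ by
      have e1 : v.1 * (field b F₀ G₀ 1 m).1 - v.2 * (field b F₀ G₀ 2 m).1 = 0 :=
        congrArg Prod.fst hv
      have e2 : v.1 * (field b F₀ G₀ 1 m).2 - v.2 * (field b F₀ G₀ 2 m).2 = 0 :=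
        congrArg Prod.snd hv
      simp only [cross] at hc
      refine Prod.ext ?_ ?_
      · refine (mul_eq_zero.1 (?_ : _ * v.1 = 0)).resolve_left hc
        linear_combination (field b F₀ G₀ 2 m).2 * e1 - (field b F₀ G₀ 2 m).1 * e2
      · refine (mul_eq_zero.1 (?_ : _ * v.2 = 0)).resolve_left hc
        linear_combination (field b F₀ G₀ 1 m).2 * e1 - (field b F₀ G₀ 1 m).1 * e2
  obtain ⟨z, hz, hz'⟩ := exists_tendsto_zero h.gauge (z₀ := (T₀, S₀)) A
    (Φ := fun x z ↦ γ x z.1 - β x z.2)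
    (Φ' := fun x z ↦ φ₁.smulRight (field b (F x) (G x) 1 (γ x z.1)) -
      φ₂.smulRight (field b (F x) (G x) 2 (β x z.2)))
    (fun z hz ↦ by
      filter_upwards [(hγ _ hz.fst_nhds).2, (hβ _ hz.snd_nhds).2] with x hx hx'
      have d1 := hx.2.hasFDerivAt.comp (z x) (hasFDerivAt_fst (𝕜 := ℝ) (E := ℝ) (F := ℝ))
      have d2 := hx'.2.hasFDerivAt.comp (z x) (hasFDerivAt_snd (𝕜 := ℝ) (E := ℝ) (F := ℝ))
      refine (d1.sub d2).congr_fderiv ?_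
      ext <;> simp [hφ₁, hφ₂])
    (fun z hz ↦ by
      rw [hA]
      exact (tendsto_smulRight _ (h.tendsto_field 1 (hKγ _ hz.fst_nhds)
        (hγ _ hz.fst_nhds).1)).sub (tendsto_smulRight _ (h.tendsto_field 2 (hKβ _ hz.snd_nhds)
        (hβ _ hz.snd_nhds).1)))
    (by
      have := (hγ _ tendsto_const_nhds).1.sub (hβ _ tendsto_const_nhds).1
      rwa [sub_self] at this)
  refine ⟨fun x ↦ γ x (z x).1, (hγ _ hz.fst_nhds).1, ?_⟩
  filter_upwards [(hγ _ hz.fst_nhds).2, (hβ _ hz.snd_nhds).2, hz'] with x h1 h2 h3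
  refine ⟨h1.1, ?_⟩
  rw [sub_eq_zero.1 h3]
  exact h2.1

/-- Transverse intersections of wave curves persist. -/
theorem Perturb.exists_intersection (h : Perturb 𝒰 K b F₀ G₀ F G)
    (hlK : ∀ᶠ x in 𝒰, l x ∈ K) (hl : Tendsto l 𝒰 (𝓝 l₀))
    (hrK : ∀ᶠ x in 𝒰, r x ∈ K) (hr : Tendsto r 𝒰 (𝓝 r₀)) (hmK : m ∈ interior K) {c d : Wave}
    (hm : m ∈ fullCurve K F₀ G₀ 1 l₀ c) (hm' : m ∈ fullCurve K F₀ G₀ 2 r₀ d)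
    (hc : cross (conormal b F₀ G₀ 1 l₀ m c) (conormal b F₀ G₀ 2 r₀ m d) ≠ 0) :
    ∃ p : ι → ℝ × ℝ, Tendsto p 𝒰 (𝓝 m) ∧ ∀ᶠ x in 𝒰,
      p x ∈ fullCurve K (F x) (G x) 1 (l x) c ∧ p x ∈ fullCurve K (F x) (G x) 2 (r x) d := by
  have hK : ∀ {z : ι → ℝ × ℝ}, Tendsto z 𝒰 (𝓝 m) → ∀ᶠ x in 𝒰, z x ∈ K := fun hz ↦
    hz.eventually (mem_interior_iff_mem_nhds.1 hmK)
  cases c <;> cases d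
  · obtain ⟨p, hp, hp'⟩ := h.exists_shock_shock hlK hl hrK hr hmK hm.2 hm'.2 hc
    exact ⟨p, hp, (hp'.and (hK hp)).mono fun x hx ↦ ⟨⟨hx.2, hx.1.1⟩, hx.2, hx.1.2⟩⟩
  · obtain ⟨p, hp, hp'⟩ := h.exists_rarefaction_shock (Or.inr rfl) hr hlK hl hmK hm' hm.2
      fun h0 ↦ hc (by
        rw [fderiv_apply_eq] at h0
        simp only [cross, conormal]
        linear_combination h0)
    exact ⟨p, hp, (hp'.and (hK hp)).mono fun x hx ↦ ⟨⟨hx.2, hx.1.2⟩, hx.1.1⟩⟩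
  · obtain ⟨p, hp, hp'⟩ := h.exists_rarefaction_shock (Or.inl rfl) hl hrK hr hmK hm hm'.2
      fun h0 ↦ hc (by
        rw [fderiv_apply_eq] at h0
        simp only [cross, conormal]
        linear_combination -h0)
    exact ⟨p, hp, (hp'.and (hK hp)).mono fun x hx ↦ ⟨hx.1.1, hx.2, hx.1.2⟩⟩
  · exact h.exists_rarefaction_rarefaction hl hr hmK hm hm'

end Existence

/-! ### Stability of the unique double-wave solution -/

section Stability

variable {ι : Type*} {𝒰 : Ultrafilter ι} {K U : Set (ℝ × ℝ)} {b : Bool} {F₀ G₀ : ℝ × ℝ → ℝ}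
  {F G : ι → ℝ × ℝ → ℝ} {l r : ι → ℝ × ℝ} {m l₀ r₀ : ℝ × ℝ}

/-- There are two kinds of waves, and an ultrafilter decides between them. -/
theorem eventually_exists_wave {P : Wave → ι → Prop} (h : ∀ᶠ x in 𝒰, ∃ c, P c x) :
    ∃ c, ∀ᶠ x in 𝒰, P c x := by
  have : ∀ᶠ x in 𝒰, P Wave.shock x ∨ P Wave.rarefaction x := by
    filter_upwards [h] with x ⟨c, hc⟩
    cases c
    exacts [Or.inl hc, Or.inr hc]
  rcases Ultrafilter.eventually_or.1 this with h | h
  exacts [⟨_, h⟩, ⟨_, h⟩]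

theorem Perturb.eventually_transverseOn (h : Perturb 𝒰 K b F₀ G₀ F G)
    (hU : IsOpen U) (hKU : K ⊆ U) (hreg : ∀ p ∈ U, Reg b F₀ G₀ p)
    (h1 : Generic U b F₀ G₀ l₀ r₀) (h2 : Generic U b F₀ G₀ r₀ l₀)
    (hlK : ∀ᶠ x in 𝒰, l x ∈ K) (hl : Tendsto l 𝒰 (𝓝 l₀))
    (hrK : ∀ᶠ x in 𝒰, r x ∈ K) (hr : Tendsto r 𝒰 (𝓝 r₀)) :
    ∀ᶠ x in 𝒰, TransverseOn K (F x) (G x) (l x) (r x) := by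
  have key : ∀ c d, ∀ᶠ x in 𝒰,
      ((fullCurve K (F x) (G x) 1 (l x) c ∩ fullCurve K (F x) (G x) 2 (r x) d) \
        {l x, r x}).Finite ∧
      ∀ p ∈ (fullCurve K (F x) (G x) 1 (l x) c ∩ fullCurve K (F x) (G x) 2 (r x) d) \ {l x, r x},
        Module.finrank ℝ (tangent (F x) (G x) 1 (l x) p c) = 1 ∧
        Module.finrank ℝ (tangent (F x) (G x) 2 (r x) p d) = 1 ∧
        tangent (F x) (G x) 1 (l x) p c ⊔ tangent (F x) (G x) 2 (r x) p d = ⊤ := by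
    intro c d
    filter_upwards [h.eventually_finite hU hKU hreg h1 h2 hlK hl hrK hr c d,
      h.eventually_transverse hU hKU hreg h1 h2 hlK hl hrK hr c d] with x hx hx'
    exact ⟨hx.subset sdiff_subset, fun p hp ↦ hx' p (fullCurve_subset hp.1.1) hp.1.1 hp.1.2⟩
  filter_upwards [key .shock .shock, key .shock .rarefaction, key .rarefaction .shock,
    key .rarefaction .rarefaction] with x k1 k2 k3 k4 c d
  cases c <;> cases d
  exacts [k1, k2, k3, k4]

/-- Unique double-wave solutions persist under perturbations of generic Riemann problems. -/
theorem Perturb.exists_isUniqueDoubleWave (h : Perturb 𝒰 K b F₀ G₀ F G)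
    (hU : IsOpen U) (hKU : K ⊆ U) (hreg : ∀ p ∈ U, Reg b F₀ G₀ p)
    (h1 : Generic U b F₀ G₀ l₀ r₀) (h2 : Generic U b F₀ G₀ r₀ l₀)
    (hlK : ∀ᶠ x in 𝒰, l x ∈ K) (hl : Tendsto l 𝒰 (𝓝 l₀))
    (hrK : ∀ᶠ x in 𝒰, r x ∈ K) (hr : Tendsto r 𝒰 (𝓝 r₀)) (hmK : m ∈ interior K) {c d : Wave}
    (huniq : IsUniqueDoubleWave U F₀ G₀ l₀ r₀ c d m) (hdw : IsDoubleWave K F₀ G₀ l₀ r₀ c d m) :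
    ∃ p : ι → ℝ × ℝ, Tendsto p 𝒰 (𝓝 m) ∧
      ∀ᶠ x in 𝒰, IsUniqueDoubleWave K (F x) (G x) (l x) (r x) c d (p x) := by
  obtain ⟨⟨hmf, hmb, hml, hmr⟩, hinter⟩ := huniq
  have hc := (h1.cross_conormal_ne hreg h2 (forwardOne_subset hmf) (backwardTwo_subset hmb)).2.2
  -- Existence uses the wave inside `K`, where the perturbations are controlled; uniqueness below
  -- uses that no other solution exists in `U`.
  obtain ⟨p, hp, hp'⟩ := h.exists_intersection hlK hl hrK hr hmK (forwardOne_subset hdw.1)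
    (backwardTwo_subset hdw.2.1) hc
  have pf := h.eventually_mem_forwardOne hlK hl hp (hp'.mono fun x hx ↦ hx.1) hmf hml
  have pb := h.eventually_mem_backwardTwo hrK hr hp (hp'.mono fun x hx ↦ hx.2) hmb hmr
  -- A second family of solutions has a limit on both unperturbed wave curves, which is m, with the
  -- same kinds of waves. Both families then lie on the same two perturbed curves, and the secant
  -- argument identifies them.
  have huni : ∀ᶠ x in 𝒰, ∀ z, z ∈ (⋃ c, forwardOne K (F x) (G x) (l x) c) ∩
      (⋃ c, backwardTwo K (F x) (G x) (r x) c) → z = p x := by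
    by_contra hn
    have hn' := Ultrafilter.eventually_not.2 hn
    push Not at hn'
    obtain ⟨z, hz⟩ := hn'.choice
    obtain ⟨c', zf⟩ := eventually_exists_wave (hz.mono fun x hx ↦ mem_iUnion.1 hx.1.1)
    obtain ⟨d', zb⟩ := eventually_exists_wave (hz.mono fun x hx ↦ mem_iUnion.1 hx.1.2)
    have zf' := zf.mono fun x hx ↦ forwardOne_subset hx
    have zb' := zb.mono fun x hx ↦ backwardTwo_subset hx
    obtain ⟨q, hq, hzq⟩ := exists_tendsto_of_eventually_mem h.isCompact
      (zf'.mono fun x hx ↦ fullCurve_subset hx)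
    have q1 := h.mem_fullCurve_of_tendsto (Or.inl rfl) hU hKU hlK hl hzq zf'
    have q2 := h.mem_fullCurve_of_tendsto (Or.inr rfl) hU hKU hrK hr hzq zb'
    have qf := h.mem_forwardOne_of_tendsto hU hKU hreg h1 h2 hlK hl hzq zf q2
    have qb := h.mem_backwardTwo_of_tendsto hU hKU hreg h1 h2 hrK hr hzq zb q1
    have hqm : q = m := by
      have : q ∈ ({m} : Set (ℝ × ℝ)) := hinter ▸ ⟨mem_iUnion.2 ⟨c', qf⟩, mem_iUnion.2 ⟨d', qb⟩⟩
      exact this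
    subst hqm
    obtain rfl := forwardOne_kind_unique qf hmf
    obtain rfl := backwardTwo_kind_unique qb hmb
    have s1 := h.secant (Or.inl rfl) hlK hl hmK hzq hp zf' (hp'.mono fun x hx ↦ hx.1)
    have s2 := h.secant (Or.inr rfl) hrK hr hmK hzq hp zb' (hp'.mono fun x hx ↦ hx.2)
    obtain ⟨x, e1, e2⟩ := ((s1.eventually_eq s2 hc).and hz).exists
    exact e2.2 e1
  refine ⟨p, hp, ?_⟩
  filter_upwards [pf, pb, huni, (hp.sub hl).eventually_ne (sub_ne_zero.2 hml),
    (hp.sub hr).eventually_ne (sub_ne_zero.2 hmr)] with x e1 e2 e3 e4 e5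
  refine ⟨⟨e1, e2, sub_ne_zero.1 e4, sub_ne_zero.1 e5⟩, ?_⟩
  refine Subset.antisymm e3 ?_
  rintro _ rfl
  exact ⟨mem_iUnion.2 ⟨c, e1⟩, mem_iUnion.2 ⟨d, e2⟩⟩

end Stability

/-! ### From the C²(K) norm to convergence of fluxes -/

theorem norm_iteratedFDeriv_le_c2Norm {K : Set (ℝ × ℝ)} (hK : IsCompact K) {f : ℝ × ℝ → ℝ}
    (hf : ∀ p ∈ K, ContDiffAt ℝ 2 f p) {i : ℕ} (hi : i < 3) {p : ℝ × ℝ} (hp : p ∈ K) :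
    ‖iteratedFDeriv ℝ i f p‖ ≤ c2Norm K f := by
  -- A real supremum over an unbounded family has the default value 0, so the norm dominates the
  -- derivatives only after boundedness is known.
  have hbdd : BddAbove (range fun p : K ↦ ‖iteratedFDeriv ℝ i f (p : ℝ × ℝ)‖) := by
    have h1 : ContinuousOn (fun p ↦ ‖iteratedFDeriv ℝ i f p‖) K := fun p hp ↦
      ((hf p hp).continuousAt_iteratedFDeriv (k := i)
        (by exact_mod_cast Nat.lt_succ_iff.1 hi)).norm.continuousWithinAt
    have h2 := hK.bddAbove_image h1
    rwa [image_eq_range] at h2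
  have h1 : ‖iteratedFDeriv ℝ i f p‖ ≤ ⨆ p : K, ‖iteratedFDeriv ℝ i f (p : ℝ × ℝ)‖ :=
    le_ciSup hbdd ⟨p, hp⟩
  exact h1.trans (Finset.single_le_sum
    (f := fun i ↦ ⨆ p : K, ‖iteratedFDeriv ℝ i f (p : ℝ × ℝ)‖)
    (fun i _ ↦ Real.iSup_nonneg fun _ ↦ norm_nonneg _) (Finset.mem_range.2 hi))

theorem c2Norm_nonneg (K : Set (ℝ × ℝ)) (f : ℝ × ℝ → ℝ) : 0 ≤ c2Norm K f :=
  Finset.sum_nonneg fun _ _ ↦ Real.iSup_nonneg fun _ ↦ norm_nonneg _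

/-- Small perturbations in `C²(K)` converge. -/
theorem fluxConv_add {ι : Type*} {𝒰 : Ultrafilter ι} {K : Set (ℝ × ℝ)} (hK : IsCompact K)
    {f₀ : ℝ × ℝ → ℝ} (hf₀ : ∀ p ∈ K, ContDiffAt ℝ 2 f₀ p) {fδ : ι → ℝ × ℝ → ℝ}
    (hfδ : ∀ x, ∀ p ∈ K, ContDiffAt ℝ 2 (fδ x) p)
    (hlim : Tendsto (fun x ↦ c2Norm K (fδ x)) 𝒰 (𝓝 0)) :
    FluxConv 𝒰 K (fun x ↦ f₀ + fδ x) f₀ := by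
  have hadd : ∀ {V : Type} [NormedAddCommGroup V] {φ : ι → V} {v : V} (ψ : ι → V),
      Tendsto φ 𝒰 (𝓝 v) → (∀ᶠ x in 𝒰, ‖ψ x‖ ≤ c2Norm K (fδ x)) →
      Tendsto (fun x ↦ φ x + ψ x) 𝒰 (𝓝 v) := fun ψ hφ hψ ↦ by
    have := hφ.add (squeeze_zero_norm' hψ hlim)
    rwa [add_zero] at this
  refine ⟨fun x p hp ↦ (hf₀ p hp).add (hfδ x p hp), fun p q hp hpq ↦ ?_, fun p q hp hpq ↦ ?_,
    fun p q hp hpq ↦ ?_⟩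
  all_goals have hq := hf₀ q (hK.isClosed.mem_of_tendsto hpq hp)
  · have h1 : Tendsto (fun x ↦ f₀ (p x)) 𝒰 (𝓝 (f₀ q)) := hq.continuousAt.tendsto.comp hpq
    have h2 := hadd (fun x ↦ fδ x (p x)) h1 (hp.mono fun x hx ↦ by
      rw [← norm_iteratedFDeriv_zero (𝕜 := ℝ)]
      exact norm_iteratedFDeriv_le_c2Norm hK (hfδ x) (by norm_num) hx)
    exact h2
  · have h1 : Tendsto (fun x ↦ fderiv ℝ f₀ (p x)) 𝒰 (𝓝 (fderiv ℝ f₀ q)) :=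
      ((hq.fderiv_right (m := 1) (by norm_num)).continuousAt.tendsto).comp hpq
    have h2 := hadd (fun x ↦ fderiv ℝ (fδ x) (p x)) h1 (hp.mono fun x hx ↦ by
      rw [← norm_iteratedFDeriv_one]
      exact norm_iteratedFDeriv_le_c2Norm hK (hfδ x) (by norm_num) hx)
    refine h2.congr' (hp.mono fun x hx ↦ ?_)
    exact (fderiv_add ((hf₀ _ hx).differentiableAt two_ne_zero)
      ((hfδ x _ hx).differentiableAt two_ne_zero)).symm
  · have h1 : Tendsto (fun x ↦ fderiv ℝ (fderiv ℝ f₀) (p x)) 𝒰 (𝓝 (fderiv ℝ (fderiv ℝ f₀) q)) :=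
      (((hq.fderiv_right (m := 1) (by norm_num)).fderiv_right (m := 0)
        (by norm_num)).continuousAt.tendsto).comp hpq
    have h2 := hadd (fun x ↦ fderiv ℝ (fderiv ℝ (fδ x)) (p x)) h1 (hp.mono fun x hx ↦ by
      rw [← norm_iteratedFDeriv_one, norm_iteratedFDeriv_fderiv]
      exact norm_iteratedFDeriv_le_c2Norm hK (hfδ x) (by norm_num) hx)
    refine h2.congr' (hp.mono fun x hx ↦ ?_)
    have e1 := hf₀ _ hx
    have e2 := hfδ x _ hx
    have hev : fderiv ℝ (f₀ + fδ x) =ᶠ[𝓝 (p x)] fderiv ℝ f₀ + fderiv ℝ (fδ x) := by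
      filter_upwards [e1.eventually (by simp), e2.eventually (by simp)] with y y1 y2
      exact fderiv_add (y1.differentiableAt two_ne_zero) (y2.differentiableAt two_ne_zero)
    refine Eq.trans ?_ hev.fderiv_eq.symm
    exact (fderiv_add
      ((e1.fderiv_right (m := 1) (by norm_num)).differentiableAt one_ne_zero)
      ((e2.fderiv_right (m := 1) (by norm_num)).differentiableAt one_ne_zero)).symm

end Riemann

end

theorem theorem3p5 (U : Set (ℝ × ℝ)) (hU : IsOpen U) (F G : ℝ × ℝ → ℝ)
    (hF : ContDiffOn ℝ 2 F U) (hG : ContDiffOn ℝ 2 G U)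
    (hyp : StrictlyHyperbolic U F G) (gnl : GenuinelyNonlinear U F G)
    (graph : GraphCondition U F G) (reg : RegularManifold U F G) :
    ∀ᵐ q : (ℝ × ℝ) × (ℝ × ℝ) ∂(volume.restrict (U ×ˢ U)),
      ∀ (a b : Wave) (m : ℝ × ℝ), IsUniqueDoubleWave U F G q.1 q.2 a b m →
      ∀ K : Set (ℝ × ℝ), IsCompact K → K ⊆ U →
        q.1 ∈ interior K → q.2 ∈ interior K → m ∈ interior K →
        IsDoubleWave K F G q.1 q.2 a b m →
      ∀ ε₂ > 0, ∃ ε₁ > 0, ∀ (Fδ Gδ : ℝ × ℝ → ℝ) (δl δr : ℝ × ℝ),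
        (∀ p ∈ K, ContDiffAt ℝ 2 Fδ p) → (∀ p ∈ K, ContDiffAt ℝ 2 Gδ p) →
        c2Norm K Fδ + c2Norm K Gδ + |δl.1| + |δl.2| + |δr.1| + |δr.2| < ε₁ →
        TransverseOn K (F + Fδ) (G + Gδ) (q.1 + δl) (q.2 + δr) ∧
        ∃ m' ∈ interior K,
          IsUniqueDoubleWave K (F + Fδ) (G + Gδ) (q.1 + δl) (q.2 + δr) a b m' ∧
          √((m'.1 - m.1) ^ 2 + (m'.2 - m.2) ^ 2) < ε₂ := by
  obtain ⟨b₀, hreg⟩ := exists_forall_reg hU hF hG hyp gnl graph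
  filter_upwards [ae_restrict_generic hU hreg reg] with q hq a b m huniq K hK hKU hl hr hm hdw ε₂ hε₂
  obtain ⟨-, -, hgen, hgen'⟩ := hq
  -- If no ε₁ works, there is for each n a failing perturbation of size less than 1 / (n + 1).
  by_contra hn
  have hbad : ∀ n : ℕ, ∃ (Fδ Gδ : ℝ × ℝ → ℝ) (δl δr : ℝ × ℝ),
      (∀ p ∈ K, ContDiffAt ℝ 2 Fδ p) ∧ (∀ p ∈ K, ContDiffAt ℝ 2 Gδ p) ∧
      c2Norm K Fδ + c2Norm K Gδ + |δl.1| + |δl.2| + |δr.1| + |δr.2| < 1 / ((n : ℝ) + 1) ∧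
      ¬ (TransverseOn K (F + Fδ) (G + Gδ) (q.1 + δl) (q.2 + δr) ∧
        ∃ m' ∈ interior K,
          IsUniqueDoubleWave K (F + Fδ) (G + Gδ) (q.1 + δl) (q.2 + δr) a b m' ∧
          √((m'.1 - m.1) ^ 2 + (m'.2 - m.2) ^ 2) < ε₂) := by
    intro n
    by_contra hcon
    exact hn ⟨1 / ((n : ℝ) + 1), by positivity, fun Fδ Gδ δl δr h1 h2 h3 ↦
      by_contra fun h4 ↦ hcon ⟨Fδ, Gδ, δl, δr, h1, h2, h3, h4⟩⟩
  choose Fδ Gδ δl δr hFδ hGδ hsmall hfail using hbad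
  -- A free ultrafilter on the indices replaces all passages to subsequences; 1 / (n + 1) is its
  -- gauge.
  have hle : (hyperfilter ℕ : Filter ℕ) ≤ atTop := Nat.hyperfilter_le_atTop
  have hgauge : Tendsto (fun n : ℕ ↦ 1 / ((n : ℝ) + 1)) (hyperfilter ℕ : Filter ℕ) (𝓝 0) :=
    tendsto_one_div_add_atTop_nhds_zero_nat.mono_left hle
  have hzero : ∀ φ : ℕ → ℝ, (∀ n, |φ n| ≤ c2Norm K (Fδ n) + c2Norm K (Gδ n) + |(δl n).1| +
      |(δl n).2| + |(δr n).1| + |(δr n).2|) → Tendsto φ (hyperfilter ℕ : Filter ℕ) (𝓝 0) :=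
    fun φ hφ ↦ squeeze_zero_norm (fun n ↦ (hφ n).trans (hsmall n).le) hgauge
  have nF := fun n ↦ c2Norm_nonneg K (Fδ n)
  have nG := fun n ↦ c2Norm_nonneg K (Gδ n)
  have n1 := fun n ↦ abs_nonneg (δl n).1
  have n2 := fun n ↦ abs_nonneg (δl n).2
  have n3 := fun n ↦ abs_nonneg (δr n).1
  have n4 := fun n ↦ abs_nonneg (δr n).2
  have tl : Tendsto (fun n ↦ q.1 + δl n) (hyperfilter ℕ : Filter ℕ) (𝓝 q.1) := by
    have : Tendsto δl (hyperfilter ℕ : Filter ℕ) (𝓝 (0, 0)) :=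
      (hzero (fun n ↦ (δl n).1) fun n ↦ by linarith [nF n, nG n, n1 n, n2 n, n3 n, n4 n]).prodMk_nhds
        (hzero (fun n ↦ (δl n).2) fun n ↦ by linarith [nF n, nG n, n1 n, n2 n, n3 n, n4 n])
    have h := this.const_add q.1
    rwa [Prod.mk_zero_zero, add_zero] at h
  have tr : Tendsto (fun n ↦ q.2 + δr n) (hyperfilter ℕ : Filter ℕ) (𝓝 q.2) := by
    have : Tendsto δr (hyperfilter ℕ : Filter ℕ) (𝓝 (0, 0)) :=
      (hzero (fun n ↦ (δr n).1) fun n ↦ by linarith [nF n, nG n, n1 n, n2 n, n3 n, n4 n]).prodMk_nhds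
        (hzero (fun n ↦ (δr n).2) fun n ↦ by linarith [nF n, nG n, n1 n, n2 n, n3 n, n4 n])
    have h := this.const_add q.2
    rwa [Prod.mk_zero_zero, add_zero] at h
  have hpert : Perturb (hyperfilter ℕ) K b₀ F G (fun n ↦ F + Fδ n) (fun n ↦ G + Gδ n) := by
    refine ⟨hK, fun p hp ↦ hreg p (hKU hp), fluxConv_add hK (fun p hp ↦ (hreg p (hKU hp)).F2) hFδ
      (hzero _ fun n ↦ ?_), fluxConv_add hK (fun p hp ↦ (hreg p (hKU hp)).G2) hGδ
      (hzero _ fun n ↦ ?_), fun n ↦ 1 / ((n : ℝ) + 1), fun n ↦ by positivity, hgauge⟩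
    · rw [abs_of_nonneg (nF n)]
      linarith [nF n, nG n, n1 n, n2 n, n3 n, n4 n]
    · rw [abs_of_nonneg (nG n)]
      linarith [nF n, nG n, n1 n, n2 n, n3 n, n4 n]
  have hlK := tl.eventually (mem_interior_iff_mem_nhds.1 hl)
  have hrK := tr.eventually (mem_interior_iff_mem_nhds.1 hr)
  obtain ⟨p, hp, hp'⟩ := hpert.exists_isUniqueDoubleWave hU hKU hreg hgen hgen' hlK tl hrK tr hm
    huniq hdw
  have hdist : Tendsto (fun n ↦ √(((p n).1 - m.1) ^ 2 + ((p n).2 - m.2) ^ 2))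
      (hyperfilter ℕ : Filter ℕ) (𝓝 0) := by
    have := (((hp.fst_nhds.sub_const m.1).pow 2).add ((hp.snd_nhds.sub_const m.2).pow 2)).sqrt
    simpa using this
  obtain ⟨n, e1, e2, e3, e4⟩ := ((hpert.eventually_transverseOn hU hKU hreg hgen hgen' hlK tl hrK
    tr).and (hp'.and ((hp.eventually (isOpen_interior.mem_nhds hm)).and
      (hdist.eventually (gt_mem_nhds hε₂))))).exists
  exact hfail n ⟨e1, p n, e3, e2, e4⟩
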